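/- Fix an integer $k\ge 2$, a significance level $\alpha\in(0,1)$ and constants $\varepsilon,c,\delta>0$. For each $n$ let $\boldsymbol X=\beta\,\boldsymbol v^{\otimes k}+\boldsymbol Z\in\otimes^k\mathbb R^n$, where $\beta=\beta_n\in\mathbb R$, $\boldsymbol v=\boldsymbol v_n\in\mathbb R^n$ is a deterministic unit vector, and the entries of the noise tensor $\boldsymbol Z$ are i.i.d. $\mathcal N(0,1/n)$. For $\boldsymbol w\in\mathbb R^n$ let $\boldsymbol X[\boldsymbol w^{\otimes(k-1)}]\in\mathbb R^n$ be the vector with $i$-th entry $\langle \boldsymbol X,\boldsymbol e_i\otimes\boldsymbol w^{\otimes(k-1)}\rangle$, and $\boldsymbol X[\boldsymbol w^{\otimes k}]=\langle\boldsymbol X,\boldsymbol w^{\otimes k}\rangle$. Given a deterministic unit vector $\boldsymbol u=\boldsymbol u_n$, define the power iteration $$\boldsymbol u_0=\boldsymbol u,\qquad \boldsymbol u_{t+1}=\frac{\boldsymbol X[\boldsymbol u_t^{\otimes(k-1)}]}{\|\boldsymbol X[\boldsymbol u_t^{\otimes(k-1)}]\|_2}.$$ Let $\boldsymbol a=\boldsymbol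 a_n$ be a deterministic unit vector and $T=T_n\in\mathbb N$. Assume that, for all sufficiently large $n$, $$|\langle\boldsymbol u,\boldsymbol v\rangle|\ge \frac{c}{\sqrt n},\qquad |\beta\langle\boldsymbol u,\boldsymbol v\rangle^{k-2}|\ge n^{\varepsilon},\qquad T\ge 1+\frac1\varepsilon\Big(\frac12+\frac{2\log|\beta|}{\log n}\Big),\qquad \langle\boldsymbol a,(\boldsymbol I_n-\boldsymbol v\boldsymbol v^\top)\boldsymbol a\rangle\ge\delta,$$ and that $|\langle\boldsymbol a,\boldsymbol v\rangle|=o(|\beta|^3/\sqrt n)$ as $n\to\infty$. Let $\widehat{\boldsymbol v}=\boldsymbol u_T$, $\widehat\beta=\boldsymbol X[\widehat{\boldsymbol v}^{\otimes k}]$, $z_\alpha=\Phi^{-1}(1-\alpha/2)$ with $\Phi$ the standard Gaussian distribution function, and let $I_n$ be the closed interval whose endpoints (in either order) are $$\frac{1}{1-1/(2\widehat\beta^2)}\left[\langle\boldsymbol a,\widehat{\boldsymbol v}\rangle\pm z_\alpha\frac{\sqrt{\langle\boldsymbol a,(\boldsymbol I_n-\widehat{\boldsymbol v}\widehat{\boldsymbol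 v}^\top)\boldsymbol a\rangle}}{\sqrt n\,\widehat\beta}\right].$$ Then, as $n\to\infty$: 1. if $k$ is odd and $\beta_n>0$ for all large $n$, then $\mathbb P(\langle\boldsymbol a,\boldsymbol v\rangle\in I_n)\to1-\alpha$; 2. if $k$ is odd and $\beta_n<0$ for all large $n$, then $\mathbb P(\langle\boldsymbol a,-\boldsymbol v\rangle\in I_n)\to1-\alpha$; 3. if $k$ is even and $\beta_n>0$ for all large $n$, then $\mathbb P(\langle\boldsymbol a,\operatorname{sgn}(\langle\boldsymbol u,\boldsymbol v\rangle)\boldsymbol v\rangle\in I_n)\to1-\alpha$; 4. if $k$ is even and $\beta_n<0$ for all large $n$, then $\mathbb P(\langle\boldsymbol a,(-1)^{T}\operatorname{sgn}(\langle\boldsymbol u,\boldsymbol v\rangle)\boldsymbol v\rangle\in I_n)\to1-\alpha$. -/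

import Mathlib

open MeasureTheory ProbabilityTheory Filter Topology Asymptotics

noncomputable section

namespace SpikedTensor

/-- Tensors of order `k` over `ℝⁿ`, given by their `n ^ k` entries. -/
abbrev Tensor (k n : ℕ) : Type := (Fin k → Fin n) → ℝ

/-- The entrywise inner product of two tensors. -/
def tensorInner {k n : ℕ} (τ η : Tensor k n) : ℝ := ∑ j : Fin k → Fin n, τ j * η j

/-- The elementary tensor `w 0 ⊗ w 1 ⊗ ⋯ ⊗ w (k - 1)`. -/
def elementary {k n : ℕ} (w : Fin k → EuclideanSpace ℝ (Fin n)) : Tensor k n :=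
  fun j => ∏ l : Fin k, w l (j l)

/-- The tensor power `u ⊗ ⋯ ⊗ u` with `k` factors. -/
def tensorPow (k : ℕ) {n : ℕ} (u : EuclideanSpace ℝ (Fin n)) : Tensor k n :=
  elementary fun _ => u

/-- The vector `X[u^{⊗(k-1)}]`, whose `i`-th entry is `⟨X, e_i ⊗ u ⊗ ⋯ ⊗ u⟩`
(the factor in the first slot is the basis vector `e_i`, all others are `u`). -/
def applyPow {k n : ℕ} (X : Tensor k n) (u : EuclideanSpace ℝ (Fin n)) :
    EuclideanSpace ℝ (Fin n) :=
  WithLp.toLp 2 fun i =>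
    tensorInner X
      (elementary fun l : Fin k => if (l : ℕ) = 0 then EuclideanSpace.single i (1 : ℝ) else u)

/-- Tensor power iteration: `u₀ = u` and `u_{t+1} = X[u_t^{⊗(k-1)}] / ‖X[u_t^{⊗(k-1)}]‖`. -/
def powerIter {k n : ℕ} (X : Tensor k n) (u : EuclideanSpace ℝ (Fin n)) :
    ℕ → EuclideanSpace ℝ (Fin n)
  | 0 => u
  | t + 1 => ‖applyPow X (powerIter X u t)‖⁻¹ • applyPow X (powerIter X u t)

/-- The estimator `β̂ = X[v̂^{⊗k}] = ⟨X, v̂^{⊗k}⟩` of the signal strength. -/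
def betaHat {k n : ℕ} (X : Tensor k n) (vhat : EuclideanSpace ℝ (Fin n)) : ℝ :=
  tensorInner X (tensorPow k vhat)

/-- The rank-one spiked tensor `X = β v^{⊗k} + Z`. -/
def spiked {k n : ℕ} (β : ℝ) (v : EuclideanSpace ℝ (Fin n)) (Z : Tensor k n) : Tensor k n :=
  β • tensorPow k v + Z

/-- The entries of the random tensor `Z` are i.i.d. Gaussian with mean `0` and variance `1/n`. -/
structure IsGaussianNoise {k n : ℕ} {Ω : Type*} [MeasurableSpace Ω] (P : Measure Ω)
    (Z : Ω → Tensor k n) : Prop where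
  indep : iIndepFun (fun (j : Fin k → Fin n) (ω : Ω) => Z ω j) P
  law : ∀ j : Fin k → Fin n, HasLaw (fun ω => Z ω j) (gaussianReal 0 ((n : NNReal)⁻¹)) P

/-- The quadratic form `⟨a, (I - w wᵀ) a⟩`. -/
def residualForm {n : ℕ} (a w : EuclideanSpace ℝ (Fin n)) : ℝ :=
  inner ℝ a (a - inner ℝ w a • w)

/-- The two-sided critical value `Φ⁻¹(1 - α/2)`, with `Φ` the standard Gaussian distribution
function and `Φ⁻¹` its quantile function. -/
def criticalValue (α : ℝ) : ℝ := sInf {x : ℝ | 1 - α / 2 ≤ cdf (gaussianReal 0 1) x}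

/-- The closed interval whose two endpoints are
`(1 - 1/(2β̂²))⁻¹ (⟨a, v̂⟩ ∓ z_α √⟨a, (I - v̂ v̂ᵀ) a⟩ / (√n β̂))`.
It is the interval between these endpoints in whichever order they come, since they are in
decreasing order when `β̂` is negative. -/
def confInterval {n : ℕ} (α : ℝ) (a vhat : EuclideanSpace ℝ (Fin n)) (bhat : ℝ) : Set ℝ :=
  Set.uIcc
    (1 / (1 - 1 / (2 * bhat ^ 2)) *
      (inner ℝ a vhat - criticalValue α * (√(residualForm a vhat) / (√(n : ℝ) * bhat))))
    (1 / (1 - 1 / (2 * bhat ^ 2)) *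
      (inner ℝ a vhat + criticalValue α * (√(residualForm a vhat) / (√(n : ℝ) * bhat))))

/-- The confidence interval computed from the observed tensor `X` by `T` steps of power iteration
started at `u`, that is, from `v̂ = u_T` and `β̂ = X[v̂^{⊗k}]`. -/
def powerInterval {k n : ℕ} (α : ℝ) (X : Tensor k n) (u a : EuclideanSpace ℝ (Fin n)) (T : ℕ) :
    Set ℝ :=
  confInterval α a (powerIter X u T) (betaHat X (powerIter X u T))

end SpikedTensor

end

namespace SpikedTensor

/-! Put m = k - 1 and read the noise as an n × n^m Gaussian matrix, so that one unnormalised step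
from w is β⟨v,w⟩^m v + h(w) with h(w) = Z w^{⊗m}. The difficulty is that the iterates depend on Z.
However, a step reveals Z only on v^{⊗m}, u_0^{⊗m}, u_1^{⊗m}, …; after Gram–Schmidt, Z is still a
fresh Gaussian matrix on the orthogonal complement of the explored vectors (`IsAdapted.map_splice`).
Second moments and Chebyshev then show that over any fixed number of steps Z acts on the explored
span almost isometrically, with images almost orthogonal to v and to b = a - ⟨a,v⟩v, up to O(1/√n)
(`measure_not_isConcentrated_le`).

A sign symmetry reduces to β > 0 and ⟨u,v⟩ > 0. The correlation with v then grows by a factor n^ε/4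
per step until it is of constant order (`IsNoisyTrajectory.growth`), after which 1 - ⟨v,w⟩² =
O(1/β²). Since T has no upper bound while exploration covers boundedly many steps, a net bound
2n^{ε/4} on the norm of the noise as a multilinear form is also needed: it makes the normalised step
a strong contraction on unit vectors of correlation at least 1/2, so all iterates past a fixed
horizon stay negligibly close to the one at the horizon (`IsNoisyTrajectory.isLateIterate`).

If w' is the step from a late iterate w, the noise part of that step has norm close to 1 and the
signal part size close to β, hence 1 - ⟨v,w'⟩ ≈ 1/(2β²): this is the bias removed by the prefactor
of the interval. In direction b, ⟨b,h(w)⟩ = ⟨b,h(v)⟩ + O(1/(β√n)), because w^{⊗m} is close to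
v^{⊗m}. With β̂ = β + O(1/β + 1/√n) this gives (`late_estimate`) √n β̂ (⟨a,v̂⟩ - ⟨a,v⟩(1 -
1/(2β̂²))) = √n⟨b,h(v)⟩ + O(√n|⟨a,v⟩|/β³ + 1/β). The error vanishes by assumption and the main term
is exactly Gaussian with variance ‖b‖² = ⟨a,(I - vvᵀ)a⟩. On the good event the coverage is therefore
squeezed between the events |N| ≤ z_α ± η for a standard normal N (`eventually_pivot_sandwich`), and
continuity of Φ concludes. -/

/-- The law of a family of independent centered Gaussian variables of variance `s`. -/
noncomputable abbrev iidGaussian (κ : Type*) [Fintype κ] (s : NNReal) : Measure (κ → ℝ) :=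
  Measure.pi fun _ => gaussianReal 0 s

/-! ### Linear images of i.i.d. Gaussian families, via characteristic functionals. -/

section Gaussian

variable {κ κ' : Type*} [Fintype κ] [Fintype κ'] [DecidableEq κ] [DecidableEq κ']

lemma charFunDual_iidGaussian (s : NNReal) (l : StrongDual ℝ (κ → ℝ)) :
    charFunDual (iidGaussian κ s) l
      = Complex.exp (-((s * ∑ i, l (Pi.single i 1) ^ 2 : ℝ) : ℂ) / 2) := by
  rw [charFunDual_pi]
  have h : ∀ i, charFunDual (gaussianReal 0 s) (l.comp (.single ℝ (fun _ : κ => ℝ) i))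
      = Complex.exp (-((s * l (Pi.single i 1) ^ 2 : ℝ) : ℂ) / 2) := by
    intro i
    have hl : l.comp (.single ℝ (fun _ : κ => ℝ) i)
        = (l (Pi.single i 1)) • (ContinuousLinearMap.id ℝ ℝ : StrongDual ℝ ℝ) := by
      ext
      simp
    rw [hl, ← charFun_map_eq_charFunDual_smul]
    have : (gaussianReal 0 s).map (ContinuousLinearMap.id ℝ ℝ : StrongDual ℝ ℝ)
        = gaussianReal 0 s := by
      simp
    rw [this, charFun_gaussianReal]
    congr 1
    push_cast
    ring
  simp_rw [h]
  rw [← Complex.exp_sum]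
  congr 1
  push_cast
  rw [Finset.mul_sum, ← Finset.sum_neg_distrib, Finset.sum_div]

lemma map_iidGaussian (s : NNReal) (A : (κ → ℝ) →L[ℝ] (κ' → ℝ)) (s' : NNReal)
    (h : ∀ l : StrongDual ℝ (κ' → ℝ),
      s * ∑ i, l (A (Pi.single i 1)) ^ 2 = s' * ∑ i, l (Pi.single i 1) ^ 2) :
    (iidGaussian κ s).map A = iidGaussian κ' s' := by
  have : IsProbabilityMeasure ((iidGaussian κ s).map A) :=
    Measure.isProbabilityMeasure_map (by fun_prop)
  apply Measure.ext_of_charFunDual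
  ext l
  rw [charFunDual_map, charFunDual_iidGaussian, charFunDual_iidGaussian]
  simp only [ContinuousLinearMap.comp_apply]
  rw [h l]

omit [DecidableEq κ'] in
-- A centred Gaussian law is determined by its covariance form, and independence adds the forms of
-- the two summands. This is what recombines independent pieces of a Gaussian matrix living on
-- complementary directions.
lemma map_prod_iidGaussian (s : NNReal) (A B C : (κ → ℝ) →L[ℝ] (κ' → ℝ))
    (h : ∀ l : StrongDual ℝ (κ' → ℝ),
      ∑ i, l (A (Pi.single i 1)) ^ 2 + ∑ i, l (B (Pi.single i 1)) ^ 2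
        = ∑ i, l (C (Pi.single i 1)) ^ 2) :
    ((iidGaussian κ s).prod (iidGaussian κ s)).map (fun p => A p.1 + B p.2)
      = (iidGaussian κ s).map C := by
  have : IsProbabilityMeasure ((iidGaussian κ s).map C) :=
    Measure.isProbabilityMeasure_map (by fun_prop)
  have h2 : IsProbabilityMeasure
      (((iidGaussian κ s).prod (iidGaussian κ s)).map (A.coprod B)) :=
    Measure.isProbabilityMeasure_map (by fun_prop)
  have hAB : (fun p : (κ → ℝ) × (κ → ℝ) => A p.1 + B p.2) = A.coprod B := by
    ext; simp
  rw [hAB]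
  apply Measure.ext_of_charFunDual
  ext l
  rw [charFunDual_map, charFunDual_map, charFunDual_prod, charFunDual_iidGaussian,
    charFunDual_iidGaussian, charFunDual_iidGaussian, ← Complex.exp_add]
  congr 1
  have := h l
  simp only [ContinuousLinearMap.comp_apply, ContinuousLinearMap.inl_apply,
    ContinuousLinearMap.inr_apply, ContinuousLinearMap.coprod_apply, map_zero, add_zero, zero_add]
  rw [← this]
  push_cast
  ring

/-- A linear combination of independent centered Gaussians is Gaussian. -/
lemma map_sum_iidGaussian (s : NNReal) (c : κ → ℝ) (s' : NNReal) (h : (s' : ℝ) = s * ∑ i, c i ^ 2) :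
    (iidGaussian κ s).map (fun x => ∑ i, c i * x i) = gaussianReal 0 s' := by
  let l : StrongDual ℝ (κ → ℝ) := ∑ i, c i • ContinuousLinearMap.proj i
  have hl : (fun x : κ → ℝ => ∑ i, c i * x i) = l := by
    ext x; simp [l]
  rw [hl]
  have : IsProbabilityMeasure ((iidGaussian κ s).map l) :=
    Measure.isProbabilityMeasure_map (by fun_prop)
  apply Measure.ext_of_charFun
  ext t
  rw [charFun_map_eq_charFunDual_smul, charFunDual_iidGaussian, charFun_gaussianReal]
  congr 1
  have : ∀ i, l (Pi.single i 1) = c i := by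
    intro i
    simp [l, Pi.single_apply]
  have h' : ((s' : ℝ) : ℂ) = (s : ℝ) * ∑ i, (c i : ℂ) ^ 2 := by
    rw [h]
    push_cast
    rfl
  simp only [smul_apply, this, smul_eq_mul, mul_pow, ← Finset.mul_sum]
  push_cast
  rw [h']
  simp
  ring

end Gaussian

/-! ### Scalar Gaussian tails and chi-square moments. -/

lemma gaussianReal_abs_ge_le {s : NNReal} {B : ℝ} (hB : 0 ≤ B) {w : NNReal} (hs : s ≤ w) :
    (gaussianReal 0 s) {x | B ≤ |x|} ≤ ENNReal.ofReal (2 * Real.exp (-B ^ 2 / (2 * w))) := by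
  have h1 : HasSubgaussianMGF (fun x => x) w (gaussianReal 0 s) :=
    ⟨fun t => integrable_exp_mul_gaussianReal t, fun t => by
      rw [mgf_fun_id_gaussianReal]
      simp only [zero_mul, zero_add]
      gcongr⟩
  have h2 := h1.measure_ge_le hB
  have h3 := h1.neg.measure_ge_le hB
  have : {x : ℝ | B ≤ |x|} ⊆ {x | B ≤ x} ∪ {x | B ≤ (-fun x => x) x} := by
    intro x hx
    simpa [le_abs] using hx
  refine (measure_mono this).trans ((measure_union_le _ _).trans ?_)
  rw [two_mul, ENNReal.ofReal_add (by positivity) (by positivity)]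
  gcongr
  · rw [← ofReal_measureReal]
    exact ENNReal.ofReal_le_ofReal h2
  · rw [← ofReal_measureReal]
    exact ENNReal.ofReal_le_ofReal h3

lemma lintegral_sq_gaussianReal (s : NNReal) :
    ∫⁻ x, ENNReal.ofReal (x ^ 2) ∂(gaussianReal 0 s) = s := by
  rw [← ofReal_integral_eq_lintegral_ofReal]
  · have := variance_fun_id_gaussianReal (μ := 0) (v := s)
    rw [variance_of_integral_eq_zero (by fun_prop) (by simp)] at this
    simp only [this]
    simp
  · exact (memLp_id_gaussianReal' 2 (by simp)).integrable_sq
  · exact Eventually.of_forall fun x => sq_nonneg x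

/-- The mean of the sum of squares is exactly 1 and its n independent terms have variance of order
1/n² each. The constant stays a symbolic variance: only its independence of n matters. -/
lemma lintegral_sq_sum_sq_sub (n : ℕ) (hn : 0 < n) :
    ∫⁻ x, ENNReal.ofReal ((∑ i, x i ^ 2 - 1) ^ 2) ∂(iidGaussian (Fin n) ((n : NNReal)⁻¹))
      = ENNReal.ofReal (Var[fun x => x ^ 2; gaussianReal 0 1] / n) := by
  have hn' : (n : ℝ) ≠ 0 := by positivity
  set s : NNReal := (n : NNReal)⁻¹
  have hm : MemLp (fun x : ℝ => x ^ 2) 2 (gaussianReal 0 s) := by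
    have := memLp_id_gaussianReal' (μ := 0) (v := s) 4 (by simp)
    have h2 := this.norm_rpow_div (q := 2)
    have h3 : (4 / 2 : ENNReal) = 2 := by
      rw [show (4 : ENNReal) = 2 * 2 by norm_num]
      exact ENNReal.mul_div_cancel_right (by simp) (by simp)
    rw [h3] at h2
    simpa using h2
  have hvar : Var[fun x => x ^ 2; gaussianReal 0 s]
      = Var[fun x => x ^ 2; gaussianReal 0 1] / n ^ 2 := by
    have : gaussianReal 0 s = (gaussianReal 0 1).map (fun x => (√(n : ℝ))⁻¹ * x) := by
      rw [gaussianReal_map_const_mul]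
      congr 1
      · simp
      · ext
        simp [s]
    rw [this, variance_map (by fun_prop) (by fun_prop)]
    have : (fun x : ℝ => x ^ 2) ∘ (fun x => (√(n : ℝ))⁻¹ * x) = fun x => (n : ℝ)⁻¹ * x ^ 2 := by
      ext x
      simp only [Function.comp, mul_pow, inv_pow]
      rw [Real.sq_sqrt (by positivity)]
    rw [this, variance_const_mul]
    field_simp
  have hv := variance_sum_pi (μ := fun _ : Fin n => gaussianReal 0 s)
    (X := fun _ x => x ^ 2) (fun _ => hm)
  have hm' : MemLp (∑ i, fun x : Fin n → ℝ => x i ^ 2) 2 (iidGaussian (Fin n) s) := by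
    apply memLp_finsetSum'
    intro i _
    exact hm.comp_measurePreserving (measurePreserving_eval (fun _ : Fin n => gaussianReal 0 s) i)
  have hmean : (iidGaussian (Fin n) s)[∑ i, fun x : Fin n → ℝ => x i ^ 2] = 1 := by
    simp only [Finset.sum_apply]
    rw [integral_finsetSum]
    · have : ∀ i, ∫ x : Fin n → ℝ, x i ^ 2 ∂(iidGaussian (Fin n) s) = s := by
        intro i
        rw [integral_comp_eval (μ := fun _ : Fin n => gaussianReal 0 s) (i := i)
          (f := fun x : ℝ => x ^ 2) (by fun_prop)]
        have := variance_fun_id_gaussianReal (μ := 0) (v := s)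
        rwa [variance_of_integral_eq_zero (by fun_prop) (by simp)] at this
      simp [this, s, hn']
    · intro i _
      exact (hm.comp_measurePreserving
        (measurePreserving_eval (fun _ : Fin n => gaussianReal 0 s) i)).integrable (by norm_num)
  rw [← ofReal_integral_eq_lintegral_ofReal]
  · congr 1
    rw [variance_eq_integral hm'.aemeasurable, hmean] at hv
    simp only [Finset.sum_apply, hvar] at hv
    rw [hv]
    simp
    field_simp
  · have := (hm'.sub (memLp_const 1)).integrable_sq
    simpa using this
  · exact Eventually.of_forall fun x => sq_nonneg _


/-! ### Projections onto initial segments of a Gram–Schmidt sequence. -/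

section PartialProjection

variable {V : Type*} [NormedAddCommGroup V] [InnerProductSpace ℝ V]

/-- The map `x ↦ ∑_{i < j} ⟪q i, x⟫ q i`, the orthogonal projection onto the span of the first `j`
vectors when these are orthonormal or zero. -/
noncomputable def partialProj (q : ℕ → V) (j : ℕ) : V →ₗ[ℝ] V :=
  ∑ i ∈ Finset.range j, (innerₛₗ ℝ (q i)).smulRight (q i)

lemma partialProj_apply (q : ℕ → V) (j : ℕ) (x : V) :
    partialProj q j x = ∑ i ∈ Finset.range j, inner ℝ (q i) x • q i := by
  simp [partialProj]

/-- Pairwise orthogonal vectors each of which is a unit vector or zero. -/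
structure IsOrthonormalOrZero (q : ℕ → V) : Prop where
  orthogonal : ∀ i j, i ≠ j → inner ℝ (q i) (q j) = 0
  norm_eq : ∀ i, ‖q i‖ = 1 ∨ q i = 0

namespace IsOrthonormalOrZero

variable {q : ℕ → V} (hq : IsOrthonormalOrZero q)
include hq

lemma partialProj_self_of_lt {i j : ℕ} (h : i < j) : partialProj q j (q i) = q i := by
  rw [partialProj_apply, Finset.sum_eq_single_of_mem i (by simpa using h)]
  · rcases hq.norm_eq i with h | h
    · simp [h]
    · simp [h]
  · intro l _ hl
    simp [hq.orthogonal l i hl]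

lemma partialProj_self_of_le {i j : ℕ} (h : j ≤ i) : partialProj q j (q i) = 0 := by
  rw [partialProj_apply]
  refine Finset.sum_eq_zero fun l hl => ?_
  rw [hq.orthogonal l i (by simp at hl; omega), zero_smul]

lemma inner_partialProj (j : ℕ) (x : V) {i : ℕ} (h : i < j) :
    inner ℝ (q i) (partialProj q j x) = inner ℝ (q i) x := by
  rw [partialProj_apply, inner_sum, Finset.sum_eq_single_of_mem i (by simpa using h)]
  · rcases hq.norm_eq i with h | h
    · simp [inner_smul_right, h]
    · simp [h]
  · intro l _ hl
    simp [inner_smul_right, hq.orthogonal i l hl.symm]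

lemma norm_partialProj_sq (j : ℕ) (x : V) :
    ‖partialProj q j x‖ ^ 2 = ∑ i ∈ Finset.range j, inner ℝ (q i) x ^ 2 := by
  rw [← real_inner_self_eq_norm_sq]
  nth_rw 1 [partialProj_apply]
  rw [sum_inner]
  refine Finset.sum_congr rfl fun i hi => ?_
  rw [inner_smul_left, hq.inner_partialProj j x (by simpa using hi)]
  simp [sq]

lemma norm_sub_partialProj_sq (j : ℕ) (x : V) :
    ‖x - partialProj q j x‖ ^ 2 = ‖x‖ ^ 2 - ∑ i ∈ Finset.range j, inner ℝ (q i) x ^ 2 := by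
  rw [norm_sub_sq_real, hq.norm_partialProj_sq, partialProj_apply, inner_sum]
  have : ∀ i, inner ℝ x (inner ℝ (q i) x • q i) = inner ℝ (q i) x ^ 2 := by
    intro i
    rw [inner_smul_right, real_inner_comm x (q i), sq]
  simp_rw [this]
  ring

lemma norm_inner_smul_sq (j : ℕ) (x : V) :
    ‖inner ℝ (q j) x • q j‖ ^ 2 = inner ℝ (q j) x ^ 2 := by
  rw [norm_smul, mul_pow, Real.norm_eq_abs, sq_abs]
  rcases hq.norm_eq j with h | h <;> simp [h]

end IsOrthonormalOrZero

open InnerProductSpace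

lemma isOrthonormalOrZero_gramSchmidtNormed (f : ℕ → V) :
    IsOrthonormalOrZero (gramSchmidtNormed ℝ f) where
  orthogonal i j h := by
    simp [gramSchmidtNormed, inner_smul_left, inner_smul_right, gramSchmidt_orthogonal ℝ f h]
  norm_eq i := by
    by_cases h : gramSchmidtNormed ℝ f i = 0
    · exact Or.inr h
    · exact Or.inl (gramSchmidtNormed_unit_length' h)

lemma gramSchmidt_eq_sub_partialProj (f : ℕ → V) (n : ℕ) :
    gramSchmidt ℝ f n = f n - partialProj (gramSchmidtNormed ℝ f) n (f n) := by
  rw [gramSchmidt_def, partialProj_apply, Nat.Iio_eq_range]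
  congr 1
  refine Finset.sum_congr rfl fun i _ => ?_
  rw [Submodule.starProjection_singleton, gramSchmidtNormed, inner_smul_left, smul_smul]
  congr 1
  simp
  ring

lemma gramSchmidtNormed_eq (f : ℕ → V) (n : ℕ) :
    gramSchmidtNormed ℝ f n = ‖f n - partialProj (gramSchmidtNormed ℝ f) n (f n)‖⁻¹ •
      (f n - partialProj (gramSchmidtNormed ℝ f) n (f n)) := by
  rw [← gramSchmidt_eq_sub_partialProj]
  rfl

/-- Each input lies in the span of the Gram–Schmidt vectors up to its own index, on which the
projection is the identity. Linearly dependent inputs produce zero vectors, which is why zeros are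
tolerated throughout. -/
lemma partialProj_gramSchmidtNormed (f : ℕ → V) {i j : ℕ} (h : i < j) :
    partialProj (gramSchmidtNormed ℝ f) j (f i) = f i := by
  have hq := isOrthonormalOrZero_gramSchmidtNormed f
  have h1 : f i ∈ Submodule.span ℝ (gramSchmidtNormed ℝ f '' Set.Iic i) := by
    rw [span_gramSchmidtNormed]
    exact mem_span_gramSchmidt ℝ f le_rfl
  refine Submodule.span_induction (p := fun x _ => partialProj (gramSchmidtNormed ℝ f) j x = x)
    ?_ ?_ ?_ ?_ h1
  · rintro x ⟨l, hl, rfl⟩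
    exact hq.partialProj_self_of_lt (lt_of_le_of_lt hl h)
  · simp
  · intro x y _ _ hx hy
    rw [map_add, hx, hy]
  · intro a x _ hx
    rw [map_smul, hx]

/-- Gram–Schmidt is causal, which lets adaptedness pass from the exploration sequence to its
orthonormalisation. -/
lemma gramSchmidtNormed_congr {f g : ℕ → V} {n : ℕ} (h : ∀ i ≤ n, f i = g i) :
    gramSchmidtNormed ℝ f n = gramSchmidtNormed ℝ g n := by
  induction n using Nat.strong_induction_on with
  | _ n ih =>
    have : partialProj (gramSchmidtNormed ℝ f) n (f n)
        = partialProj (gramSchmidtNormed ℝ g) n (g n) := by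
      rw [partialProj_apply, partialProj_apply]
      refine Finset.sum_congr rfl fun i hi => ?_
      rw [ih i (by simpa using hi) (fun l hl => h l (by simp at hi; omega)), h n le_rfl]
    rw [gramSchmidtNormed_eq, gramSchmidtNormed_eq, this, h n le_rfl]

lemma measurable_gramSchmidtNormed [MeasurableSpace V] [BorelSpace V] [FiniteDimensional ℝ V]
    {Ω : Type*} [MeasurableSpace Ω] {f : ℕ → Ω → V} (hf : ∀ i, Measurable (f i)) (n : ℕ) :
    Measurable fun ω => gramSchmidtNormed ℝ (fun i => f i ω) n := by
  induction n using Nat.strong_induction_on with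
  | _ n ih =>
    have : Measurable fun ω => f n ω
        - partialProj (gramSchmidtNormed ℝ fun i => f i ω) n (f n ω) := by
      simp_rw [partialProj_apply]
      refine (hf n).sub (Finset.measurable_sum _ fun i hi => ?_)
      have h1 := ih i (by simpa using hi)
      exact (h1.inner (hf n)).smul h1
    simp_rw [gramSchmidtNormed_eq (fun i => f i _) n]
    exact this.norm.inv.smul this

end PartialProjection

/-! ### Matrices as operators, and right multiplication of Gaussian matrices. -/

section Operator

variable {I J : Type*} [Fintype J]

/-- The operator with matrix `Z`. -/
noncomputable def op (Z : I × J → ℝ) : EuclideanSpace ℝ J →ₗ[ℝ] EuclideanSpace ℝ I where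
  toFun q := WithLp.toLp 2 fun i => ∑ j, Z (i, j) * q j
  map_add' x y := by
    ext i
    simp [mul_add, Finset.sum_add_distrib]
  map_smul' a x := by
    ext i
    simp only [PiLp.smul_apply, smul_eq_mul, RingHom.id_apply, Finset.mul_sum]
    exact Finset.sum_congr rfl fun j _ => by ring

@[simp]
lemma op_apply (Z : I × J → ℝ) (q : EuclideanSpace ℝ J) (i : I) :
    op Z q i = ∑ j, Z (i, j) * q j := rfl

lemma op_add (Z W : I × J → ℝ) (q : EuclideanSpace ℝ J) : op (Z + W) q = op Z q + op W q := by
  ext i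
  simp [add_mul, Finset.sum_add_distrib]

lemma measurable_op {Ω : Type*} [MeasurableSpace Ω] {Z : Ω → I × J → ℝ}
    {q : Ω → EuclideanSpace ℝ J} (hZ : Measurable Z) (hq : Measurable q) :
    Measurable fun ω => op (Z ω) (q ω) := by
  refine (MeasurableEquiv.toLp 2 (I → ℝ)).measurable.comp (measurable_pi_iff.2 fun i => ?_)
  refine Finset.measurable_sum _ fun j _ => ?_
  have h1 : Measurable fun ω => Z ω (i, j) := (measurable_pi_apply _).comp hZ
  have h2 : Measurable fun ω => q ω j :=
    (measurable_pi_apply j).comp ((MeasurableEquiv.toLp 2 (J → ℝ)).symm.measurable.comp hq)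
  exact h1.mul h2

variable [DecidableEq J]

/-- The matrix of the composition of the operator `op Z` with `R`. -/
noncomputable def mulOp (R : EuclideanSpace ℝ J →ₗ[ℝ] EuclideanSpace ℝ J) :
    (I × J → ℝ) →ₗ[ℝ] (I × J → ℝ) where
  toFun Z p := ∑ j, Z (p.1, j) * R (EuclideanSpace.single p.2 1) j
  map_add' x y := by
    ext p
    simp [add_mul, Finset.sum_add_distrib]
  map_smul' a x := by
    ext p
    simp only [Pi.smul_apply, smul_eq_mul, RingHom.id_apply, Finset.mul_sum]
    exact Finset.sum_congr rfl fun j _ => by ring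

lemma mulOp_apply (R : EuclideanSpace ℝ J →ₗ[ℝ] EuclideanSpace ℝ J) (Z : I × J → ℝ) (p : I × J) :
    mulOp R Z p = ∑ j, Z (p.1, j) * R (EuclideanSpace.single p.2 1) j := rfl

lemma sum_smul_map_single (R : EuclideanSpace ℝ J →ₗ[ℝ] EuclideanSpace ℝ J) (x : J → ℝ) (j : J) :
    ∑ l, x l * R (EuclideanSpace.single l 1) j = R (WithLp.toLp 2 x) j := by
  have : WithLp.toLp 2 x = ∑ l, x l • EuclideanSpace.single l (1 : ℝ) := by
    ext i
    simp [Pi.single_apply]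
  rw [this, map_sum]
  simp

lemma op_mulOp (R : EuclideanSpace ℝ J →ₗ[ℝ] EuclideanSpace ℝ J) (Z : I × J → ℝ)
    (x : EuclideanSpace ℝ J) : op (mulOp R Z) x = op Z (R x) := by
  ext i
  simp only [op_apply, mulOp_apply, Finset.sum_mul]
  rw [Finset.sum_comm]
  refine Finset.sum_congr rfl fun j _ => ?_
  have := sum_smul_map_single R x j
  rw [WithLp.toLp_ofLp] at this
  rw [← this, Finset.mul_sum]
  exact Finset.sum_congr rfl fun l _ => by ring

lemma ext_op {Z W : I × J → ℝ} (h : ∀ x, op Z x = op W x) : Z = W := by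
  ext p
  have := congrArg (fun y : EuclideanSpace ℝ I => y p.1) (h (EuclideanSpace.single p.2 1))
  simpa [Pi.single_apply] using this

variable [Fintype I] [DecidableEq I]

/-- Right multiplication acts row by row, so dually `R` is applied to each row of `l`. Hence the
covariance of a multiplied Gaussian matrix sees `R` only through x ↦ ‖R x‖². -/
lemma sum_dual_mulOp_sq (R : EuclideanSpace ℝ J →ₗ[ℝ] EuclideanSpace ℝ J)
    (l : StrongDual ℝ (I × J → ℝ)) :
    ∑ p, l (mulOp R (Pi.single p 1)) ^ 2
      = ∑ i, ‖R (WithLp.toLp 2 fun j => l (Pi.single (i, j) 1))‖ ^ 2 := by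
  rw [Fintype.sum_prod_type]
  refine Finset.sum_congr rfl fun i _ => ?_
  rw [EuclideanSpace.norm_sq_eq]
  refine Finset.sum_congr rfl fun j _ => ?_
  rw [Real.norm_eq_abs, sq_abs, ← sum_smul_map_single]
  congr 1
  have : mulOp R (Pi.single (i, j) 1)
      = ∑ j', (R (EuclideanSpace.single j' 1) j) • (Pi.single (i, j') 1 : I × J → ℝ) := by
    ext ⟨i', j'⟩
    simp only [mulOp_apply, Pi.single_apply, Prod.mk.injEq, Finset.sum_apply, Pi.smul_apply,
      smul_eq_mul]
    by_cases h : i' = i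
    · simp [h]
    · simp [h]
  rw [this, map_sum]
  exact Finset.sum_congr rfl fun _ _ => by rw [map_smul, smul_eq_mul, mul_comm]

/-- Right multiplication of independent Gaussian matrices by operators `R₁`, `R₂`: the law of the
sum depends only on the quadratic form `‖R₁ x‖² + ‖R₂ x‖²`. -/
lemma map_prod_mulOp (s : NNReal) (R₁ R₂ R₃ : EuclideanSpace ℝ J →ₗ[ℝ] EuclideanSpace ℝ J)
    (h : ∀ x, ‖R₁ x‖ ^ 2 + ‖R₂ x‖ ^ 2 = ‖R₃ x‖ ^ 2) :
    ((iidGaussian (I × J) s).prod (iidGaussian (I × J) s)).map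
        (fun p => mulOp R₁ p.1 + mulOp R₂ p.2)
      = (iidGaussian (I × J) s).map (mulOp R₃) := by
  refine map_prod_iidGaussian s (mulOp R₁).toContinuousLinearMap (mulOp R₂).toContinuousLinearMap
    (mulOp R₃).toContinuousLinearMap fun l => ?_
  simp only [LinearMap.coe_toContinuousLinearMap']
  rw [sum_dual_mulOp_sq, sum_dual_mulOp_sq, sum_dual_mulOp_sq, ← Finset.sum_add_distrib]
  exact Finset.sum_congr rfl fun i _ => h _

end Operator

end SpikedTensor

set_option linter.unusedSectionVars false

namespace SpikedTensor

open InnerProductSpace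

/-! ### Adaptive exploration: the unexplored part of the noise stays fresh. -/

section Resampling

variable {I J : Type*} [Fintype I] [Fintype J] [DecidableEq I] [DecidableEq J]

/-- `Z` on the span of the first `j` vectors of `q`, and `W` on its orthogonal complement. -/
noncomputable def splice (q : ℕ → EuclideanSpace ℝ J) (j : ℕ) (Z W : I × J → ℝ) : I × J → ℝ :=
  mulOp (partialProj q j) Z + mulOp (LinearMap.id - partialProj q j) W

lemma op_splice (q : ℕ → EuclideanSpace ℝ J) (j : ℕ) (Z W : I × J → ℝ) (x : EuclideanSpace ℝ J) :
    op (splice q j Z W) x = op Z (partialProj q j x) + op W (x - partialProj q j x) := by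
  rw [splice, op_add, op_mulOp, op_mulOp]
  simp

lemma measurable_splice {Ω : Type*} [MeasurableSpace Ω] {q : ℕ → Ω → EuclideanSpace ℝ J} (j : ℕ)
    (hq : ∀ i, Measurable (q i)) {Z W : Ω → I × J → ℝ} (hZ : Measurable Z) (hW : Measurable W) :
    Measurable fun ω => splice (fun i => q i ω) j (Z ω) (W ω) := by
  have hP : ∀ x, Measurable fun ω => partialProj (fun i => q i ω) j x := by
    intro x
    simp_rw [partialProj_apply]
    exact Finset.measurable_sum _ fun i _ => Measurable.fun_smul ((hq i).inner measurable_const) (hq i)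
  refine measurable_pi_iff.2 fun p => ?_
  have h1 : ∀ ω, splice (fun i => q i ω) j (Z ω) (W ω) p
      = ∑ l, Z ω (p.1, l) * partialProj (fun i => q i ω) j (EuclideanSpace.single p.2 1) l
        + ∑ l, W ω (p.1, l) * (EuclideanSpace.single p.2 (1 : ℝ)
          - partialProj (fun i => q i ω) j (EuclideanSpace.single p.2 1)) l := fun ω => rfl
  simp_rw [h1]
  have hev : ∀ (l : J) (y : Ω → EuclideanSpace ℝ J), Measurable y → Measurable fun ω => y ω l :=
    fun l y hy => (measurable_pi_apply l).comp
      ((MeasurableEquiv.toLp 2 (J → ℝ)).symm.measurable.comp hy)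
  refine (Finset.measurable_sum _ fun l _ => ?_).add (Finset.measurable_sum _ fun l _ => ?_)
  · exact ((measurable_pi_apply _).comp hZ).mul (hev l _ (hP _))
  · exact ((measurable_pi_apply _).comp hW).mul (hev l _ (measurable_const.sub (hP _)))

/-- A sequence of exploration vectors `f j Z`, where `f j` depends on `Z` only through
the previously observed vectors `op Z (f i Z)`, `i < j`. -/
structure IsAdapted (f : ℕ → (I × J → ℝ) → EuclideanSpace ℝ J) : Prop where
  measurable : ∀ j, Measurable (f j)
  adapted : ∀ j Z Z', (∀ i < j, op Z' (f i Z) = op Z (f i Z)) → f j Z' = f j Z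

/-- The normalized Gram–Schmidt vectors of an exploration sequence. -/
noncomputable def explored (f : ℕ → (I × J → ℝ) → EuclideanSpace ℝ J) (Z : I × J → ℝ) :
    ℕ → EuclideanSpace ℝ J :=
  gramSchmidtNormed ℝ fun i => f i Z

variable {f : ℕ → (I × J → ℝ) → EuclideanSpace ℝ J}

lemma isOrthonormalOrZero_explored (Z : I × J → ℝ) : IsOrthonormalOrZero (explored f Z) :=
  isOrthonormalOrZero_gramSchmidtNormed _

namespace IsAdapted

variable (hf : IsAdapted f)
include hf

lemma measurable_explored (j : ℕ) : Measurable fun Z => explored f Z j :=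
  measurable_gramSchmidtNormed hf.measurable j

/-- The spliced matrix agrees with `Z` on the first `j` exploration vectors, hence yields the same
observations and, by adaptedness, the same choices up to index `j` inclusive. -/
lemma splice_apply (j : ℕ) (Z W : I × J → ℝ) {i : ℕ} (hi : i ≤ j) :
    f i (splice (explored f Z) j Z W) = f i Z := by
  refine hf.adapted i _ _ fun l hl => ?_
  rw [op_splice, explored, partialProj_gramSchmidtNormed _ (by omega), sub_self, map_zero, add_zero]

lemma explored_splice (j : ℕ) (Z W : I × J → ℝ) {i : ℕ} (hi : i ≤ j) :
    explored f (splice (explored f Z) j Z W) i = explored f Z i :=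
  gramSchmidtNormed_congr fun _ hl => hf.splice_apply j Z W (hl.trans hi)

lemma op_splice_explored_lt (j : ℕ) (Z W : I × J → ℝ) {i : ℕ} (hi : i < j) :
    op (splice (explored f Z) j Z W) (explored f (splice (explored f Z) j Z W) i)
      = op Z (explored f Z i) := by
  rw [hf.explored_splice j Z W hi.le, op_splice,
    (isOrthonormalOrZero_explored Z).partialProj_self_of_lt hi, sub_self, map_zero, add_zero]

lemma op_splice_explored (j : ℕ) (Z W : I × J → ℝ) :
    op (splice (explored f Z) j Z W) (explored f (splice (explored f Z) j Z W) j)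
      = op W (explored f Z j) := by
  rw [hf.explored_splice j Z W le_rfl, op_splice,
    (isOrthonormalOrZero_explored Z).partialProj_self_of_le le_rfl, sub_zero, map_zero, zero_add]

/-- Both splices use the same directions, those of `Z`. What results is a three-way split: `Z` on
the first `j` directions, `W` on the next one, `W'` on the rest. -/
lemma splice_splice_succ (j : ℕ) (Z W W' : I × J → ℝ) :
    splice (explored f (splice (explored f Z) j Z W)) (j + 1) (splice (explored f Z) j Z W) W'
      = mulOp (partialProj (explored f Z) j) Z
        + (mulOp (partialProj (explored f Z) (j + 1) - partialProj (explored f Z) j) W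
          + mulOp (LinearMap.id - partialProj (explored f Z) (j + 1)) W') := by
  have hq := isOrthonormalOrZero_explored (f := f) Z
  have hP : partialProj (explored f (splice (explored f Z) j Z W)) (j + 1)
      = partialProj (explored f Z) (j + 1) := by
    ext1 x
    rw [partialProj_apply, partialProj_apply]
    refine Finset.sum_congr rfl fun i hi => ?_
    rw [hf.explored_splice j Z W (by simp at hi; omega)]
  refine ext_op fun x => ?_
  rw [op_splice, op_splice, op_add, op_add, op_mulOp, op_mulOp, op_mulOp, hP, add_assoc]
  have h1 : partialProj (explored f Z) j (partialProj (explored f Z) (j + 1) x)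
      = partialProj (explored f Z) j x := by
    rw [partialProj_apply, partialProj_apply _ j x]
    refine Finset.sum_congr rfl fun i hi => ?_
    rw [hq.inner_partialProj (j + 1) x (by simp at hi; omega)]
  rw [h1]
  simp

/-- Resampling the unexplored part of a Gaussian matrix does not change its law. -/
theorem map_splice (s : NNReal) (j : ℕ) :
    ((iidGaussian (I × J) s).prod (iidGaussian (I × J) s)).map
        (fun p => splice (explored f p.1) j p.1 p.2)
      = iidGaussian (I × J) s := by
  set μ := iidGaussian (I × J) s
  have hmeas : ∀ j, Measurable fun p : (I × J → ℝ) × (I × J → ℝ) =>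
      splice (explored f p.1) j p.1 p.2 := fun j =>
    measurable_splice (q := fun i (p : (I × J → ℝ) × (I × J → ℝ)) => explored f p.1 i) j
      (fun i => (hf.measurable_explored i).comp measurable_fst) measurable_fst measurable_snd
  induction j with
  | zero =>
    have : (fun p : (I × J → ℝ) × (I × J → ℝ) => splice (explored f p.1) 0 p.1 p.2)
        = Prod.snd := by
      ext1 p
      refine ext_op fun x => ?_
      rw [op_splice]
      simp [partialProj_apply]
    rw [this]
    exact measurePreserving_snd.map_eq
  | succ j ih =>
    -- Induction hypothesis in integrated form: the base matrix may itself be replaced by a splice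
    -- at level `j`, which isolates the newly explored direction.
    have key : ∀ G : (I × J → ℝ) → ENNReal, Measurable G →
        ∫⁻ Z, G Z ∂μ = ∫⁻ Z, ∫⁻ W, G (splice (explored f Z) j Z W) ∂μ ∂μ := by
      intro G hG
      conv_lhs => rw [← ih]
      rw [lintegral_map hG (hmeas j)]
      exact lintegral_prod _ (hG.comp (hmeas j)).aemeasurable
    ext A hA
    rw [Measure.map_apply (hmeas _) hA, Measure.prod_apply (hmeas _ hA),
      key _ (measurable_measure_prodMk_left (hmeas _ hA))]
    conv_rhs => rw [← ih, Measure.map_apply (hmeas _) hA, Measure.prod_apply (hmeas _ hA)]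
    -- With `Z` frozen the directions are deterministic, so it remains to merge two independent
    -- Gaussian matrices supported on complementary directions.
    refine lintegral_congr fun Z => ?_
    set P := partialProj (explored f Z) j
    set P' := partialProj (explored f Z) (j + 1)
    have hq := isOrthonormalOrZero_explored (f := f) Z
    set B : Set (I × J → ℝ) := (fun W => mulOp P Z + W) ⁻¹' A
    have hB : MeasurableSet B := (measurable_const.add measurable_id) hA
    have hlaw := map_prod_mulOp (I := I) s (P' - P) (LinearMap.id - P') (LinearMap.id - P) (by
      intro x
      have h1 : (P' - P) x = inner ℝ (explored f Z j) x • explored f Z j := by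
        simp [P, P', partialProj_apply, Finset.sum_range_succ]
      rw [h1, hq.norm_inner_smul_sq]
      simp only [LinearMap.sub_apply, LinearMap.id_apply, P, P', hq.norm_sub_partialProj_sq,
        Finset.sum_range_succ]
      ring)
    have hm1 : ∀ R : EuclideanSpace ℝ J →ₗ[ℝ] EuclideanSpace ℝ J,
        Measurable (mulOp (I := I) R) := fun R =>
      (mulOp (I := I) R).toContinuousLinearMap.continuous.measurable
    have hm2 : Measurable fun p : (I × J → ℝ) × (I × J → ℝ) =>
        mulOp (P' - P) p.1 + mulOp (LinearMap.id - P') p.2 :=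
      ((hm1 _).comp measurable_fst).add ((hm1 _).comp measurable_snd)
    have h2 := congrArg (fun ν => ν B) hlaw
    simp only [Measure.map_apply hm2 hB, Measure.map_apply (hm1 _) hB] at h2
    rw [Measure.prod_apply (hm2 hB)] at h2
    refine Eq.trans (lintegral_congr fun W => ?_) (h2.trans ?_)
    · congr 1
      ext W'
      simp only [Set.mem_preimage, hf.splice_splice_succ, B, P, P']
    · congr 1

/-- Conditioning on the past: `F` may use whatever splicing preserves, and the next observation is
then that of an independent copy `W` in a direction fixed by `Z`. -/
lemma lintegral_op_explored (s : NNReal) (j : ℕ)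
    {F : (I × J → ℝ) → EuclideanSpace ℝ I → ENNReal} (hF : Measurable (Function.uncurry F))
    (hF' : ∀ Z W x, F (splice (explored f Z) j Z W) x = F Z x) :
    ∫⁻ Z, F Z (op Z (explored f Z j)) ∂(iidGaussian (I × J) s)
      = ∫⁻ Z, ∫⁻ W, F Z (op W (explored f Z j)) ∂(iidGaussian (I × J) s)
          ∂(iidGaussian (I × J) s) := by
  have hm : Measurable fun Z : I × J → ℝ => F Z (op Z (explored f Z j)) :=
    hF.comp (measurable_id.prodMk (measurable_op measurable_id (hf.measurable_explored j)))
  have hm2 : Measurable fun p : (I × J → ℝ) × (I × J → ℝ) =>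
      splice (explored f p.1) j p.1 p.2 :=
    measurable_splice (q := fun i (p : (I × J → ℝ) × (I × J → ℝ)) => explored f p.1 i) j
      (fun i => (hf.measurable_explored i).comp measurable_fst) measurable_fst measurable_snd
  conv_lhs => rw [← hf.map_splice s j]
  rw [lintegral_map hm hm2]
  refine (lintegral_prod _ (hm.comp hm2).aemeasurable).trans ?_
  simp only [Function.comp, hF', hf.op_splice_explored]

end IsAdapted

end Resampling

/-! ### Second moments of a Gaussian matrix applied to a fixed vector. -/

section Moments

variable {I J : Type*} [Fintype I] [Fintype J] [DecidableEq I] [DecidableEq J]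

lemma inner_op (W : I × J → ℝ) (y : EuclideanSpace ℝ I) (q : EuclideanSpace ℝ J) :
    inner ℝ y (op W q) = ∑ p : I × J, (y p.1 * q p.2) * W p := by
  rw [Fintype.sum_prod_type, PiLp.inner_apply]
  refine Finset.sum_congr rfl fun i _ => ?_
  simp only [op_apply, RCLike.inner_apply, conj_trivial, Finset.sum_mul]
  exact Finset.sum_congr rfl fun j _ => by ring

lemma map_inner_op (s : NNReal) (y : EuclideanSpace ℝ I) (q : EuclideanSpace ℝ J) (s' : NNReal)
    (hs : (s' : ℝ) = s * (‖y‖ ^ 2 * ‖q‖ ^ 2)) :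
    (iidGaussian (I × J) s).map (fun W => inner ℝ y (op W q)) = gaussianReal 0 s' := by
  simp_rw [inner_op]
  refine map_sum_iidGaussian s _ s' ?_
  rw [hs, EuclideanSpace.norm_sq_eq, EuclideanSpace.norm_sq_eq, Fintype.sum_prod_type,
    Finset.sum_mul_sum]
  simp [mul_pow]

lemma measurable_op_const (q : EuclideanSpace ℝ J) : Measurable fun W : I × J → ℝ => op W q :=
  measurable_op measurable_id measurable_const

lemma lintegral_inner_op_sq (s : NNReal) (y : EuclideanSpace ℝ I) (q : EuclideanSpace ℝ J) :
    ∫⁻ W, ENNReal.ofReal (inner ℝ y (op W q) ^ 2) ∂(iidGaussian (I × J) s)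
      = ENNReal.ofReal (s * (‖y‖ ^ 2 * ‖q‖ ^ 2)) := by
  have h := map_inner_op s y q ⟨s * (‖y‖ ^ 2 * ‖q‖ ^ 2), by positivity⟩ rfl
  have h2 := lintegral_sq_gaussianReal ⟨s * (‖y‖ ^ 2 * ‖q‖ ^ 2), by positivity⟩
  rw [← h, lintegral_map (by fun_prop) (measurable_const.inner (measurable_op_const q))] at h2
  rw [h2, ENNReal.ofReal]
  congr 1
  exact (Real.toNNReal_of_nonneg _).symm

lemma lintegral_norm_op_sq (s : NNReal) (q : EuclideanSpace ℝ J) :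
    ∫⁻ W, ENNReal.ofReal (‖op W q‖ ^ 2) ∂(iidGaussian (I × J) s)
      = ENNReal.ofReal (Fintype.card I * (s * ‖q‖ ^ 2)) := by
  have h : ∀ W : I × J → ℝ, ENNReal.ofReal (‖op W q‖ ^ 2)
      = ∑ i, ENNReal.ofReal (inner ℝ (EuclideanSpace.single i (1 : ℝ)) (op W q) ^ 2) := by
    intro W
    rw [EuclideanSpace.norm_sq_eq, ENNReal.ofReal_sum_of_nonneg (fun _ _ => by positivity)]
    refine Finset.sum_congr rfl fun i _ => ?_
    rw [EuclideanSpace.inner_single_left]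
    simp
  simp_rw [h]
  rw [lintegral_finsetSum]
  · simp only [lintegral_inner_op_sq]
    simp
  · intro i _
    exact ((measurable_const.inner (measurable_op_const q)).pow_const 2).ennreal_ofReal

lemma map_op (s : NNReal) {q : EuclideanSpace ℝ J} (hq : ‖q‖ = 1) :
    (iidGaussian (I × J) s).map (fun W => (op W q).ofLp) = iidGaussian I s := by
  let A : (I × J → ℝ) →ₗ[ℝ] (I → ℝ) :=
    { toFun := fun W => (op W q).ofLp
      map_add' := fun W W' => by rw [op_add]; rfl
      map_smul' := fun a W => by
        ext i
        simp only [op_apply, Pi.smul_apply, smul_eq_mul, Finset.mul_sum, RingHom.id_apply]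
        exact Finset.sum_congr rfl fun j _ => by ring }
  refine map_iidGaussian s A.toContinuousLinearMap s fun l => ?_
  congr 1
  rw [Fintype.sum_prod_type]
  refine Finset.sum_congr rfl fun i _ => ?_
  have h1 : ∀ j, l (A (Pi.single (i, j) 1)) = q j * l (Pi.single i 1) := by
    intro j
    rw [← smul_eq_mul, ← map_smul]
    congr 1
    ext i'
    simp only [A, LinearMap.coe_mk, AddHom.coe_mk, op_apply, Pi.single_apply, Prod.mk.injEq,
      Pi.smul_apply, smul_eq_mul]
    by_cases h : i' = i <;> simp [h]
  simp only [LinearMap.coe_toContinuousLinearMap', h1, mul_pow]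
  have := EuclideanSpace.norm_sq_eq q
  rw [hq] at this
  rw [← Finset.sum_mul]
  simp only [Real.norm_eq_abs, sq_abs] at this
  rw [← this]
  simp

lemma lintegral_norm_op_sq_sub {n : ℕ} (hn : 0 < n) {q : EuclideanSpace ℝ J}
    (hq : ‖q‖ = 1 ∨ q = 0) :
    ∫⁻ W, ENNReal.ofReal ((‖op W q‖ ^ 2 - ‖q‖ ^ 2) ^ 2)
        ∂(iidGaussian (Fin n × J) ((n : NNReal)⁻¹))
      ≤ ENNReal.ofReal (Var[fun x => x ^ 2; gaussianReal 0 1] / n) := by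
  rcases hq with hq | hq
  · have hm : Measurable fun W : Fin n × J → ℝ => (op W q).ofLp :=
      (MeasurableEquiv.toLp 2 (Fin n → ℝ)).symm.measurable.comp (measurable_op_const q)
    rw [← lintegral_sq_sum_sq_sub n hn, ← map_op (I := Fin n) (J := J) ((n : NNReal)⁻¹) hq,
      lintegral_map (by fun_prop) hm]
    simp [EuclideanSpace.norm_sq_eq, hq]
  · simp [hq]

end Moments

/-! ### The same moments along explored directions. -/

section ExploredMoments

variable {J : Type*} [Fintype J] [DecidableEq J] {n : ℕ}
  {f : ℕ → (Fin n × J → ℝ) → EuclideanSpace ℝ J}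

lemma norm_explored_sq_le (Z : Fin n × J → ℝ) (j : ℕ) : ‖explored f Z j‖ ^ 2 ≤ 1 := by
  rcases (isOrthonormalOrZero_explored (f := f) Z).norm_eq j with h | h <;> simp [h]

variable (hf : IsAdapted f) (hn : 0 < n)
include hf

lemma lintegral_inner_op_explored_sq_le (j : ℕ) (y : EuclideanSpace ℝ (Fin n)) (hy : ‖y‖ ≤ 1) :
    ∫⁻ Z, ENNReal.ofReal (inner ℝ y (op Z (explored f Z j)) ^ 2)
      ∂(iidGaussian (Fin n × J) ((n : NNReal)⁻¹)) ≤ ENNReal.ofReal (1 / n) := by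
  rw [hf.lintegral_op_explored _ j (F := fun _ x => ENNReal.ofReal (inner ℝ y x ^ 2))
    (by fun_prop) (fun _ _ _ => rfl)]
  refine (lintegral_mono fun Z => ?_).trans
    (by simp : ∫⁻ Z, ENNReal.ofReal (1 / n) ∂(iidGaussian (Fin n × J) ((n : NNReal)⁻¹)) ≤ _)
  rw [lintegral_inner_op_sq]
  refine ENNReal.ofReal_le_ofReal ?_
  have h1 : ‖y‖ ^ 2 ≤ 1 := by nlinarith [norm_nonneg y]
  have h2 : ‖y‖ ^ 2 * ‖explored f Z j‖ ^ 2 ≤ 1 :=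
    mul_le_one₀ h1 (by positivity) (norm_explored_sq_le Z j)
  simpa using mul_le_of_le_one_right (by positivity : (0 : ℝ) ≤ (n : ℝ)⁻¹) h2

include hn

lemma lintegral_norm_op_explored_sq_le (j : ℕ) :
    ∫⁻ Z, ENNReal.ofReal (‖op Z (explored f Z j)‖ ^ 2)
      ∂(iidGaussian (Fin n × J) ((n : NNReal)⁻¹)) ≤ 1 := by
  rw [hf.lintegral_op_explored _ j (F := fun _ x => ENNReal.ofReal (‖x‖ ^ 2))
    (by fun_prop) (fun _ _ _ => rfl)]
  refine (lintegral_mono fun Z => ?_).trans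
    (by simp : ∫⁻ Z, 1 ∂(iidGaussian (Fin n × J) ((n : NNReal)⁻¹)) ≤ _)
  rw [lintegral_norm_op_sq, ENNReal.ofReal_le_one]
  have : (n : ℝ) ≠ 0 := by positivity
  simpa [this] using norm_explored_sq_le Z j

/-- The earlier image is already determined by the past, so the inner product is conditionally
centred Gaussian with variance at most its squared norm over n; that squared norm has mean at most
one. -/
lemma lintegral_inner_op_explored_op_explored_sq_le {i j : ℕ} (hij : i < j) :
    ∫⁻ Z, ENNReal.ofReal (inner ℝ (op Z (explored f Z i)) (op Z (explored f Z j)) ^ 2)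
      ∂(iidGaussian (Fin n × J) ((n : NNReal)⁻¹)) ≤ ENNReal.ofReal (1 / n) := by
  have hm : Measurable fun Z : Fin n × J → ℝ => op Z (explored f Z i) :=
    measurable_op measurable_id (hf.measurable_explored i)
  rw [hf.lintegral_op_explored _ j
    (F := fun Z x => ENNReal.ofReal (inner ℝ (op Z (explored f Z i)) x ^ 2))
    (((hm.comp measurable_fst).inner measurable_snd).pow_const 2).ennreal_ofReal
    (fun Z W x => by simp only [hf.op_splice_explored_lt j Z W hij])]
  have h1 : ∀ Z : Fin n × J → ℝ,
      ∫⁻ W, ENNReal.ofReal (inner ℝ (op Z (explored f Z i)) (op W (explored f Z j)) ^ 2)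
        ∂(iidGaussian (Fin n × J) ((n : NNReal)⁻¹))
      ≤ ENNReal.ofReal (1 / n) * ENNReal.ofReal (‖op Z (explored f Z i)‖ ^ 2) := by
    intro Z
    rw [lintegral_inner_op_sq, ← ENNReal.ofReal_mul (by positivity)]
    refine ENNReal.ofReal_le_ofReal ?_
    have := mul_le_of_le_one_right (by positivity : 0 ≤ ‖op Z (explored f Z i)‖ ^ 2)
      (norm_explored_sq_le (f := f) Z j)
    simp only [NNReal.coe_inv, NNReal.coe_natCast, one_div]
    gcongr
  refine (lintegral_mono h1).trans ?_
  rw [lintegral_const_mul _ (hm.norm.pow_const 2).ennreal_ofReal]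
  exact mul_le_of_le_one_right' (lintegral_norm_op_explored_sq_le hf hn i)

lemma lintegral_norm_op_explored_sq_sub_le (j : ℕ) :
    ∫⁻ Z, ENNReal.ofReal ((‖op Z (explored f Z j)‖ ^ 2 - ‖explored f Z j‖ ^ 2) ^ 2)
      ∂(iidGaussian (Fin n × J) ((n : NNReal)⁻¹))
      ≤ ENNReal.ofReal (Var[fun x => x ^ 2; gaussianReal 0 1] / n) := by
  rw [hf.lintegral_op_explored _ j
    (F := fun Z x => ENNReal.ofReal ((‖x‖ ^ 2 - ‖explored f Z j‖ ^ 2) ^ 2))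
    (((measurable_snd.norm.pow_const 2).sub
      (((hf.measurable_explored j).comp measurable_fst).norm.pow_const 2)).pow_const
        2).ennreal_ofReal
    (fun Z W x => by simp only [hf.explored_splice j Z W le_rfl])]
  refine (lintegral_mono fun Z => ?_).trans
    (by simp : ∫⁻ Z, ENNReal.ofReal (Var[fun x => x ^ 2; gaussianReal 0 1] / n)
      ∂(iidGaussian (Fin n × J) ((n : NNReal)⁻¹)) ≤ _)
  exact lintegral_norm_op_sq_sub hn ((isOrthonormalOrZero_explored Z).norm_eq j)

end ExploredMoments


open InnerProductSpace

/-! ### Simultaneous concentration over a bounded number of explored directions. -/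

section Concentration

variable {J : Type*} [Fintype J] {n : ℕ}

/-- The vectors `op Z (q j)`, `j ≤ K`, have approximately the Gram matrix of the `q j`, and are
approximately orthogonal to `x` and `y`. -/
structure IsConcentrated (q : ℕ → EuclideanSpace ℝ J) (Z : Fin n × J → ℝ) (K : ℕ) (δ : ℝ)
    (x y : EuclideanSpace ℝ (Fin n)) : Prop where
  left : ∀ j ≤ K, |inner ℝ x (op Z (q j))| ≤ δ
  right : ∀ j ≤ K, |inner ℝ y (op Z (q j))| ≤ δ
  norm : ∀ j ≤ K, |‖op Z (q j)‖ ^ 2 - ‖q j‖ ^ 2| ≤ δ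
  cross : ∀ i j, i < j → j ≤ K → |inner ℝ (op Z (q i)) (op Z (q j))| ≤ δ

/-- Chebyshev's inequality, with threshold and second moment scaled so that n cancels. -/
lemma measure_lt_abs_le {Ω : Type*} [MeasurableSpace Ω] (μ : Measure Ω) (hn : 0 < n) {g : Ω → ℝ}
    {C L : ℝ} (hL : 0 < L) (h : ∫⁻ ω, ENNReal.ofReal (g ω ^ 2) ∂μ ≤ ENNReal.ofReal (C / n))
    (hg : Measurable g) :
    μ {ω | L / √(n : ℝ) < |g ω|} ≤ ENNReal.ofReal (C / L ^ 2) := by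
  have hn' : (0 : ℝ) < n := by positivity
  have h1 : {ω | L / √(n : ℝ) < |g ω|}
      ⊆ {ω | ENNReal.ofReal (L ^ 2 / n) ≤ ENNReal.ofReal (g ω ^ 2)} := by
    intro ω hω
    have hω' : L / √(n : ℝ) < |g ω| := hω
    refine ENNReal.ofReal_le_ofReal ?_
    have : (L / √(n : ℝ)) ^ 2 ≤ |g ω| ^ 2 := by
      gcongr
    rwa [div_pow, Real.sq_sqrt hn'.le, sq_abs] at this
  have h2 := mul_meas_ge_le_lintegral (μ := μ) (hg.pow_const 2).ennreal_ofReal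
    (ENNReal.ofReal (L ^ 2 / n))
  have hpos : 0 < L ^ 2 / n := by positivity
  refine (measure_mono h1).trans ?_
  have h3 : μ {ω | ENNReal.ofReal (L ^ 2 / n) ≤ ENNReal.ofReal (g ω ^ 2)}
      ≤ ENNReal.ofReal (C / n) / ENNReal.ofReal (L ^ 2 / n) := by
    rw [ENNReal.le_div_iff_mul_le (Or.inl (by simpa using hpos)) (Or.inl ENNReal.ofReal_ne_top),
      mul_comm]
    exact h2.trans h
  refine h3.trans ?_
  rw [← ENNReal.ofReal_div_of_pos hpos]
  apply le_of_eq
  congr 1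
  field_simp

/-- Constant in the tail bound for `IsConcentrated`. -/
noncomputable def concentrationConst (K : ℕ) : ℝ :=
  (K + 1) * (2 + Var[fun x => x ^ 2; gaussianReal 0 1] + K)

variable [DecidableEq J] {f : ℕ → (Fin n × J → ℝ) → EuclideanSpace ℝ J}

/-- Union bound over `K + 1` directions: each costs one term for `x`, one for `y`, the variance
constant for the norm, and at most `K` terms for the earlier directions. -/
lemma measure_not_isConcentrated_le (hf : IsAdapted f) (hn : 0 < n) (K : ℕ) {L : ℝ} (hL : 0 < L)
    {x y : EuclideanSpace ℝ (Fin n)} (hx : ‖x‖ ≤ 1) (hy : ‖y‖ ≤ 1) :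
    (iidGaussian (Fin n × J) ((n : NNReal)⁻¹))
        {Z | ¬ IsConcentrated (explored f Z) Z K (L / √(n : ℝ)) x y}
      ≤ ENNReal.ofReal (concentrationConst K / L ^ 2) := by
  set μ := iidGaussian (Fin n × J) ((n : NNReal)⁻¹)
  set δ := L / √(n : ℝ)
  set V := Var[fun x => x ^ 2; gaussianReal 0 1]
  have hV : 0 ≤ V := variance_nonneg _ _
  have hm : ∀ j, Measurable fun Z : Fin n × J → ℝ => op Z (explored f Z j) := fun j =>
    measurable_op measurable_id (hf.measurable_explored j)
  let A : ℕ → Set (Fin n × J → ℝ) := fun j => {Z | δ < |inner ℝ x (op Z (explored f Z j))|}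
  let B : ℕ → Set (Fin n × J → ℝ) := fun j => {Z | δ < |inner ℝ y (op Z (explored f Z j))|}
  let C : ℕ → Set (Fin n × J → ℝ) := fun j =>
    {Z | δ < |‖op Z (explored f Z j)‖ ^ 2 - ‖explored f Z j‖ ^ 2|}
  let D : ℕ → ℕ → Set (Fin n × J → ℝ) := fun j i =>
    {Z | δ < |inner ℝ (op Z (explored f Z i)) (op Z (explored f Z j))|}
  have hA : ∀ j, μ (A j) ≤ ENNReal.ofReal (1 / L ^ 2) := fun j =>
    measure_lt_abs_le μ hn hL (lintegral_inner_op_explored_sq_le hf j x hx)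
      (measurable_const.inner (hm j))
  have hB : ∀ j, μ (B j) ≤ ENNReal.ofReal (1 / L ^ 2) := fun j =>
    measure_lt_abs_le μ hn hL (lintegral_inner_op_explored_sq_le hf j y hy)
      (measurable_const.inner (hm j))
  have hC : ∀ j, μ (C j) ≤ ENNReal.ofReal (V / L ^ 2) := fun j =>
    measure_lt_abs_le μ hn hL (lintegral_norm_op_explored_sq_sub_le hf hn j)
      (((hm j).norm.pow_const 2).sub ((hf.measurable_explored j).norm.pow_const 2))
  have hD : ∀ j, ∀ i ∈ Finset.range j, μ (D j i) ≤ ENNReal.ofReal (1 / L ^ 2) := fun j i hij =>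
    measure_lt_abs_le μ hn hL
      (lintegral_inner_op_explored_op_explored_sq_le hf hn (by simpa using hij))
      ((hm i).inner (hm j))
  have hsub : {Z | ¬ IsConcentrated (explored f Z) Z K δ x y}
      ⊆ ⋃ j ∈ Finset.range (K + 1), ((A j ∪ B j) ∪ (C j ∪ ⋃ i ∈ Finset.range j, D j i)) := by
    intro Z hZ
    by_contra hcon
    simp only [Set.mem_iUnion, Finset.mem_range, Set.mem_union, not_exists, not_or, A, B, C, D,
      Set.mem_ofPred_eq, not_lt] at hcon
    exact hZ ⟨fun j hj => (hcon j (by omega)).1.1, fun j hj => (hcon j (by omega)).1.2,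
      fun j hj => (hcon j (by omega)).2.1, fun i j hij hj => (hcon j (by omega)).2.2 i hij⟩
  have hj : ∀ j ∈ Finset.range (K + 1),
      μ ((A j ∪ B j) ∪ (C j ∪ ⋃ i ∈ Finset.range j, D j i))
        ≤ ENNReal.ofReal ((2 + V + K) / L ^ 2) := by
    intro j hj
    have h1 : μ (⋃ i ∈ Finset.range j, D j i) ≤ ENNReal.ofReal (K * (1 / L ^ 2)) := by
      refine (measure_biUnion_finset_le _ _).trans ((Finset.sum_le_sum (hD j)).trans ?_)
      rw [Finset.sum_const, Finset.card_range, ENNReal.ofReal_mul (by positivity),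
        ENNReal.ofReal_natCast, nsmul_eq_mul]
      gcongr
      simp at hj
      omega
    have e : (2 + V + K) / L ^ 2
        = (1 / L ^ 2 + 1 / L ^ 2) + (V / L ^ 2 + K * (1 / L ^ 2)) := by ring
    rw [e, ENNReal.ofReal_add (by positivity) (by positivity),
      ENNReal.ofReal_add (by positivity) (by positivity),
      ENNReal.ofReal_add (by positivity) (by positivity)]
    refine (measure_union_le _ _).trans (add_le_add ?_ ?_)
    · exact (measure_union_le _ _).trans (add_le_add (hA j) (hB j))
    · exact (measure_union_le _ _).trans (add_le_add (hC j) h1)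
  refine (measure_mono hsub).trans ((measure_biUnion_finset_le _ _).trans
    ((Finset.sum_le_sum hj).trans (le_of_eq ?_)))
  rw [Finset.sum_const, Finset.card_range, nsmul_eq_mul, concentrationConst, mul_div_assoc,
    ENNReal.ofReal_mul (by positivity)]
  congr 1
  rw [← ENNReal.ofReal_natCast]
  push_cast
  rfl

end Concentration

/-! ### Concentration transferred to unit vectors in the explored span. -/

section Consequences

variable {J : Type*} [Fintype J] {n : ℕ} {q : ℕ → EuclideanSpace ℝ J} {Z : Fin n × J → ℝ} {K : ℕ}
  {δ : ℝ} {x y : EuclideanSpace ℝ (Fin n)} {w : EuclideanSpace ℝ J} {j : ℕ}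

lemma op_eq_sum (hw : partialProj q j w = w) :
    op Z w = ∑ i ∈ Finset.range j, inner ℝ (q i) w • op Z (q i) := by
  conv_lhs => rw [← hw, partialProj_apply, map_sum]
  simp

lemma sum_inner_sq (hq : IsOrthonormalOrZero q) (hw : partialProj q j w = w) (hw1 : ‖w‖ = 1) :
    ∑ i ∈ Finset.range j, inner ℝ (q i) w ^ 2 = 1 := by
  rw [← hq.norm_partialProj_sq, hw, hw1, one_pow]

namespace IsConcentrated

variable (hc : IsConcentrated q Z K δ x y) (hq : IsOrthonormalOrZero q) (hj : j ≤ K + 1)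
  (hw : partialProj q j w = w) (hw1 : ‖w‖ = 1)
include hc

lemma nonneg : 0 ≤ δ := (abs_nonneg _).trans (hc.left 0 (Nat.zero_le _))

lemma symm : IsConcentrated q Z K δ y x := ⟨hc.right, hc.left, hc.norm, hc.cross⟩

include hq hj hw hw1

lemma abs_inner_op_le : |inner ℝ x (op Z w)| ≤ (K + 1) * δ := by
  have hs := sum_inner_sq hq hw hw1
  have hδ := hc.nonneg
  rw [op_eq_sum hw, inner_sum]
  refine (Finset.abs_sum_le_sum_abs _ _).trans ?_
  have h1 : ∀ i ∈ Finset.range j, |inner ℝ x (inner ℝ (q i) w • op Z (q i))| ≤ δ := by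
    intro i hi
    have hi' : i < j := by simpa using hi
    rw [inner_smul_right, abs_mul]
    have h2 : inner ℝ (q i) w ^ 2 ≤ 1 := by
      rw [← hs]
      exact Finset.single_le_sum (f := fun i => inner ℝ (q i) w ^ 2)
        (fun _ _ => sq_nonneg _) hi
    have h3 : |inner ℝ (q i) w| ≤ 1 := by rwa [sq_le_one_iff_abs_le_one] at h2
    exact (mul_le_of_le_one_left (abs_nonneg _) h3).trans (hc.left i (by omega))
  refine (Finset.sum_le_sum h1).trans ?_
  rw [Finset.sum_const, Finset.card_range, nsmul_eq_mul]
  gcongr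
  exact_mod_cast hj

/-- Once the component along `q 0` is removed, the other coefficients have squares summing to 1 - ⟨q
0, w⟩². With `q 0` equal to v^{⊗m}, this square root later supplies the extra factor 1/β. -/
lemma abs_inner_op_sub_le (hj0 : 0 < j) :
    |inner ℝ x (op Z w) - inner ℝ (q 0) w * inner ℝ x (op Z (q 0))|
      ≤ (K + 1) * δ * √(1 - inner ℝ (q 0) w ^ 2) := by
  have hs := sum_inner_sq hq hw hw1
  have hδ := hc.nonneg
  obtain ⟨j, rfl⟩ : ∃ l, j = l + 1 := ⟨j - 1, by omega⟩
  rw [Finset.sum_range_succ'] at hs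
  rw [op_eq_sum hw, inner_sum, Finset.sum_range_succ', inner_smul_right, add_sub_cancel_right]
  refine (Finset.abs_sum_le_sum_abs _ _).trans ?_
  have h1 : ∀ i ∈ Finset.range j,
      |inner ℝ x (inner ℝ (q (i + 1)) w • op Z (q (i + 1)))|
        ≤ √(1 - inner ℝ (q 0) w ^ 2) * δ := by
    intro i hi
    have hi' : i < j := by simpa using hi
    rw [inner_smul_right, abs_mul]
    have h2 : inner ℝ (q (i + 1)) w ^ 2 ≤ 1 - inner ℝ (q 0) w ^ 2 := by
      rw [← hs, add_sub_cancel_right]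
      exact Finset.single_le_sum (f := fun i => inner ℝ (q (i + 1)) w ^ 2)
        (fun _ _ => sq_nonneg _) hi
    gcongr
    · exact Real.abs_le_sqrt h2
    · exact hc.left _ (by omega)
  refine (Finset.sum_le_sum h1).trans ?_
  rw [Finset.sum_const, Finset.card_range, nsmul_eq_mul]
  have : (j : ℝ) ≤ K + 1 := by
    have : j ≤ K + 1 := by omega
    exact_mod_cast this
  calc (j : ℝ) * (√(1 - inner ℝ (q 0) w ^ 2) * δ)
      ≤ (K + 1) * (√(1 - inner ℝ (q 0) w ^ 2) * δ) := by gcongr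
    _ = _ := by ring

/-- The difference is a quadratic form in the coefficients of `w`, namely the Gram matrix of the
images minus that of the `q i`. There are at most (K + 1)² entries, each at most `δ`, with
coefficients bounded by 1. -/
lemma abs_norm_op_sq_sub_one_le : |‖op Z w‖ ^ 2 - 1| ≤ (K + 1) ^ 2 * δ := by
  have hs := sum_inner_sq hq hw hw1
  have hδ := hc.nonneg
  have hc1 : ∀ i ∈ Finset.range j, |inner ℝ (q i) w| ≤ 1 := by
    intro i hi
    rw [← sq_le_one_iff_abs_le_one, ← hs]
    exact Finset.single_le_sum (f := fun i => inner ℝ (q i) w ^ 2)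
      (fun _ _ => sq_nonneg _) hi
  have h1 : ‖op Z w‖ ^ 2 - 1 = ∑ i ∈ Finset.range j, ∑ l ∈ Finset.range j,
      inner ℝ (q i) w * inner ℝ (q l) w *
        (inner ℝ (op Z (q i)) (op Z (q l)) - if i = l then ‖q i‖ ^ 2 else 0) := by
    have h2 : ∑ i ∈ Finset.range j, ∑ l ∈ Finset.range j, inner ℝ (q i) w * inner ℝ (q l) w *
        (if i = l then ‖q i‖ ^ 2 else 0) = 1 := by
      rw [← hs]
      refine Finset.sum_congr rfl fun i hi => ?_
      simp only [mul_ite, mul_zero, Finset.sum_ite_eq, hi, if_true]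
      rcases hq.norm_eq i with h | h
      · simp [h, sq]
      · simp [h]
    simp_rw [mul_sub, Finset.sum_sub_distrib]
    rw [h2, ← real_inner_self_eq_norm_sq, op_eq_sum hw, sum_inner]
    congr 1
    refine Finset.sum_congr rfl fun i _ => ?_
    rw [inner_sum]
    refine Finset.sum_congr rfl fun l _ => ?_
    rw [inner_smul_left, inner_smul_right]
    simp only [conj_trivial]
    ring
  have h3 : ∀ i ∈ Finset.range j, ∀ l ∈ Finset.range j,
      |inner ℝ (q i) w * inner ℝ (q l) w *
        (inner ℝ (op Z (q i)) (op Z (q l)) - if i = l then ‖q i‖ ^ 2 else 0)| ≤ δ := by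
    intro i hi l hl
    rw [abs_mul, abs_mul]
    have hil : |inner ℝ (op Z (q i)) (op Z (q l)) - if i = l then ‖q i‖ ^ 2 else 0| ≤ δ := by
      have hi' : i < j := by simpa using hi
      have hl' : l < j := by simpa using hl
      rcases lt_trichotomy i l with h | h | h
      · simpa [h.ne] using hc.cross i l h (by omega)
      · subst h
        simpa using hc.norm i (by omega)
      · rw [real_inner_comm]
        simpa [h.ne'] using hc.cross l i h (by omega)
    exact (mul_le_of_le_one_left (abs_nonneg _)
      (mul_le_one₀ (hc1 i hi) (abs_nonneg _) (hc1 l hl))).trans hil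
  rw [h1]
  refine (Finset.abs_sum_le_sum_abs _ _).trans ?_
  have h4 : ∀ i ∈ Finset.range j, |∑ l ∈ Finset.range j, inner ℝ (q i) w * inner ℝ (q l) w *
      (inner ℝ (op Z (q i)) (op Z (q l)) - if i = l then ‖q i‖ ^ 2 else 0)| ≤ (K + 1) * δ := by
    intro i hi
    refine (Finset.abs_sum_le_sum_abs _ _).trans ((Finset.sum_le_sum (h3 i hi)).trans ?_)
    rw [Finset.sum_const, Finset.card_range, nsmul_eq_mul]
    gcongr
    exact_mod_cast hj
  refine (Finset.sum_le_sum h4).trans ?_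
  rw [Finset.sum_const, Finset.card_range, nsmul_eq_mul, sq, mul_assoc]
  gcongr
  exact_mod_cast hj

end IsConcentrated

end Consequences


/-! ### Tensors of order m + 1 as matrices, and power iteration as an exploration. -/

section Algebra

variable {m n : ℕ}

/-- The tensor power `w^{⊗m}` as a Euclidean vector. -/
noncomputable def powVec (m : ℕ) (w : EuclideanSpace ℝ (Fin n)) :
    EuclideanSpace ℝ (Fin m → Fin n) :=
  WithLp.toLp 2 fun j => ∏ l, w (j l)

@[simp]
lemma powVec_apply (w : EuclideanSpace ℝ (Fin n)) (j : Fin m → Fin n) :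
    powVec m w j = ∏ l, w (j l) := rfl

lemma inner_powVec (x y : EuclideanSpace ℝ (Fin n)) :
    inner ℝ (powVec m x) (powVec m y) = inner ℝ x y ^ m := by
  rw [PiLp.inner_apply, PiLp.inner_apply, Fintype.sum_pow]
  refine Finset.sum_congr rfl fun j _ => ?_
  simp [Finset.prod_mul_distrib]

lemma norm_powVec (x : EuclideanSpace ℝ (Fin n)) : ‖powVec m x‖ = ‖x‖ ^ m := by
  rw [← sq_eq_sq₀ (norm_nonneg _) (by positivity), ← real_inner_self_eq_norm_sq, inner_powVec,
    real_inner_self_eq_norm_sq]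
  ring

lemma measurable_powVec : Measurable (powVec m : EuclideanSpace ℝ (Fin n) → _) := by
  refine (MeasurableEquiv.toLp 2 ((Fin m → Fin n) → ℝ)).measurable.comp
    (measurable_pi_iff.2 fun j => Finset.measurable_prod _ fun l _ => ?_)
  exact (measurable_pi_apply _).comp (MeasurableEquiv.toLp 2 (Fin n → ℝ)).symm.measurable

/-- A tensor of order `m + 1` as a matrix whose rows are indexed by the first slot. -/
def flat (Z : Tensor (m + 1) n) : Fin n × (Fin m → Fin n) → ℝ := fun p => Z (Fin.cons p.1 p.2)

lemma tensorInner_elementary (Z : Tensor (m + 1) n) (w : Fin (m + 1) → EuclideanSpace ℝ (Fin n)) :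
    tensorInner Z (elementary w)
      = ∑ p, flat Z p * (w 0 p.1 * ∏ l : Fin m, w l.succ (p.2 l)) := by
  rw [tensorInner, ← (Fin.consEquiv fun _ : Fin (m + 1) => Fin n).sum_comp]
  refine Finset.sum_congr rfl fun p _ => ?_
  simp [elementary, flat, Fin.consEquiv, Fin.prod_univ_succ]

lemma inner_op_powVec (Z : Tensor (m + 1) n) (x u : EuclideanSpace ℝ (Fin n)) :
    inner ℝ x (op (flat Z) (powVec m u))
      = tensorInner Z (elementary (Fin.cons x fun _ => u)) := by
  rw [inner_op, tensorInner_elementary]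
  refine Finset.sum_congr rfl fun p _ => ?_
  simp
  ring

lemma applyPow_eq_op (Z : Tensor (m + 1) n) (u : EuclideanSpace ℝ (Fin n)) :
    applyPow Z u = op (flat Z) (powVec m u) := by
  ext i
  have h1 : inner ℝ (EuclideanSpace.single i (1 : ℝ)) (op (flat Z) (powVec m u))
      = op (flat Z) (powVec m u) i := by
    rw [EuclideanSpace.inner_single_left]
    simp
  rw [← h1, inner_op_powVec]
  simp only [applyPow]
  congr 2
  ext l
  refine Fin.cases ?_ (fun l => ?_) l
  · simp
  · simp

lemma betaHat_eq_inner (Z : Tensor (m + 1) n) (w : EuclideanSpace ℝ (Fin n)) :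
    betaHat Z w = inner ℝ w (applyPow Z w) := by
  rw [applyPow_eq_op, inner_op_powVec, betaHat, tensorPow]
  congr 2
  ext l
  refine Fin.cases ?_ (fun l => ?_) l <;> simp

lemma op_flat_spiked (β : ℝ) (v : EuclideanSpace ℝ (Fin n)) (Z : Tensor (m + 1) n)
    (u : EuclideanSpace ℝ (Fin n)) :
    op (flat (spiked β v Z)) (powVec m u)
      = (β * inner ℝ v u ^ m) • v + op (flat Z) (powVec m u) := by
  have h1 : flat (spiked β v Z) = β • flat (tensorPow (m + 1) v) + flat Z := rfl
  have h2 : op (flat (tensorPow (m + 1) v)) (powVec m u) = inner ℝ v u ^ m • v := by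
    ext i
    rw [← inner_powVec, PiLp.inner_apply]
    simp [flat, tensorPow, elementary, Fin.prod_univ_succ, Finset.sum_mul]
    exact Finset.sum_congr rfl fun j _ => by ring
  rw [h1, op_add, mul_smul, ← h2]
  congr 1
  ext i
  simp [Finset.mul_sum, mul_assoc]

lemma applyPow_spiked (β : ℝ) (v : EuclideanSpace ℝ (Fin n)) (Z : Tensor (m + 1) n)
    (u : EuclideanSpace ℝ (Fin n)) :
    applyPow (spiked β v Z) u = (β * inner ℝ v u ^ m) • v + op (flat Z) (powVec m u) := by
  rw [applyPow_eq_op, op_flat_spiked]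

/-- Power iteration on the spiked tensor, as a function of the flattened noise. -/
noncomputable def spikedIter (m : ℕ) (β : ℝ) (v u : EuclideanSpace ℝ (Fin n))
    (Y : Fin n × (Fin m → Fin n) → ℝ) : ℕ → EuclideanSpace ℝ (Fin n)
  | 0 => u
  | t + 1 =>
    ‖(β * inner ℝ v (spikedIter m β v u Y t) ^ m) • v
        + op Y (powVec m (spikedIter m β v u Y t))‖⁻¹ •
      ((β * inner ℝ v (spikedIter m β v u Y t) ^ m) • v
        + op Y (powVec m (spikedIter m β v u Y t)))

lemma powerIter_spiked (β : ℝ) (v u : EuclideanSpace ℝ (Fin n)) (Z : Tensor (m + 1) n) (t : ℕ) :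
    powerIter (spiked β v Z) u t = spikedIter m β v u (flat Z) t := by
  induction t with
  | zero => rfl
  | succ t ih => rw [powerIter, spikedIter, ih, applyPow_spiked]

/-- The signal and the iterates, as an exploration sequence for the flattened noise. -/
noncomputable def probe (m : ℕ) (β : ℝ) (v u : EuclideanSpace ℝ (Fin n)) :
    ℕ → (Fin n × (Fin m → Fin n) → ℝ) → EuclideanSpace ℝ (Fin m → Fin n)
  | 0, _ => powVec m v
  | t + 1, Y => powVec m (spikedIter m β v u Y t)

lemma measurable_spikedIter (β : ℝ) (v u : EuclideanSpace ℝ (Fin n)) (t : ℕ) :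
    Measurable fun Y => spikedIter m β v u Y t := by
  induction t with
  | zero => exact measurable_const
  | succ t ih =>
    have h : Measurable fun Y => (β * inner ℝ v (spikedIter m β v u Y t) ^ m) • v
        + op Y (powVec m (spikedIter m β v u Y t)) :=
      (Measurable.smul_const (((measurable_const.inner ih).pow_const m).const_mul β) v).add
        (measurable_op measurable_id (measurable_powVec.comp ih))
    exact h.norm.inv.smul h

/-- An iterate uses the noise only through its action on the tensor powers of earlier iterates,
which are earlier probes; the signal term does not involve the noise. -/
lemma isAdapted_probe (β : ℝ) (v u : EuclideanSpace ℝ (Fin n)) : IsAdapted (probe m β v u) where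
  measurable j := by
    cases j with
    | zero => exact measurable_const
    | succ t => exact measurable_powVec.comp (measurable_spikedIter β v u t)
  adapted j Y Y' h := by
    cases j with
    | zero => rfl
    | succ t =>
      have : ∀ s ≤ t, spikedIter m β v u Y' s = spikedIter m β v u Y s := by
        intro s hs
        induction s with
        | zero => rfl
        | succ s ih =>
          have h1 := h (s + 1) (by omega)
          simp only [probe] at h1
          rw [spikedIter, spikedIter, ih (by omega), h1]
      simp only [probe, this t le_rfl]

/-- The signal is probed before all iterates so that its own image, the source of the limiting
Gaussian, is the reference direction with index 0. -/
lemma explored_probe_zero (β : ℝ) {v : EuclideanSpace ℝ (Fin n)} (u : EuclideanSpace ℝ (Fin n))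
    (hv : ‖v‖ = 1) (Y : Fin n × (Fin m → Fin n) → ℝ) :
    explored (probe m β v u) Y 0 = powVec m v := by
  rw [explored, gramSchmidtNormed_eq, partialProj_apply]
  simp [probe, norm_powVec, hv]

end Algebra

/-! ### The noise as a multilinear form; grid approximation of the unit ball. -/

section InjectiveNorm

variable {k m n : ℕ}

/-- The multilinear form `w ↦ ⟨Z, w 0 ⊗ ⋯ ⊗ w (k - 1)⟩`. -/
noncomputable def tensorForm (Z : Tensor k n) :
    ContinuousMultilinearMap ℝ (fun _ : Fin k => EuclideanSpace ℝ (Fin n)) ℝ :=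
  ∑ j, Z j • (ContinuousMultilinearMap.mkPiAlgebra ℝ (Fin k) ℝ).compContinuousLinearMap
    fun l => EuclideanSpace.proj (j l)

lemma tensorForm_apply (Z : Tensor k n) (w : Fin k → EuclideanSpace ℝ (Fin n)) :
    tensorForm Z w = tensorInner Z (elementary w) := by
  simp [tensorForm, tensorInner, elementary]

lemma norm_op_powVec_le (Z : Tensor (m + 1) n) {u : EuclideanSpace ℝ (Fin n)} (hu : ‖u‖ = 1) :
    ‖op (flat Z) (powVec m u)‖ ≤ ‖tensorForm Z‖ := by
  set y := op (flat Z) (powVec m u)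
  by_cases hy : ‖y‖ = 0
  · rw [hy]; exact norm_nonneg _
  have h1 : ‖y‖ ^ 2 ≤ ‖tensorForm Z‖ * ‖y‖ := by
    rw [← real_inner_self_eq_norm_sq, inner_op_powVec, ← tensorForm_apply]
    refine (le_abs_self _).trans (((tensorForm Z).le_opNorm _).trans ?_)
    simp [Fin.prod_univ_succ, hu]
  rw [sq] at h1
  exact le_of_mul_le_mul_right h1 (lt_of_le_of_ne (norm_nonneg _) (Ne.symm hy))

/-- Testing against the normalised difference turns the norm into a difference of two values of the
multilinear form, which is Lipschitz on tuples of unit vectors; the factor m + 1 is the number of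
slots. -/
lemma norm_op_powVec_sub_le (Z : Tensor (m + 1) n) {u u' : EuclideanSpace ℝ (Fin n)}
    (hu : ‖u‖ = 1) (hu' : ‖u'‖ = 1) :
    ‖op (flat Z) (powVec m u) - op (flat Z) (powVec m u')‖
      ≤ (m + 1) * ‖tensorForm Z‖ * ‖u - u'‖ := by
  set y := op (flat Z) (powVec m u) - op (flat Z) (powVec m u')
  by_cases hy : ‖y‖ = 0
  · rw [hy]; positivity
  have hy' : 0 < ‖y‖ := lt_of_le_of_ne (norm_nonneg _) (Ne.symm hy)
  set x := ‖y‖⁻¹ • y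
  have hx : ‖x‖ = 1 := by
    rw [norm_smul, norm_inv, norm_norm, inv_mul_cancel₀ hy]
  have hxy : inner ℝ x y = ‖y‖ := by
    rw [inner_smul_left, real_inner_self_eq_norm_sq]
    simp
    field_simp
  have h1 : inner ℝ x y = tensorForm Z (Fin.cons x fun _ => u)
      - tensorForm Z (Fin.cons x fun _ => u') := by
    rw [inner_sub_right, inner_op_powVec, inner_op_powVec, tensorForm_apply, tensorForm_apply]
  have hn : ∀ z : EuclideanSpace ℝ (Fin n), ‖z‖ = 1 →
      ‖(Fin.cons x fun _ => z : Fin (m + 1) → EuclideanSpace ℝ (Fin n))‖ = 1 := by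
    intro z hz
    apply le_antisymm
    · refine (pi_norm_le_iff_of_nonneg zero_le_one).2 fun l => ?_
      refine Fin.cases ?_ (fun l => ?_) l <;> simp [hx, hz]
    · have := norm_le_pi_norm (Fin.cons x fun _ => z : Fin (m + 1) → EuclideanSpace ℝ (Fin n)) 0
      simpa [hx] using this
  have hd : ‖(Fin.cons x fun _ => u : Fin (m + 1) → EuclideanSpace ℝ (Fin n))
      - (Fin.cons x fun _ => u')‖ ≤ ‖u - u'‖ := by
    refine (pi_norm_le_iff_of_nonneg (norm_nonneg _)).2 fun l => ?_
    refine Fin.cases ?_ (fun l => ?_) l <;> simp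
  have h2 := (tensorForm Z).norm_image_sub_le (Fin.cons x fun _ => u) (Fin.cons x fun _ => u')
  rw [hn u hu, hn u' hu', ← h1, hxy, Real.norm_eq_abs, abs_of_pos hy'] at h2
  refine h2.trans ?_
  simp only [max_self, one_pow, mul_one, Fintype.card_fin]
  push_cast
  rw [mul_comm ‖tensorForm Z‖]
  gcongr

/-- Rounding a vector of norm at most one towards zero on the grid of mesh `1/n`. -/
lemma exists_grid_approx (hn : 0 < n) (x : EuclideanSpace ℝ (Fin n)) (hx : ‖x‖ ≤ 1) :
    ∃ g : Fin n → Fin (2 * n + 1),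
      ‖(WithLp.toLp 2 fun i => (((g i : ℕ) : ℝ) - n) / n : EuclideanSpace ℝ (Fin n))‖ ≤ 1 ∧
      ‖x - WithLp.toLp 2 fun i => (((g i : ℕ) : ℝ) - n) / n‖ ≤ 1 / √(n : ℝ) := by
  have hn' : (0 : ℝ) < n := by positivity
  have hxi : ∀ i, |x i| ≤ 1 := fun i => (PiLp.norm_apply_le x i).trans hx
  -- Truncating n|x i| to an integer keeps the grid point inside the unit ball; the index is that
  -- integer added to or subtracted from `n`, according to the sign of x i.
  have hex : ∀ i, ∃ g : Fin (2 * n + 1), |(((g : ℕ) : ℝ) - n) / n| ≤ |x i| ∧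
      |x i - (((g : ℕ) : ℝ) - n) / n| ≤ 1 / n := by
    intro i
    have h0 := abs_le.1 (hxi i)
    have hfl : ⌊n * |x i|⌋₊ ≤ n := by
      apply Nat.floor_le_of_le
      exact mul_le_of_le_one_right hn'.le (hxi i)
    have hle : (⌊n * |x i|⌋₊ : ℝ) ≤ n * |x i| := Nat.floor_le (by positivity)
    have hlt := Nat.lt_floor_add_one (n * |x i|)
    have hle' : (⌊n * |x i|⌋₊ : ℝ) / n ≤ |x i| := by
      rw [div_le_iff₀ hn']; linarith
    have hge' : |x i| ≤ (⌊n * |x i|⌋₊ : ℝ) / n + 1 / n := by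
      rw [← add_div, le_div_iff₀ hn']; linarith
    have hnn : (0 : ℝ) ≤ (⌊n * |x i|⌋₊ : ℝ) / n := by positivity
    rcases le_total 0 (x i) with h | h
    · refine ⟨⟨n + ⌊n * |x i|⌋₊, by omega⟩, ?_⟩
      have e : (((n + ⌊n * |x i|⌋₊ : ℕ) : ℝ) - n) / n = (⌊n * |x i|⌋₊ : ℝ) / n := by
        push_cast; ring
      simp only [e]
      rw [abs_of_nonneg hnn]
      rw [abs_of_nonneg h] at *
      refine ⟨hle', abs_le.2 ⟨?_, ?_⟩⟩
      · have : 0 ≤ 1 / (n : ℝ) := by positivity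
        linarith
      · linarith
    · refine ⟨⟨n - ⌊n * |x i|⌋₊, by omega⟩, ?_⟩
      have e : (((n - ⌊n * |x i|⌋₊ : ℕ) : ℝ) - n) / n = - ((⌊n * |x i|⌋₊ : ℝ) / n) := by
        rw [Nat.cast_sub hfl]; ring
      simp only [e]
      rw [abs_neg, abs_of_nonneg hnn]
      rw [abs_of_nonpos h] at *
      refine ⟨hle', abs_le.2 ⟨?_, ?_⟩⟩
      · linarith
      · have : 0 ≤ 1 / (n : ℝ) := by positivity
        linarith
  choose g hg1 hg2 using hex
  refine ⟨g, ?_, ?_⟩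
  · refine le_trans ?_ hx
    rw [EuclideanSpace.norm_eq, EuclideanSpace.norm_eq]
    gcongr with i
    exact hg1 i
  · rw [EuclideanSpace.norm_eq]
    have h1 : 1 / √(n : ℝ) = √(1 / n) := by
      rw [Real.sqrt_div zero_le_one, Real.sqrt_one]
    rw [h1]
    refine Real.sqrt_le_sqrt ?_
    have h2 : ∀ i ∈ Finset.univ,
        ‖(x - WithLp.toLp 2 fun i => (((g i : ℕ) : ℝ) - n) / n) i‖ ^ 2 ≤ (1 / (n : ℝ)) ^ 2 := by
      intro i _
      gcongr
      exact hg2 i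
    refine (Finset.sum_le_sum h2).trans (le_of_eq ?_)
    simp
    field_simp

end InjectiveNorm


/-! ### Net bound for the norm of the Gaussian multilinear form. -/

section Net

variable {k n : ℕ}

/-- The grid point of mesh `1/n` in `[-1, 1]ⁿ` with the given indices. -/
noncomputable def gridPoint (g : Fin n → Fin (2 * n + 1)) : EuclideanSpace ℝ (Fin n) :=
  WithLp.toLp 2 fun i => (((g i : ℕ) : ℝ) - n) / n

/-- Moving to the grid costs at most k‖Z‖/√n, which is at most half of the norm being estimated and
can be absorbed. -/
lemma norm_tensorForm_le_of_grid (Z : Tensor k n) (hn : 0 < n) (hk : 2 * (k : ℝ) ≤ √(n : ℝ))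
    {B : ℝ} (hB0 : 0 ≤ B)
    (hB : ∀ G : Fin k → Fin n → Fin (2 * n + 1), (∀ l, ‖gridPoint (G l)‖ ≤ 1) →
      |tensorForm Z fun l => gridPoint (G l)| ≤ B) :
    ‖tensorForm Z‖ ≤ 2 * B := by
  set M := ‖tensorForm Z‖
  have hM : 0 ≤ M := norm_nonneg _
  have hn' : (0 : ℝ) < √(n : ℝ) := by positivity
  have key : ∀ x : Fin k → EuclideanSpace ℝ (Fin n), (∀ l, ‖x l‖ ≤ 1) →
      ‖tensorForm Z x‖ ≤ B + M / 2 := by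
    intro x hx
    choose G hG1 hG2 using fun l => exists_grid_approx hn (x l) (hx l)
    have h1 := (tensorForm Z).norm_image_sub_le x (fun l => gridPoint (G l))
    have h2 : ‖x‖ ≤ 1 := (pi_norm_le_iff_of_nonneg zero_le_one).2 hx
    have h3 : ‖fun l => gridPoint (G l)‖ ≤ 1 := (pi_norm_le_iff_of_nonneg zero_le_one).2 hG1
    have h4 : ‖x - fun l => gridPoint (G l)‖ ≤ 1 / √(n : ℝ) :=
      (pi_norm_le_iff_of_nonneg (by positivity)).2 hG2
    have h5 : max ‖x‖ ‖fun l => gridPoint (G l)‖ ^ (Fintype.card (Fin k) - 1) ≤ 1 :=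
      pow_le_one₀ (le_max_of_le_left (norm_nonneg _)) (max_le h2 h3)
    have h6 : ‖tensorForm Z x - tensorForm Z fun l => gridPoint (G l)‖
        ≤ M * k * 1 * (1 / √(n : ℝ)) := by
      refine h1.trans ?_
      simp only [Fintype.card_fin] at h5 ⊢
      gcongr
    have h7 : M * k * 1 * (1 / √(n : ℝ)) ≤ M / 2 := by
      rw [mul_one, mul_one_div, div_le_div_iff₀ hn' two_pos]
      nlinarith
    have h8 := hB G hG1
    have h9 := norm_sub_norm_le (tensorForm Z x) (tensorForm Z fun l => gridPoint (G l))
    rw [Real.norm_eq_abs (tensorForm Z fun l => gridPoint (G l))] at h9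
    linarith
  have h1 : M ≤ B + M / 2 := by
    refine (tensorForm Z).opNorm_le_bound (by positivity) fun w => ?_
    have hw : w = fun l => ‖w l‖ • (‖w l‖⁻¹ • w l) := by
      ext1 l
      by_cases h : ‖w l‖ = 0
      · rw [norm_eq_zero.1 h]; simp
      · rw [smul_smul, mul_inv_cancel₀ h, one_smul]
    have h2 := key (fun l => ‖w l‖⁻¹ • w l) fun l => by
      rw [norm_smul, norm_inv, norm_norm]
      exact inv_mul_le_one
    conv_lhs => rw [hw, (tensorForm Z).map_smul_univ]
    rw [norm_smul, mul_comm]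
    gcongr
    simp
  linarith

lemma map_tensorForm (s : NNReal) (w : Fin k → EuclideanSpace ℝ (Fin n)) (s' : NNReal)
    (hs : (s' : ℝ) = s * ∏ l, ‖w l‖ ^ 2) :
    (iidGaussian (Fin k → Fin n) s).map (fun Z => tensorForm Z w) = gaussianReal 0 s' := by
  have h : (fun Z : Tensor k n => tensorForm Z w) = fun Z => ∑ j, (∏ l, w l (j l)) * Z j := by
    ext Z
    rw [tensorForm_apply, tensorInner]
    exact Finset.sum_congr rfl fun j _ => by rw [elementary, mul_comm]
  rw [h]
  refine map_sum_iidGaussian s _ s' ?_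
  rw [hs]
  congr 1
  simp_rw [EuclideanSpace.norm_sq_eq, Finset.prod_univ_sum, Fintype.piFinset_univ,
    Real.norm_eq_abs, sq_abs, Finset.prod_pow]

lemma measurable_tensorForm (w : Fin k → EuclideanSpace ℝ (Fin n)) :
    Measurable fun Z : Tensor k n => tensorForm Z w := by
  simp_rw [tensorForm_apply, tensorInner]
  fun_prop

lemma measure_lt_norm_tensorForm_le (hn : 0 < n) (hk : 2 * (k : ℝ) ≤ √(n : ℝ)) {B : ℝ}
    (hB : 0 ≤ B) :
    (iidGaussian (Fin k → Fin n) ((n : NNReal)⁻¹)) {Z | 2 * B < ‖tensorForm Z‖}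
      ≤ ENNReal.ofReal ((2 * n + 1) ^ (n * k) * (2 * Real.exp (-(n * B ^ 2) / 2))) := by
  set μ := iidGaussian (Fin k → Fin n) ((n : NNReal)⁻¹)
  -- The norm condition sits inside the event, so grid tuples leaving the unit ball contribute
  -- nothing while the union bound still runs over all of them.
  let S : (Fin k → Fin n → Fin (2 * n + 1)) → Set (Tensor k n) := fun G =>
    {Z | (∀ l, ‖gridPoint (G l)‖ ≤ 1) ∧ B ≤ |tensorForm Z fun l => gridPoint (G l)|}
  have hS : ∀ G, μ (S G) ≤ ENNReal.ofReal (2 * Real.exp (-(n * B ^ 2) / 2)) := by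
    intro G
    by_cases hG : ∀ l, ‖gridPoint (G l)‖ ≤ 1
    · set w : Fin k → EuclideanSpace ℝ (Fin n) := fun l => gridPoint (G l)
      have hS' : S G = (fun Z => tensorForm Z w) ⁻¹' {x | B ≤ |x|} := by
        ext Z
        simp [S, hG, w]
      let s' : NNReal := ⟨((n : NNReal)⁻¹ : NNReal) * ∏ l, ‖w l‖ ^ 2, by positivity⟩
      have hs' : s' ≤ (n : NNReal)⁻¹ := by
        rw [← NNReal.coe_le_coe]
        refine mul_le_of_le_one_right (by positivity) ?_
        exact Finset.prod_le_one (fun _ _ => by positivity)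
          fun l _ => pow_le_one₀ (norm_nonneg _) (hG l)
      have hmeas : MeasurableSet {x : ℝ | B ≤ |x|} :=
        measurableSet_le measurable_const measurable_id.abs
      rw [hS', ← Measure.map_apply (measurable_tensorForm w) hmeas,
        map_tensorForm ((n : NNReal)⁻¹) w s' rfl]
      refine (gaussianReal_abs_ge_le hB hs').trans (le_of_eq ?_)
      congr 3
      have : (n : ℝ) ≠ 0 := by positivity
      push_cast
      field_simp
    · have : S G = ∅ := by
        ext Z
        simp only [S, Set.mem_ofPred_eq, hG, false_and, Set.mem_empty_iff_false]
      rw [this]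
      simp
  have hsub : {Z : Tensor k n | 2 * B < ‖tensorForm Z‖} ⊆ ⋃ G ∈ Finset.univ, S G := by
    intro Z hZ
    by_contra hcon
    simp only [Finset.mem_univ, Set.iUnion_true, Set.mem_iUnion, not_exists, S, Set.mem_ofPred_eq,
      not_and, not_le] at hcon
    have hZ' : 2 * B < ‖tensorForm Z‖ := hZ
    exact absurd (norm_tensorForm_le_of_grid Z hn hk hB fun G hG => (hcon G hG).le) (not_le.2 hZ')
  refine (measure_mono hsub).trans ((measure_biUnion_finset_le _ _).trans
    ((Finset.sum_le_sum fun G _ => hS G).trans (le_of_eq ?_)))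
  rw [Finset.sum_const, nsmul_eq_mul,
    ENNReal.ofReal_mul (p := (2 * (n : ℝ) + 1) ^ (n * k)) (by positivity)]
  congr 1
  rw [← ENNReal.ofReal_natCast]
  congr 1
  simp [← pow_mul]

end Net

/-! ### Net entropy n log n against the exponent n^{1+2ε}. -/

section NetAsymptotics

lemma tendsto_grid_bound (k : ℕ) {ε : ℝ} (hε : 0 < ε) :
    Tendsto (fun n : ℕ => (2 * (n : ℝ) + 1) ^ (n * k)
      * (2 * Real.exp (-(n * ((n : ℝ) ^ ε) ^ 2) / 2))) atTop (𝓝 0) := by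
  -- Calibrated so that, with (2n+1)^{2ε} ≤ 3^{2ε} n^{2ε}, the entropy k log(2n+1) is at most
  -- n^{2ε}/4, half of the available n^{2ε}/2.
  have hc : (0 : ℝ) < 1 / (4 * (k + 1) * 3 ^ (2 * ε)) := by positivity
  have hcast : Tendsto (fun n : ℕ => 2 * (n : ℝ) + 1) atTop atTop :=
    tendsto_atTop_add_const_right _ _
      (tendsto_natCast_atTop_atTop.const_mul_atTop (by norm_num))
  have h1 := hcast.eventually ((isLittleO_log_rpow_atTop (by positivity : 0 < 2 * ε)).bound hc)
  have h2 := ((tendsto_rpow_atTop (by positivity : 0 < 2 * ε)).comp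
    (tendsto_natCast_atTop_atTop (R := ℝ))).eventually_ge_atTop 4
  have hlim : Tendsto (fun n : ℕ => 2 * Real.exp (-(n : ℝ))) atTop (𝓝 0) := by
    have := (Real.tendsto_exp_neg_atTop_nhds_zero.comp
      (tendsto_natCast_atTop_atTop (R := ℝ))).const_mul 2
    simpa using this
  refine tendsto_of_tendsto_of_tendsto_of_le_of_le' tendsto_const_nhds hlim
    (Eventually.of_forall fun n => by positivity) ?_
  filter_upwards [h1, h2, eventually_ge_atTop 1] with n h1 h2 hn
  have hn' : (1 : ℝ) ≤ n := by exact_mod_cast hn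
  have hpos : (0 : ℝ) < 2 * n + 1 := by positivity
  simp only [Function.comp] at h2
  have h3 : Real.log (2 * n + 1) ≤ 1 / (4 * (k + 1)) * (n : ℝ) ^ (2 * ε) := by
    refine (le_abs_self _).trans ?_
    rw [Real.norm_eq_abs, Real.norm_eq_abs, abs_of_nonneg (Real.rpow_nonneg hpos.le (2 * ε))] at h1
    refine h1.trans ?_
    have h4 : (2 * (n : ℝ) + 1) ^ (2 * ε) ≤ 3 ^ (2 * ε) * (n : ℝ) ^ (2 * ε) := by
      rw [← Real.mul_rpow (by norm_num) (by positivity)]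
      gcongr
      linarith
    calc _ ≤ 1 / (4 * ((k : ℝ) + 1) * 3 ^ (2 * ε)) * (3 ^ (2 * ε) * (n : ℝ) ^ (2 * ε)) := by
          gcongr
      _ = _ := by field_simp
  have h5 : ((n : ℝ) ^ ε) ^ 2 = (n : ℝ) ^ (2 * ε) := by
    rw [← Real.rpow_natCast, ← Real.rpow_mul (by positivity), mul_comm ε]
    norm_num
  rw [h5, ← Real.exp_log (show 0 < (2 * (n : ℝ) + 1) ^ (n * k) by positivity), Real.log_pow,
    mul_left_comm, ← Real.exp_add]
  gcongr
  push_cast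
  have h6 : (k : ℝ) * Real.log (2 * n + 1) ≤ (n : ℝ) ^ (2 * ε) / 4 := by
    calc (k : ℝ) * Real.log (2 * n + 1) ≤ (k + 1) * (1 / (4 * (k + 1)) * (n : ℝ) ^ (2 * ε)) := by
          gcongr
          · exact Real.log_nonneg (by linarith)
          · linarith
      _ = _ := by field_simp
  nlinarith

end NetAsymptotics


/-! ### One step of the iteration in an abstract inner product space. -/

section Dynamics

variable {E : Type*} [NormedAddCommGroup E] [InnerProductSpace ℝ E]

lemma norm_normalize_sub_le {z z' : E} (hz : 1 / 2 ≤ ‖z‖) (hz' : z' ≠ 0) :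
    ‖‖z‖⁻¹ • z - ‖z'‖⁻¹ • z'‖ ≤ 4 * ‖z - z'‖ := by
  have ha : 0 < ‖z‖ := by linarith
  have hb : 0 < ‖z'‖ := norm_pos_iff.2 hz'
  have h1 : ‖z‖⁻¹ • z - ‖z'‖⁻¹ • z' = ‖z‖⁻¹ • (z - z') + (‖z‖⁻¹ - ‖z'‖⁻¹) • z' := by
    module
  have h2 : ‖(‖z‖⁻¹ - ‖z'‖⁻¹) • z'‖ ≤ ‖z‖⁻¹ * ‖z - z'‖ := by
    rw [norm_smul, Real.norm_eq_abs, inv_sub_inv ha.ne' hb.ne', abs_div, abs_of_pos (mul_pos ha hb),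
      abs_sub_comm]
    have := abs_norm_sub_norm_le z z'
    calc |‖z‖ - ‖z'‖| / (‖z‖ * ‖z'‖) * ‖z'‖ = ‖z‖⁻¹ * |‖z‖ - ‖z'‖| := by field_simp
      _ ≤ _ := by gcongr
  have h3 : ‖z‖⁻¹ ≤ 2 := by
    rw [inv_le_comm₀ ha two_pos]
    linarith
  rw [h1]
  refine (norm_add_le _ _).trans ?_
  rw [norm_smul, norm_inv, norm_norm]
  nlinarith [norm_nonneg (z - z')]

/-- One unnormalized step of the power iteration with signal `β v^{⊗(m+1)}` and noise map `h`. -/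
def signalStep (β : ℝ) (m : ℕ) (v : E) (h : E → E) (w : E) : E :=
  (β * inner ℝ v w ^ m) • v + h w

variable {β : ℝ} {m : ℕ} {v : E} {h : E → E} {w : E}

lemma inner_signalStep (hv : ‖v‖ = 1) :
    inner ℝ v (signalStep β m v h w) = β * inner ℝ v w ^ m + inner ℝ v (h w) := by
  rw [signalStep, inner_add_right, inner_smul_right, real_inner_self_eq_norm_sq, hv]
  ring

lemma norm_signalStep_sq (hv : ‖v‖ = 1) :
    ‖signalStep β m v h w‖ ^ 2
      = (β * inner ℝ v w ^ m + inner ℝ v (h w)) ^ 2 + (‖h w‖ ^ 2 - inner ℝ v (h w) ^ 2) := by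
  rw [signalStep, norm_add_sq_real, inner_smul_left, norm_smul, hv, Real.norm_eq_abs, mul_one,
    sq_abs]
  simp only [conj_trivial]
  ring

lemma le_norm_signalStep (hv : ‖v‖ = 1) :
    β * inner ℝ v w ^ m + inner ℝ v (h w) ≤ ‖signalStep β m v h w‖ := by
  rw [← inner_signalStep hv]
  simpa [hv] using real_inner_le_norm v (signalStep β m v h w)

lemma inner_normalize_signalStep (hv : ‖v‖ = 1) :
    inner ℝ v (‖signalStep β m v h w‖⁻¹ • signalStep β m v h w)
      = (β * inner ℝ v w ^ m + inner ℝ v (h w)) / ‖signalStep β m v h w‖ := by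
  rw [inner_smul_right, inner_signalStep hv]
  ring

lemma norm_normalize_signalStep (hv : ‖v‖ = 1) (hx : 0 < β * inner ℝ v w ^ m + inner ℝ v (h w)) :
    ‖‖signalStep β m v h w‖⁻¹ • signalStep β m v h w‖ = 1 := by
  have := hx.trans_le (le_norm_signalStep hv)
  rw [norm_smul, norm_inv, norm_norm, inv_mul_cancel₀ this.ne']

/-- The normalising factor is at most √(x² + 2) for x the new signal coordinate: below 2x when x ≥
1, below 2 otherwise. -/
lemma min_le_inner_normalize (hv : ‖v‖ = 1)
    (hx : 0 < β * inner ℝ v w ^ m + inner ℝ v (h w)) (hh : ‖h w‖ ^ 2 ≤ 2) :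
    min (1 / 2) ((β * inner ℝ v w ^ m + inner ℝ v (h w)) / 2)
      ≤ inner ℝ v (‖signalStep β m v h w‖⁻¹ • signalStep β m v h w) := by
  have hy := hx.trans_le (le_norm_signalStep hv)
  rw [inner_normalize_signalStep hv]
  have hsq := norm_signalStep_sq (β := β) (m := m) (h := h) (w := w) hv
  set x := β * inner ℝ v w ^ m + inner ℝ v (h w)
  set N := ‖signalStep β m v h w‖
  have hN : N ^ 2 ≤ x ^ 2 + 2 := by
    rw [hsq]; nlinarith [sq_nonneg (inner ℝ v (h w))]
  rw [le_div_iff₀ hy]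
  rcases le_total 1 x with h1 | h1
  · have : N ≤ 2 * x := by
      refine le_of_pow_le_pow_left₀ two_ne_zero (by positivity) ?_
      nlinarith
    calc _ ≤ 1 / 2 * N := by gcongr; exact min_le_left _ _
      _ ≤ x := by linarith
  · have : N ≤ 2 := by
      refine le_of_pow_le_pow_left₀ two_ne_zero (by positivity) ?_
      nlinarith
    calc _ ≤ x / 2 * N := by gcongr; exact min_le_right _ _
      _ ≤ x := by nlinarith

/-- The left side is the squared sine of the angle to `v`, produced solely by the noise component
orthogonal to `v`. -/
lemma one_sub_inner_normalize_sq_le (hv : ‖v‖ = 1)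
    (hx : 0 < β * inner ℝ v w ^ m + inner ℝ v (h w)) :
    1 - inner ℝ v (‖signalStep β m v h w‖⁻¹ • signalStep β m v h w) ^ 2
      ≤ ‖h w‖ ^ 2 / (β * inner ℝ v w ^ m + inner ℝ v (h w)) ^ 2 := by
  have hle := le_norm_signalStep (β := β) (m := m) (h := h) (w := w) hv
  have hy := hx.trans_le hle
  rw [inner_normalize_signalStep hv]
  have hsq := norm_signalStep_sq (β := β) (m := m) (h := h) (w := w) hv
  set x := β * inner ℝ v w ^ m + inner ℝ v (h w)
  set N := ‖signalStep β m v h w‖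
  have h1 : 1 - (x / N) ^ 2 = (‖h w‖ ^ 2 - inner ℝ v (h w) ^ 2) / N ^ 2 := by
    field_simp
    linarith
  rw [h1]
  gcongr
  nlinarith [sq_nonneg (inner ℝ v (h w))]

lemma inner_le_one_of_unit (hv : ‖v‖ = 1) (hw : ‖w‖ = 1) : inner ℝ v w ≤ 1 := by
  simpa [hv, hw] using real_inner_le_norm v w

lemma abs_inner_le_norm_right (hv : ‖v‖ ≤ 1) (w : E) : |inner ℝ v w| ≤ ‖w‖ :=
  (abs_real_inner_le_norm v w).trans (mul_le_of_le_one_left (norm_nonneg _) hv)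

/-- Lipschitz constant, up to the factor `Λ / β`, of a normalized step. -/
def stepConst (m : ℕ) : ℝ := 4 * (m * 4 ^ m + 2 ^ m)

lemma stepConst_pos (m : ℕ) : 0 < stepConst m := by unfold stepConst; positivity

lemma half_pow_le {α : ℝ} (hα : 1 / 2 ≤ α) (m : ℕ) : 1 / 2 ^ m ≤ α ^ m := by
  rw [← one_div_pow]
  gcongr

variable {Λ : ℝ}

lemma signal_lower_bound (hv : ‖v‖ = 1) (hβ : 0 < β) (hΛ : 2 ^ (m + 1) * Λ ≤ β)
    (hα : 1 / 2 ≤ inner ℝ v w) (hw : ‖h w‖ ≤ Λ) :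
    β / 2 ^ (m + 1) ≤ β * inner ℝ v w ^ m + inner ℝ v (h w) := by
  have h1 := half_pow_le hα m
  have h2 := (abs_le.1 ((abs_inner_le_norm_right hv.le (h w)).trans hw)).1
  have h3 : β * (1 / 2 ^ m) ≤ β * inner ℝ v w ^ m := by gcongr
  have h4 : Λ ≤ β / 2 ^ (m + 1) := by
    rw [le_div_iff₀ (by positivity)]; linarith
  have h5 : β * (1 / 2 ^ m) = 2 * (β / 2 ^ (m + 1)) := by
    rw [pow_succ]; field_simp
  linarith

lemma half_le_inner_normalize (hv : ‖v‖ = 1) (hβ : 0 < β) (hΛ : 2 ^ (m + 1) * Λ ≤ β)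
    (hα : 1 / 2 ≤ inner ℝ v w) (hw : ‖h w‖ ≤ Λ) :
    1 / 2 ≤ inner ℝ v (‖signalStep β m v h w‖⁻¹ • signalStep β m v h w) := by
  have hx := signal_lower_bound hv hβ hΛ hα hw
  have hΛx : Λ ≤ β / 2 ^ (m + 1) := by
    rw [le_div_iff₀ (by positivity)]; linarith
  have hβ' : 0 < β / 2 ^ (m + 1) := by positivity
  have hy := (hβ'.trans_le hx).trans_le (le_norm_signalStep hv)
  rw [inner_normalize_signalStep hv]
  have hsq := norm_signalStep_sq (β := β) (m := m) (h := h) (w := w) hv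
  set x := β * inner ℝ v w ^ m + inner ℝ v (h w)
  set N := ‖signalStep β m v h w‖
  rw [le_div_iff₀ hy]
  have : N ≤ 2 * x := by
    refine le_of_pow_le_pow_left₀ two_ne_zero (by linarith) ?_
    nlinarith [sq_nonneg (inner ℝ v (h w)), norm_nonneg (h w)]
  linarith

/-- Dividing a step by βα^m, with α the correlation, keeps its direction and leaves `v` plus a small
noise term, of norm at least 1/2. There normalisation is 4-Lipschitz, and both the prefactor of the
noise and the noise map contribute a variation of order Λ/β. -/
lemma norm_normalize_signalStep_sub_le (hv : ‖v‖ = 1) (hβ : 0 < β) (hΛ : 2 ^ (m + 1) * Λ ≤ β)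
    {w' : E} (hw1 : ‖w‖ = 1) (hw1' : ‖w'‖ = 1)
    (hα : 1 / 2 ≤ inner ℝ v w) (hα' : 1 / 2 ≤ inner ℝ v w') (hw : ‖h w‖ ≤ Λ) (hw' : ‖h w'‖ ≤ Λ)
    (hlip : ‖h w - h w'‖ ≤ Λ * ‖w - w'‖) :
    ‖‖signalStep β m v h w‖⁻¹ • signalStep β m v h w
        - ‖signalStep β m v h w'‖⁻¹ • signalStep β m v h w'‖
      ≤ stepConst m * Λ / β * ‖w - w'‖ := by
  have hΛ0 : 0 ≤ Λ := (norm_nonneg _).trans hw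
  have key : ∀ w : E, 1 / 2 ≤ inner ℝ v w → ‖h w‖ ≤ Λ →
      ‖signalStep β m v h w‖⁻¹ • signalStep β m v h w
        = ‖v + (β * inner ℝ v w ^ m)⁻¹ • h w‖⁻¹ • (v + (β * inner ℝ v w ^ m)⁻¹ • h w)
      ∧ 1 / 2 ≤ ‖v + (β * inner ℝ v w ^ m)⁻¹ • h w‖ := by
    intro w hα hw
    have hs : 0 < β * inner ℝ v w ^ m := by
      have : 0 < inner ℝ v w := by linarith
      positivity
    constructor
    · have h1 : signalStep β m v h w
          = (β * inner ℝ v w ^ m) • (v + (β * inner ℝ v w ^ m)⁻¹ • h w) := by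
        rw [smul_add, smul_smul, mul_inv_cancel₀ hs.ne', one_smul]
        rfl
      rw [h1, norm_smul, Real.norm_eq_abs, abs_of_pos hs, smul_smul, mul_inv]
      congr 1
      field_simp
    · have h2 := signal_lower_bound hv hβ hΛ hα hw
      have h3 : inner ℝ v (v + (β * inner ℝ v w ^ m)⁻¹ • h w) ≤ ‖v + (β * inner ℝ v w ^ m)⁻¹ • h w‖ := by
        simpa [hv] using real_inner_le_norm v (v + (β * inner ℝ v w ^ m)⁻¹ • h w)
      refine le_trans ?_ h3
      rw [inner_add_right, inner_smul_right, real_inner_self_eq_norm_sq, hv]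
      have h4 := (abs_le.1 ((abs_inner_le_norm_right hv.le (h w)).trans hw)).1
      have h5 : β * (1 / 2 ^ m) ≤ β * inner ℝ v w ^ m := by
        gcongr; exact half_pow_le hα m
      have h6 : 2 * Λ ≤ β * inner ℝ v w ^ m := by
        refine le_trans ?_ h5
        rw [mul_one_div, le_div_iff₀ (by positivity)]
        rw [pow_succ] at hΛ
        linarith
      have h7 : -(1 / 2) ≤ (β * inner ℝ v w ^ m)⁻¹ * inner ℝ v (h w) := by
        rw [inv_mul_eq_div, le_div_iff₀ hs]
        linarith
      linarith
  obtain ⟨e1, l1⟩ := key w hα hw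
  obtain ⟨e2, l2⟩ := key w' hα' hw'
  rw [e1, e2]
  refine (norm_normalize_sub_le l1 (norm_pos_iff.1 (by linarith))).trans ?_
  have hp : 0 < inner ℝ v w ^ m := lt_of_lt_of_le (by positivity) (half_pow_le hα m)
  have hp' : 0 < inner ℝ v w' ^ m := lt_of_lt_of_le (by positivity) (half_pow_le hα' m)
  have hd : |inner ℝ v w ^ m - inner ℝ v w' ^ m| ≤ m * ‖w - w'‖ := by
    have h1 := abs_pow_sub_pow_le (inner ℝ v w) (inner ℝ v w') m
    have h2 : |inner ℝ v w - inner ℝ v w'| ≤ ‖w - w'‖ := by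
      rw [← inner_sub_right]
      exact abs_inner_le_norm_right hv.le _
    have h3 : max |inner ℝ v w| |inner ℝ v w'| ^ (m - 1) ≤ 1 := by
      refine pow_le_one₀ (le_max_of_le_left (abs_nonneg _)) (max_le ?_ ?_)
      · simpa [hw1] using abs_inner_le_norm_right hv.le w
      · simpa [hw1'] using abs_inner_le_norm_right hv.le w'
    refine h1.trans ?_
    calc _ ≤ ‖w - w'‖ * m * 1 := by gcongr
      _ = _ := by ring
  have h1 : (v + (β * inner ℝ v w ^ m)⁻¹ • h w) - (v + (β * inner ℝ v w' ^ m)⁻¹ • h w')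
      = ((β * inner ℝ v w ^ m)⁻¹ - (β * inner ℝ v w' ^ m)⁻¹) • h w
        + (β * inner ℝ v w' ^ m)⁻¹ • (h w - h w') := by module
  have h2 : |(β * inner ℝ v w ^ m)⁻¹ - (β * inner ℝ v w' ^ m)⁻¹|
      ≤ m * 4 ^ m / β * ‖w - w'‖ := by
    have e : (β * inner ℝ v w ^ m)⁻¹ - (β * inner ℝ v w' ^ m)⁻¹
        = -(inner ℝ v w ^ m - inner ℝ v w' ^ m) / (β * (inner ℝ v w ^ m * inner ℝ v w' ^ m)) := by
      field_simp
      ring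
    rw [e, abs_div, abs_neg, abs_of_pos (by positivity : 0 < β * (inner ℝ v w ^ m * inner ℝ v w' ^ m))]
    have h4 : (1 : ℝ) / 4 ^ m ≤ inner ℝ v w ^ m * inner ℝ v w' ^ m := by
      have : (1 : ℝ) / 4 ^ m = 1 / 2 ^ m * (1 / 2 ^ m) := by
        rw [one_div_mul_one_div, ← mul_pow]; norm_num
      rw [this]
      gcongr
      · exact half_pow_le hα m
      · exact half_pow_le hα' m
    calc _ ≤ (m * ‖w - w'‖) / (β * (1 / 4 ^ m)) := by gcongr
      _ = _ := by field_simp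
  have h3 : |(β * inner ℝ v w' ^ m)⁻¹| ≤ 2 ^ m / β := by
    rw [abs_of_pos (by positivity), mul_inv, div_eq_mul_inv, mul_comm]
    gcongr
    rw [inv_le_comm₀ hp' (by positivity), ← one_div]
    exact half_pow_le hα' m
  rw [h1]
  have h5 : ‖((β * inner ℝ v w ^ m)⁻¹ - (β * inner ℝ v w' ^ m)⁻¹) • h w
        + (β * inner ℝ v w' ^ m)⁻¹ • (h w - h w')‖
      ≤ (m * 4 ^ m / β * ‖w - w'‖) * Λ + 2 ^ m / β * (Λ * ‖w - w'‖) := by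
    refine (norm_add_le _ _).trans ?_
    rw [norm_smul, norm_smul, Real.norm_eq_abs, Real.norm_eq_abs]
    gcongr
  calc _ ≤ 4 * ((m * 4 ^ m / β * ‖w - w'‖) * Λ + 2 ^ m / β * (Λ * ‖w - w'‖)) := by gcongr
    _ = _ := by rw [stepConst]; ring

end Dynamics


/-! ### Whole trajectories: growth, invariance, contraction, late iterates. -/

section Trajectory

variable {E : Type*} [NormedAddCommGroup E] [InnerProductSpace ℝ E]

/-- A power iteration trajectory with signal `β v^{⊗(m+1)}` and noise map `h`, which is bounded by
`Λ` and `Λ`-Lipschitz on the unit sphere, and for whose first `K` iterates the noise behaves, up to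
`δ`, like fresh noise. -/
structure IsNoisyTrajectory (β : ℝ) (m : ℕ) (v b : E) (h : E → E) (Λ δ : ℝ) (K : ℕ) (u : ℕ → E) :
    Prop where
  norm_v : ‖v‖ = 1
  norm_b : ‖b‖ ≤ 1
  norm_zero : ‖u 0‖ = 1
  step : ∀ t, u (t + 1) = ‖signalStep β m v h (u t)‖⁻¹ • signalStep β m v h (u t)
  bound : ∀ w, ‖w‖ = 1 → ‖h w‖ ≤ Λ
  lipschitz : ∀ w w', ‖w‖ = 1 → ‖w'‖ = 1 → ‖h w - h w'‖ ≤ Λ * ‖w - w'‖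
  -- Unit norm is a premise here because normalising a zero vector gives zero; it is propagated
  -- together with the lower bound on the correlation.
  inner_v : ∀ t ≤ K, ‖u t‖ = 1 → |inner ℝ v (h (u t))| ≤ δ
  norm_sq : ∀ t ≤ K, ‖u t‖ = 1 → |‖h (u t)‖ ^ 2 - 1| ≤ δ
  inner_b : ∀ t ≤ K, ‖u t‖ = 1 →
    |inner ℝ b (h (u t)) - inner ℝ v (u t) ^ m * inner ℝ b (h v)|
      ≤ δ * √(1 - (inner ℝ v (u t) ^ m) ^ 2)
  inner_b_signal : |inner ℝ b (h v)| ≤ δ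

namespace IsNoisyTrajectory

variable {β : ℝ} {m : ℕ} {v b : E} {h : E → E} {Λ δ : ℝ} {K : ℕ} {u : ℕ → E}
  (H : IsNoisyTrajectory β m v b h Λ δ K u)
include H

lemma delta_nonneg : 0 ≤ δ := (abs_nonneg _).trans H.inner_b_signal

/-- Geometric growth of the correlation with the signal. -/
lemma growth (hm : 1 ≤ m) (hβ : 0 < β) (hα0 : 0 < inner ℝ v (u 0)) {ρ : ℝ} (hρ4 : 4 ≤ ρ)
    (hρm : 2 ^ (m + 1) ≤ ρ) (hρ : ρ ≤ β * inner ℝ v (u 0) ^ (m - 1)) (hδ1 : δ ≤ 1)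
    (hδ : 2 * δ ≤ ρ * inner ℝ v (u 0)) :
    ∀ t ≤ K, ‖u t‖ = 1 ∧ min (1 / 2) (inner ℝ v (u 0) * (ρ / 4) ^ t) ≤ inner ℝ v (u t) := by
  set α0 := inner ℝ v (u 0)
  have hα01 : α0 ≤ 1 := inner_le_one_of_unit H.norm_v H.norm_zero
  have hρβ : ρ ≤ β := hρ.trans (mul_le_of_le_one_right hβ.le (pow_le_one₀ hα0.le hα01))
  have hr1 : 1 ≤ ρ / 4 := by linarith
  intro t
  induction t with
  | zero => exact fun _ => ⟨H.norm_zero, by simp [α0]⟩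
  | succ t ih =>
    intro ht
    obtain ⟨hu, hα⟩ := ih (by omega)
    set α := inner ℝ v (u t) with hαdef
    have hp := (abs_le.1 (H.inner_v t (by omega) hu)).1
    have hh : ‖h (u t)‖ ^ 2 ≤ 2 := by
      have := (abs_le.1 (H.norm_sq t (by omega) hu)).2
      linarith
    have hpow : 1 ≤ (ρ / 4) ^ t := one_le_pow₀ hr1
    -- If α ≥ 1/2 the signal is at least 2 and the noise at most 1. Otherwise βα^m ≥ ρα, of which
    -- the noise takes at most half; normalisation takes another half, hence the rate ρ/4.
    have hx : min 1 (α0 * (ρ / 4) ^ (t + 1) * 2) ≤ β * α ^ m + inner ℝ v (h (u t)) := by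
      rcases le_or_gt (1 / 2) α with h1 | h1
      · refine (min_le_left _ _).trans ?_
        have h2 := half_pow_le h1 m
        have h3 : ρ * (1 / 2 ^ m) ≤ β * α ^ m := by gcongr
        have h4 : 2 ≤ ρ * (1 / 2 ^ m) := by
          rw [mul_one_div, le_div_iff₀ (by positivity)]
          rw [pow_succ] at hρm
          linarith
        linarith
      · refine (min_le_right _ _).trans ?_
        have h2 : α0 * (ρ / 4) ^ t ≤ α := by
          rcases min_le_iff.1 hα with h3 | h3
          · linarith
          · exact h3
        have h3 : α0 ≤ α := (le_mul_of_one_le_right hα0.le hpow).trans h2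
        have h4 : ρ * α ≤ β * α ^ m := by
          obtain ⟨l, rfl⟩ : ∃ l, m = l + 1 := ⟨m - 1, by omega⟩
          rw [pow_succ, ← mul_assoc]
          have h0 : 0 ≤ α := hα0.le.trans h3
          gcongr
          refine hρ.trans ?_
          simp only [Nat.add_sub_cancel]
          gcongr
        have h5 : ρ * α0 ≤ ρ * α := by gcongr
        have h6 : α0 * (ρ / 4) ^ (t + 1) * 2 ≤ ρ * α / 2 := by
          calc α0 * (ρ / 4) ^ (t + 1) * 2 = ρ / 2 * (α0 * (ρ / 4) ^ t) := by ring
            _ ≤ ρ / 2 * α := by gcongr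
            _ = _ := by ring
        linarith
    have hx0 : 0 < β * α ^ m + inner ℝ v (h (u t)) :=
      lt_of_lt_of_le (lt_min one_pos (by positivity)) hx
    rw [H.step t]
    refine ⟨norm_normalize_signalStep H.norm_v hx0, ?_⟩
    refine le_trans ?_ (min_le_inner_normalize H.norm_v hx0 hh)
    refine le_min (min_le_left _ _) ?_
    rw [le_div_iff₀ two_pos]
    refine le_trans (le_of_eq ?_) hx
    rw [min_mul_of_nonneg _ _ two_pos.le]
    norm_num

lemma half_le_succ_of_le {t : ℕ} (ht : t ≤ K) (hu : ‖u t‖ = 1) (hβ : 0 < β) {c : ℝ} (hc : 0 < c)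
    (hα : c ≤ inner ℝ v (u t)) (hδ1 : δ ≤ 1) (hβc : 4 ≤ β * c ^ m) :
    ‖u (t + 1)‖ = 1 ∧ 1 / 2 ≤ inner ℝ v (u (t + 1)) := by
  have hp := (abs_le.1 (H.inner_v t ht hu)).1
  have hh : ‖h (u t)‖ ^ 2 ≤ 2 := by
    have := (abs_le.1 (H.norm_sq t ht hu)).2
    linarith
  have h1 : β * c ^ m ≤ β * inner ℝ v (u t) ^ m := by gcongr
  have hx : 3 ≤ β * inner ℝ v (u t) ^ m + inner ℝ v (h (u t)) := by linarith
  rw [H.step t]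
  refine ⟨norm_normalize_signalStep H.norm_v (by linarith), ?_⟩
  refine le_trans ?_ (min_le_inner_normalize H.norm_v (by linarith) hh)
  exact le_min le_rfl (by linarith)

/-- Correlation at least 1/2 is self-sustaining using only the uniform bound Λ on the noise, so no
concentration is needed and all later times are covered. -/
lemma half_le_of_le {t₁ : ℕ} (h1 : ‖u t₁‖ = 1) (hα1 : 1 / 2 ≤ inner ℝ v (u t₁)) (hβ : 0 < β)
    (hΛ : 2 ^ (m + 1) * Λ ≤ β) {t : ℕ} (ht : t₁ ≤ t) :
    ‖u t‖ = 1 ∧ 1 / 2 ≤ inner ℝ v (u t) := by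
  induction t, ht using Nat.le_induction with
  | base => exact ⟨h1, hα1⟩
  | succ t _ ih =>
    obtain ⟨hu, hα⟩ := ih
    have hx := signal_lower_bound (m := m) H.norm_v hβ hΛ hα (H.bound _ hu)
    rw [H.step t]
    exact ⟨norm_normalize_signalStep H.norm_v (lt_of_lt_of_le (by positivity) hx),
      half_le_inner_normalize H.norm_v hβ hΛ hα (H.bound _ hu)⟩

lemma norm_succ_sub_le {t₁ : ℕ} (h1 : ‖u t₁‖ = 1) (hα1 : 1 / 2 ≤ inner ℝ v (u t₁)) (hβ : 0 < β)
    (hΛ : 2 ^ (m + 1) * Λ ≤ β) (j : ℕ) :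
    ‖u (t₁ + j + 1) - u (t₁ + j)‖ ≤ 2 * (stepConst m * Λ / β) ^ j := by
  have hΛ0 : 0 ≤ Λ := (norm_nonneg _).trans (H.bound _ h1)
  have hκ : 0 ≤ stepConst m * Λ / β := by
    have := stepConst_pos m
    positivity
  induction j with
  | zero =>
    have h2 := (H.half_le_of_le h1 hα1 hβ hΛ (Nat.le_succ t₁)).1
    have := norm_sub_le (u (t₁ + 1)) (u t₁)
    rw [h1, h2] at this
    simpa using (by linarith : ‖u (t₁ + 1) - u t₁‖ ≤ 2)
  | succ j ih =>
    obtain ⟨hu, hα⟩ := H.half_le_of_le h1 hα1 hβ hΛ (show t₁ ≤ t₁ + j by omega)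
    obtain ⟨hu', hα'⟩ := H.half_le_of_le h1 hα1 hβ hΛ (show t₁ ≤ t₁ + j + 1 by omega)
    have h3 := norm_normalize_signalStep_sub_le H.norm_v hβ hΛ hu' hu hα' hα (H.bound _ hu')
      (H.bound _ hu) (H.lipschitz _ _ hu' hu)
    rw [← H.step, ← H.step] at h3
    calc ‖u (t₁ + (j + 1) + 1) - u (t₁ + (j + 1))‖
        ≤ stepConst m * Λ / β * ‖u (t₁ + j + 1) - u (t₁ + j)‖ := h3
      _ ≤ stepConst m * Λ / β * (2 * (stepConst m * Λ / β) ^ j) := by gcongr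
      _ = _ := by ring

/-- Consecutive increments decay geometrically with ratio at most 1/2, so the total drift after time
`K` is at most twice its first term. -/
lemma norm_sub_le_of_le {t₁ : ℕ} (h1 : ‖u t₁‖ = 1) (hα1 : 1 / 2 ≤ inner ℝ v (u t₁)) (hβ : 0 < β)
    (hΛ : 2 ^ (m + 1) * Λ ≤ β) (hκ : stepConst m * Λ / β ≤ 1 / 2) (hK : t₁ ≤ K) {t : ℕ}
    (ht : K ≤ t) :
    ‖u t - u K‖ ≤ 4 * (stepConst m * Λ / β) ^ (K - t₁) := by
  have hΛ0 : 0 ≤ Λ := (norm_nonneg _).trans (H.bound _ h1)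
  have hκ0 : 0 ≤ stepConst m * Λ / β := by
    have := stepConst_pos m
    positivity
  set κ := stepConst m * Λ / β with hκdef
  obtain ⟨j, rfl⟩ := Nat.exists_eq_add_of_le ht
  -- The partial sum of the geometric series is carried along to close the induction.
  have key : ‖u (K + j) - u K‖ ≤ 4 * κ ^ (K - t₁) * (1 - (1 / 2) ^ j) := by
    induction j with
    | zero => simp
    | succ j ih =>
      have h2 := H.norm_succ_sub_le h1 hα1 hβ hΛ (K - t₁ + j)
      rw [show t₁ + (K - t₁ + j) = K + j by omega, ← hκdef] at h2
      have h3 : κ ^ (K - t₁ + j) ≤ κ ^ (K - t₁) * (1 / 2) ^ j := by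
        rw [pow_add]; gcongr
      have h4 : u (K + (j + 1)) - u K = (u (K + j + 1) - u (K + j)) + (u (K + j) - u K) := by
        rw [← add_assoc]; abel
      rw [h4]
      refine (norm_add_le _ _).trans ?_
      have := ih (by omega)
      calc _ ≤ 2 * (κ ^ (K - t₁) * (1 / 2) ^ j) + 4 * κ ^ (K - t₁) * (1 - (1 / 2) ^ j) := by
            linarith
        _ = _ := by rw [pow_succ]; ring
  refine key.trans (mul_le_of_le_one_right (by positivity) ?_)
  have : (0 : ℝ) ≤ (1 / 2) ^ j := by positivity
  linarith

end IsNoisyTrajectory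

/-- The behaviour of all late iterates of a noisy power iteration trajectory. -/
structure IsLateIterate (β : ℝ) (m : ℕ) (v b : E) (h : E → E) (C δ : ℝ) (w : E) : Prop where
  norm_eq : ‖w‖ = 1
  half_le : 1 / 2 ≤ inner ℝ v w
  one_sub_sq_le : 1 - inner ℝ v w ^ 2 ≤ C / β ^ 2
  inner_v : |inner ℝ v (h w)| ≤ C * δ
  norm_sq : |‖h w‖ ^ 2 - 1| ≤ C * δ
  inner_b : |inner ℝ b (h w) - inner ℝ b (h v)| ≤ C * δ / β

/-- Constant in the description of late iterates. -/
def lateConst (m : ℕ) : ℝ := 2 + 3 * (m + 1) * (12 * 4 ^ m)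

lemma one_sub_pow_le {α : ℝ} (h0 : 0 ≤ α) (m : ℕ) : 1 - α ^ m ≤ m * (1 - α) := by
  have := one_add_mul_le_pow (a := α - 1) (by linarith) m
  rw [add_sub_cancel] at this
  linarith

namespace IsNoisyTrajectory

variable {β : ℝ} {m : ℕ} {v b : E} {h : E → E} {Λ δ : ℝ} {K : ℕ} {u : ℕ → E}
  (H : IsNoisyTrajectory β m v b h Λ δ K u)
include H

/-- Up to time `K` the statistics come from the trajectory hypotheses. Beyond `K` the iterate is
compared with `u K`: `hτ` makes the drift at most δ/β, even after the Lipschitz factor Λ and the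
factor 2Λ lost in comparing squared norms. -/
lemma isLateIterate {t₁ : ℕ} (h1 : ‖u t₁‖ = 1) (hα1 : 1 / 2 ≤ inner ℝ v (u t₁)) (hβ : 1 ≤ β)
    (hΛ1 : 1 ≤ Λ) (hδ1 : δ ≤ 1)
    (hΛ : 2 ^ (m + 1) * Λ ≤ β) (hκ : stepConst m * Λ / β ≤ 1 / 2) (hK : t₁ + 1 ≤ K)
    (hτ : 8 * Λ ^ 2 * (stepConst m * Λ / β) ^ (K - t₁) ≤ δ / β) {t : ℕ} (ht : t₁ + 1 ≤ t) :
    IsLateIterate β m v b h (lateConst m) δ (u t) := by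
  have hβ0 : 0 < β := by linarith
  have hδ0 := H.delta_nonneg
  have hv := H.norm_v
  set κ := stepConst m * Λ / β with hκdef
  have hκ0 : 0 ≤ κ := by
    have := stepConst_pos m
    positivity
  obtain ⟨hu, hα⟩ := H.half_le_of_le h1 hα1 hβ0 hΛ (show t₁ ≤ t by omega)
  have hdiff : ∀ s, K ≤ s → ‖h (u s)‖ ≤ Λ ∧ Λ * ‖u s - u K‖ * (2 * Λ) ≤ δ / β ∧
      ‖h (u s) - h (u K)‖ ≤ Λ * ‖u s - u K‖ := by
    intro s hs
    have hus := (H.half_le_of_le h1 hα1 hβ0 hΛ (show t₁ ≤ s by omega)).1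
    have huK := (H.half_le_of_le h1 hα1 hβ0 hΛ (show t₁ ≤ K by omega)).1
    refine ⟨H.bound _ hus, ?_, H.lipschitz _ _ hus huK⟩
    have h2 := H.norm_sub_le_of_le h1 hα1 hβ0 hΛ hκ (by omega) hs
    refine le_trans ?_ hτ
    calc Λ * ‖u s - u K‖ * (2 * Λ) ≤ Λ * (4 * κ ^ (K - t₁)) * (2 * Λ) := by gcongr
      _ = _ := by ring
  have hδβ : δ / β ≤ δ := div_le_self hδ0 hβ
  have huK := (H.half_le_of_le h1 hα1 hβ0 hΛ (show t₁ ≤ K by omega)).1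
  -- the first two noise statistics
  have hp : ∀ s, t₁ ≤ s → |inner ℝ v (h (u s))| ≤ 2 * δ := by
    intro s hs
    rcases le_total s K with hsK | hsK
    · have := H.inner_v s hsK (H.half_le_of_le h1 hα1 hβ0 hΛ hs).1
      linarith
    · obtain ⟨-, d2, d3⟩ := hdiff s hsK
      have e : inner ℝ v (h (u s)) = inner ℝ v (h (u K)) + inner ℝ v (h (u s) - h (u K)) := by
        rw [inner_sub_right]; ring
      have h3 := abs_inner_le_norm_right hv.le (h (u s) - h (u K))
      have h4 := H.inner_v K le_rfl huK
      have h5 : Λ * ‖u s - u K‖ ≤ Λ * ‖u s - u K‖ * (2 * Λ) :=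
        le_mul_of_one_le_right (by positivity) (by linarith)
      rw [e]
      refine (abs_add_le _ _).trans ?_
      linarith
  have hsq : ∀ s, t₁ ≤ s → |‖h (u s)‖ ^ 2 - 1| ≤ 2 * δ := by
    intro s hs
    rcases le_total s K with hsK | hsK
    · have := H.norm_sq s hsK (H.half_le_of_le h1 hα1 hβ0 hΛ hs).1
      linarith
    · obtain ⟨d1, d2, d3⟩ := hdiff s hsK
      have d1' := (hdiff K le_rfl).1
      have h4 := H.norm_sq K le_rfl huK
      have e : ‖h (u s)‖ ^ 2 - 1
          = (‖h (u K)‖ ^ 2 - 1) + (‖h (u s)‖ - ‖h (u K)‖) * (‖h (u s)‖ + ‖h (u K)‖) := by ring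
      have h5 : |(‖h (u s)‖ - ‖h (u K)‖) * (‖h (u s)‖ + ‖h (u K)‖)| ≤ δ := by
        rw [abs_mul, abs_of_nonneg (by positivity : 0 ≤ ‖h (u s)‖ + ‖h (u K)‖)]
        calc _ ≤ ‖h (u s) - h (u K)‖ * (Λ + Λ) := by
              gcongr
              exact abs_norm_sub_norm_le _ _
          _ ≤ Λ * ‖u s - u K‖ * (Λ + Λ) := by gcongr
          _ ≤ δ := by rw [← two_mul]; linarith
      rw [e]
      refine (abs_add_le _ _).trans ?_
      linarith
  -- closeness to the signal
  have hclose : ∀ s, t₁ + 1 ≤ s → 1 - inner ℝ v (u s) ^ 2 ≤ 12 * 4 ^ m / β ^ 2 := by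
    intro s hs
    obtain ⟨r, rfl⟩ : ∃ r, s = r + 1 := ⟨s - 1, by omega⟩
    have hr : t₁ ≤ r := by omega
    obtain ⟨hur, hαr⟩ := H.half_le_of_le h1 hα1 hβ0 hΛ hr
    have hx := signal_lower_bound (m := m) hv hβ0 hΛ hαr (H.bound _ hur)
    have hx0 : 0 < β / 2 ^ (m + 1) := by positivity
    have h2 : ‖h (u r)‖ ^ 2 ≤ 3 := by
      have := (abs_le.1 (hsq r hr)).2
      linarith
    rw [H.step r]
    refine (one_sub_inner_normalize_sq_le hv (hx0.trans_le hx)).trans ?_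
    calc _ ≤ 3 / (β / 2 ^ (m + 1)) ^ 2 := by gcongr
      _ = _ := by
        have e4 : (4 : ℝ) ^ m = (2 ^ m) ^ 2 := by
          rw [← pow_mul, mul_comm, pow_mul]
          norm_num
        rw [e4, pow_succ 2 m]
        field_simp
        norm_num
  have hαle : ∀ s, t₁ ≤ s → inner ℝ v (u s) ≤ 1 := fun s hs =>
    inner_le_one_of_unit hv (H.half_le_of_le h1 hα1 hβ0 hΛ hs).1
  set C := (12 : ℝ) * 4 ^ m with hC
  have hC1 : 1 ≤ C := by
    have : (1 : ℝ) ≤ 4 ^ m := one_le_pow₀ (by norm_num)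
    linarith
  have hb : ∀ s, t₁ + 1 ≤ s → s ≤ K →
      |inner ℝ b (h (u s)) - inner ℝ b (h v)| ≤ 2 * (m + 1) * C * δ / β := by
    intro s hs hsK
    obtain ⟨hus, hαs⟩ := H.half_le_of_le h1 hα1 hβ0 hΛ (show t₁ ≤ s by omega)
    have hα1 := hαle s (by omega)
    have hcl := hclose s hs
    set α := inner ℝ v (u s)
    have h3 := H.inner_b s hsK hus
    -- Since 1 - α² = O(1/β²), the square root is O(1/β): this gain makes the fluctuation of the
    -- iterate asymptotically that of the signal.
    have h4 : √(1 - (α ^ m) ^ 2) ≤ (m + 1) * C / β := by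
      apply Real.sqrt_le_iff.2 ⟨by positivity, ?_⟩
      have h5 : 1 - (α ^ 2) ^ m ≤ m * (1 - α ^ 2) :=
        one_sub_pow_le (sq_nonneg _) m
      calc 1 - (α ^ m) ^ 2 = 1 - (α ^ 2) ^ m := by rw [← pow_mul, ← pow_mul, mul_comm]
        _ ≤ m * (C / β ^ 2) := by
            refine h5.trans ?_
            gcongr
        _ ≤ ((m + 1) * C / β) ^ 2 := by
            rw [div_pow, ← mul_div_assoc]
            gcongr
            have : (1 : ℝ) ≤ (m + 1) * C := by
              have : (0 : ℝ) ≤ m := by positivity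
              nlinarith
            nlinarith
    have h6 : |(1 - α ^ m) * inner ℝ b (h v)| ≤ m * C * δ / β := by
      have h7 : 0 ≤ 1 - α ^ m := sub_nonneg.2 (pow_le_one₀ (by linarith) hα1)
      have h8 : 1 - α ^ m ≤ m * C / β := by
        refine (one_sub_pow_le (by linarith) m).trans ?_
        rw [mul_div_assoc]
        gcongr
        calc 1 - α ≤ 1 - α ^ 2 := by nlinarith
          _ ≤ C / β ^ 2 := hcl
          _ ≤ C / β := by
            gcongr
            nlinarith
      rw [abs_mul, abs_of_nonneg h7]
      calc _ ≤ m * C / β * δ := by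
            gcongr
            exact H.inner_b_signal
        _ = _ := by ring
    have e : inner ℝ b (h (u s)) - inner ℝ b (h v)
        = (inner ℝ b (h (u s)) - α ^ m * inner ℝ b (h v)) - (1 - α ^ m) * inner ℝ b (h v) := by ring
    rw [e]
    refine (abs_sub _ _).trans ?_
    calc _ ≤ δ * ((m + 1) * C / β) + m * C * δ / β := by
          refine add_le_add (h3.trans ?_) h6
          gcongr
      _ ≤ δ * ((m + 1) * C / β) + (m + 1) * C * δ / β := by gcongr; linarith
      _ = _ := by ring
  have hCm : (0 : ℝ) ≤ (m + 1) * C := by positivity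
  have hlate : 2 ≤ lateConst m := by rw [lateConst, ← hC]; linarith
  refine ⟨hu, hα, (hclose t ht).trans ?_, (hp t (by omega)).trans ?_, (hsq t (by omega)).trans ?_, ?_⟩
  · gcongr
    rw [lateConst, ← hC]
    have : (0 : ℝ) ≤ m := by positivity
    nlinarith
  · gcongr
  · gcongr
  · have hfin : 2 * (m + 1) * C * δ / β + δ / β ≤ lateConst m * δ / β := by
      rw [lateConst, ← hC, ← add_div]
      gcongr
      nlinarith
    rcases le_total t K with htK | htK
    · refine (hb t ht htK).trans (le_trans ?_ hfin)
      have : 0 ≤ δ / β := by positivity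
      linarith
    · obtain ⟨-, d2, d3⟩ := hdiff t htK
      have e : inner ℝ b (h (u t)) - inner ℝ b (h v)
          = (inner ℝ b (h (u K)) - inner ℝ b (h v)) + inner ℝ b (h (u t) - h (u K)) := by
        rw [inner_sub_right]; ring
      have h3 := abs_inner_le_norm_right H.norm_b (h (u t) - h (u K))
      have h5 : Λ * ‖u t - u K‖ ≤ Λ * ‖u t - u K‖ * (2 * Λ) :=
        le_mul_of_one_le_right (by positivity) (by linarith)
      have h6 := hb K hK le_rfl
      rw [e]
      refine (abs_add_le _ _).trans ?_
      linarith

end IsNoisyTrajectory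

end Trajectory


/-! ### Scalar expansions behind the bias correction and the studentised statistic. -/

section Scalars

lemma abs_sub_le_of_sq_eq {C c β r x q D : ℝ} (hC : 1 ≤ C) (hCc : C ≤ c) (hr : 0 < r)
    (hr1 : r ≤ 1) (hβ : 4 * c ≤ β) (hx : |x - β| ≤ c * (1 / β + r)) (hq0 : 0 ≤ q)
    (hq2 : q ≤ 2 * C) (hD0 : 0 ≤ D) (hD : D ^ 2 = x ^ 2 + q) :
    β / 2 ≤ x ∧ x ≤ 2 * β ∧ x ≤ D ∧ D ≤ 3 * β ∧ |D - β| ≤ 3 * c * (1 / β + r) := by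
  have hc0 : 0 ≤ c := by linarith
  have hβ1 : 4 ≤ β := by linarith
  have hβ0 : 0 < β := by linarith
  have he0 : 0 < 1 / β + r := by positivity
  have he2 : 1 / β + r ≤ 2 := by
    have : 1 / β ≤ 1 := by rw [div_le_one hβ0]; linarith
    linarith
  have hce : c * (1 / β + r) ≤ β / 2 := by
    have : c * (1 / β + r) ≤ c * 2 := by gcongr
    linarith
  obtain ⟨hx1, hx2⟩ := abs_le.1 hx
  have hxlo : β / 2 ≤ x := by linarith
  have hx0 : 0 < x := by linarith
  have hxD : x ≤ D := le_of_pow_le_pow_left₀ two_ne_zero hD0 (by linarith)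
  have hDx : (D - x) * (D + x) = q := by linarith [hD]
  have hDx1 : D - x ≤ 2 * C / β := by
    rw [le_div_iff₀ hβ0]
    calc (D - x) * β ≤ (D - x) * (D + x) :=
          mul_le_mul_of_nonneg_left (by linarith) (by linarith)
      _ ≤ 2 * C := by rw [hDx]; exact hq2
  have hCβ : 2 * C / β ≤ 2 * c * (1 / β + r) := by
    calc 2 * C / β = 2 * C * (1 / β) := by ring
      _ ≤ 2 * c * (1 / β + r) := by
        gcongr
        linarith
  refine ⟨hxlo, by linarith, hxD, by linarith, abs_le.2 ⟨?_, by linarith⟩⟩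
  have : 0 ≤ c * (1 / β + r) := by positivity
  linarith

/-- Expansion of the correlation `x / √(x² + q)` after one step. -/
lemma step_expansion {C c β r x q D : ℝ} (hC : 1 ≤ C) (hCc : C ≤ c) (hr : 0 < r)
    (hr1 : r ≤ 1) (hβ : 4 * c ≤ β) (hx : |x - β| ≤ c * (1 / β + r)) (hq0 : 0 ≤ q)
    (hq2 : q ≤ 2 * C) (hq : |q - 1| ≤ 2 * C ^ 2 * r) (hD0 : 0 ≤ D) (hD : D ^ 2 = x ^ 2 + q) :
    1 - x / D ≤ 4 * C / β ^ 2 ∧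
      |1 - x / D - 1 / (2 * β ^ 2)| ≤ (4 * C ^ 2 + 21 * c) * (1 / β ^ 4 + r / β ^ 2) := by
  obtain ⟨hxlo, hxhi, hxD, hDhi, hDβ⟩ := abs_sub_le_of_sq_eq hC hCc hr hr1 hβ hx hq0 hq2 hD0 hD
  have hβ1 : 4 ≤ β := by linarith
  have hβ0 : 0 < β := by linarith
  have hx0 : 0 < x := by linarith
  have hDpos : 0 < D := by linarith
  have hDx : (D - x) * (D + x) = q := by linarith [hD]
  -- With q ≈ 1 and both x and D close to β, this exact formula has leading term 1/(2β²), the bias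
  -- corrected by the interval.
  have e1 : 1 - x / D = q / (D * (D + x)) := by
    have : 0 < D + x := by linarith
    rw [← hDx]
    field_simp
  have hden : β ^ 2 / 2 ≤ D * (D + x) := by
    calc β ^ 2 / 2 = (β / 2) * β := by ring
      _ ≤ D * (D + x) := mul_le_mul (by linarith) (by linarith) hβ0.le hDpos.le
  refine ⟨?_, ?_⟩
  · rw [e1]
    calc q / (D * (D + x)) ≤ (2 * C) / (β ^ 2 / 2) := by gcongr
      _ = _ := by field_simp; ring
  · have hden0 : 0 < D * (D + x) := lt_of_lt_of_le (by positivity) hden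
    have e2 : 1 - x / D - 1 / (2 * β ^ 2)
        = (2 * β ^ 2 * (q - 1) - ((D - β) * (D + β) + (D - β) * x + β * (x - β)))
          / (2 * β ^ 2 * (D * (D + x))) := by
      rw [e1]
      field_simp
      ring
    have hc0 : 0 ≤ c := by linarith
    have he0 : 0 < 1 / β + r := by positivity
    have a1 : |2 * β ^ 2 * (q - 1)| ≤ 2 * β ^ 2 * (2 * C ^ 2 * r) := by
      rw [abs_mul, abs_of_pos (by positivity)]
      gcongr
    have a2 : |(D - β) * (D + β)| ≤ 3 * c * (1 / β + r) * (4 * β) := by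
      rw [abs_mul, abs_of_pos (by linarith : 0 < D + β)]
      gcongr
      linarith
    have a3 : |(D - β) * x| ≤ 3 * c * (1 / β + r) * (2 * β) := by
      rw [abs_mul, abs_of_pos hx0]
      gcongr
    have a4 : |β * (x - β)| ≤ β * (c * (1 / β + r)) := by
      rw [abs_mul, abs_of_pos hβ0]
      gcongr
    have heβ : (1 / β + r) * β ≤ 1 + r * β ^ 2 := by
      have h1 : (1 / β + r) * β = 1 + r * β := by field_simp
      rw [h1]
      gcongr
      exact le_self_pow₀ (by linarith) two_ne_zero
    have a5 : c * ((1 / β + r) * β) ≤ c * (1 + r * β ^ 2) := by gcongr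
    have h1 : |2 * β ^ 2 * (q - 1) - ((D - β) * (D + β) + (D - β) * x + β * (x - β))|
        ≤ (4 * C ^ 2 + 21 * c) * (1 + r * β ^ 2) := by
      have b1 := abs_sub (2 * β ^ 2 * (q - 1)) ((D - β) * (D + β) + (D - β) * x + β * (x - β))
      have b2 := abs_add_three ((D - β) * (D + β)) ((D - β) * x) (β * (x - β))
      have b3 : 0 ≤ c * (1 + r * β ^ 2) := by positivity
      have b4 : 0 ≤ C ^ 2 := by positivity
      have b5 : 3 * c * (1 / β + r) * (4 * β) + 3 * c * (1 / β + r) * (2 * β)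
          + β * (c * (1 / β + r)) = 19 * (c * ((1 / β + r) * β)) := by ring
      have b6 : (4 * C ^ 2 + 21 * c) * (1 + r * β ^ 2)
          = 4 * C ^ 2 + 2 * β ^ 2 * (2 * C ^ 2 * r) + 21 * (c * (1 + r * β ^ 2)) := by ring
      linarith
    rw [e2, abs_div, abs_of_pos (by positivity : 0 < 2 * β ^ 2 * (D * (D + x)))]
    calc _ ≤ ((4 * C ^ 2 + 21 * c) * (1 + r * β ^ 2)) / (2 * β ^ 2 * (β ^ 2 / 2)) := by gcongr
      _ = _ := by field_simp

lemma abs_signal_sub_le {C β r α p : ℝ} (hC : 1 ≤ C) (hβ : 0 < β) (hr : 0 < r) (h0 : 0 ≤ α)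
    (h1 : α ≤ 1) (hα : 1 - α ^ 2 ≤ C / β ^ 2) (hp : |p| ≤ C * r) (m : ℕ) :
    |β * α ^ m + p - β| ≤ (m + 1) * C * (1 / β + r) := by
  have e : β * α ^ m + p - β = p - β * (1 - α ^ m) := by ring
  have h2 : 0 ≤ 1 - α ^ m := sub_nonneg.2 (pow_le_one₀ h0 h1)
  have h3 : β * (1 - α ^ m) ≤ m * C * (1 / β) := by
    have h4 : 1 - α ^ m ≤ m * (C / β ^ 2) := by
      refine (one_sub_pow_le h0 m).trans ?_
      gcongr
      refine le_trans ?_ hα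
      nlinarith
    calc β * (1 - α ^ m) ≤ β * (m * (C / β ^ 2)) := by gcongr
      _ = _ := by field_simp
  rw [e]
  refine (abs_sub _ _).trans ?_
  rw [abs_of_nonneg (by positivity : 0 ≤ β * (1 - α ^ m))]
  have h5 : 0 ≤ m * C * r := by positivity
  have h6 : 0 ≤ C * (1 / β) := by positivity
  calc |p| + β * (1 - α ^ m) ≤ C * r + m * C * (1 / β) := add_le_add hp h3
    _ ≤ _ := by linarith

/-- Applied with s = ‖h w‖² and p = ⟨v, h w⟩: removing the component along `v` changes the noise
norm only to second order. -/
lemma abs_sub_sq_sub_one_le {C r s p : ℝ} (hC : 1 ≤ C) (hr : 0 < r) (hr1 : r ≤ 1)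
    (hs : |s - 1| ≤ C * r) (hp : |p| ≤ C * r) : |s - p ^ 2 - 1| ≤ 2 * C ^ 2 * r := by
  have h1 : s - p ^ 2 - 1 = (s - 1) - p ^ 2 := by ring
  have h2 : |p ^ 2| ≤ C ^ 2 * r := by
    rw [abs_of_nonneg (sq_nonneg _), ← sq_abs p]
    calc |p| ^ 2 ≤ (C * r) ^ 2 := by gcongr
      _ = C ^ 2 * r * r := by ring
      _ ≤ C ^ 2 * r := mul_le_of_le_one_right (by positivity) hr1
  rw [h1]
  refine (abs_sub _ _).trans ?_
  have : C * r ≤ C ^ 2 * r := by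
    gcongr
    exact le_self_pow₀ hC two_ne_zero
  linarith

/-- Comparison of the studentized statistic with its Gaussian limit. -/
lemma statistic_sub_le {C P F β r g D A α' B G : ℝ} (hC : 1 ≤ C) (hCP : 2 * C ≤ P)
    (hF : F = 100 * P ^ 2) (hr : 0 < r) (hr1 : r ≤ 1) (hβ : 200 * P ≤ β) (hglo : β / 2 ≤ g)
    (hghi : g ≤ 2 * β) (hD : β / 2 ≤ D) (hA : |A| ≤ 1)
    (hinv : |α' - 1 + 1 / (2 * g ^ 2)| ≤ F * (1 / β ^ 4 + r / β ^ 2)) (hG : |G| ≤ C * r)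
    (hBG : |B - G| ≤ C * r / β) (hgD : |g - D| ≤ 13 * P * (1 / β + r)) :
    |g / r * (A * α' + B / D - A * (1 - 1 / (2 * g ^ 2))) - G / r|
      ≤ 100 * F * (|A| / (r * β ^ 3) + 1 / β) := by
  have hP2 : 2 ≤ P := by linarith
  have hβ0 : 0 < β := by linarith
  have hg0 : 0 < g := by linarith
  have hD0 : 0 < D := by linarith
  have hPP : 2 * P ≤ P ^ 2 := by nlinarith
  have hFP : 200 * P ≤ F := by rw [hF]; linarith
  have hF0 : 0 ≤ F := by linarith
  -- Three error sources: the bias formula at the estimated strength, replacement of `B` by `G`, and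
  -- replacement of `D` by `g`.
  have h2 : g / r * (A * α' + B / D - A * (1 - 1 / (2 * g ^ 2))) - G / r
      = g / r * (A * (α' - 1 + 1 / (2 * g ^ 2)))
        + (g / D * ((B - G) / r) + G / r * ((g - D) / D)) := by
    field_simp
    ring
  have h3 : |g / r * (A * (α' - 1 + 1 / (2 * g ^ 2)))|
      ≤ 2 * F * (|A| / (r * β ^ 3) + 1 / β) := by
    rw [abs_mul, abs_mul, abs_of_pos (by positivity : 0 < g / r)]
    calc _ ≤ (2 * β) / r * (|A| * (F * (1 / β ^ 4 + r / β ^ 2))) := by gcongr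
      _ = 2 * F * (|A| / (r * β ^ 3) + |A| / β) := by field_simp
      _ ≤ _ := by gcongr
  have h4 : |g / D * ((B - G) / r)| ≤ F * (1 / β) := by
    rw [abs_mul, abs_div (B - G), abs_of_pos hr, abs_of_pos (by positivity : 0 < g / D)]
    calc g / D * (|B - G| / r) ≤ (2 * β) / (β / 2) * ((C * r / β) / r) := by gcongr
      _ = 4 * C * (1 / β) := by field_simp; ring
      _ ≤ F * (1 / β) := by
          gcongr
          linarith
  have h5 : |G / r * ((g - D) / D)| ≤ F * (1 / β) := by
    rw [abs_mul, abs_div, abs_div, abs_of_pos hr, abs_of_pos hD0]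
    have he2 : 1 / β + r ≤ 2 := by
      have : 1 / β ≤ 1 := by rw [div_le_one hβ0]; linarith
      linarith
    have h6 : |g - D| ≤ 13 * P * 2 := hgD.trans (by gcongr)
    calc |G| / r * (|g - D| / D) ≤ (C * r) / r * ((13 * P * 2) / (β / 2)) := by gcongr
      _ = 26 * (2 * C) * P * (1 / β) := by field_simp; ring
      _ ≤ 26 * P * P * (1 / β) := by gcongr
      _ = 26 * P ^ 2 * (1 / β) := by ring
      _ ≤ F * (1 / β) := by
          rw [hF]
          gcongr
          norm_num
  have h7 : 0 ≤ F * (|A| / (r * β ^ 3)) := by positivity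
  have h8 : 0 ≤ F * (1 / β) := by positivity
  rw [h2]
  have h9 := abs_add_le (g / r * (A * (α' - 1 + 1 / (2 * g ^ 2))))
    (g / D * ((B - G) / r) + G / r * ((g - D) / D))
  have h10 := abs_add_le (g / D * ((B - G) / r)) (G / r * ((g - D) / D))
  linarith

lemma abs_inv_two_sq_sub_le {c β r g : ℝ} (hc : 1 ≤ c) (hr : 0 < r) (hr1 : r ≤ 1)
    (hβ : 4 * c ≤ β) (hg : |g - β| ≤ c * (1 / β + r)) :
    β / 2 ≤ g ∧ g ≤ 2 * β ∧ |1 / (2 * g ^ 2) - 1 / (2 * β ^ 2)|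
      ≤ 6 * c * (1 / β ^ 4 + r / β ^ 2) := by
  have hβ1 : 4 ≤ β := by linarith
  have hβ0 : 0 < β := by linarith
  set e := 1 / β + r with he
  have he0 : 0 < e := by positivity
  have he2 : e ≤ 2 := by
    have : 1 / β ≤ 1 := by rw [div_le_one hβ0]; linarith
    linarith
  have hce : c * e ≤ β / 2 := by
    have : c * e ≤ c * 2 := by gcongr
    linarith
  have hlo : β / 2 ≤ g := by linarith [(abs_le.1 hg).1]
  have hhi : g ≤ 2 * β := by linarith [(abs_le.1 hg).2]
  have hg0 : 0 < g := by linarith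
  refine ⟨hlo, hhi, ?_⟩
  have e1 : 1 / (2 * g ^ 2) - 1 / (2 * β ^ 2) = -((g - β) * (g + β)) / (2 * β ^ 2 * g ^ 2) := by
    field_simp
    ring
  rw [e1, abs_div, abs_neg, abs_mul, abs_of_pos (by positivity : 0 < 2 * β ^ 2 * g ^ 2),
    abs_of_pos (by positivity : 0 < g + β)]
  calc _ ≤ (c * e * (3 * β)) / (2 * β ^ 2 * (β / 2) ^ 2) := by
        gcongr
        linarith
    _ = 6 * c * (1 / β ^ 4 + r / β ^ 3) := by
        rw [he]; field_simp; ring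
    _ ≤ _ := by
        gcongr
        · linarith
        · norm_num

end Scalars

/-! ### Estimators computed from two consecutive late iterates. -/

section Late

variable {E : Type*} [NormedAddCommGroup E] [InnerProductSpace ℝ E]

variable {β : ℝ} {m : ℕ} {v : E} {h : E → E} {w : E} {C r : ℝ}

/-- Moves the tightness level `L` from the error scale into the constant, leaving the scale 1/√n. -/
lemma IsLateIterate.of_mul {b : E} {L : ℝ} (H : IsLateIterate β m v b h C (L * r) w) (hC : 0 ≤ C)
    (hL : 1 ≤ L) : IsLateIterate β m v b h (C * L) r w where
  norm_eq := H.norm_eq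
  half_le := H.half_le
  one_sub_sq_le := H.one_sub_sq_le.trans (by
    gcongr
    exact le_mul_of_one_le_right hC hL)
  inner_v := by simpa only [mul_assoc] using H.inner_v
  norm_sq := by simpa only [mul_assoc] using H.norm_sq
  inner_b := by simpa only [mul_assoc] using H.inner_b

/-- Cauchy–Schwarz on the whole product would only give O(1). Splitting `w'` into its part along
`v`, where the noise is O(r), and a remainder of size O(1/β) recovers smallness. -/
lemma abs_inner_noise_le (hC : 1 ≤ C) (hv : ‖v‖ = 1) (hr : 0 < r) (hβ : 0 < β) {w' : E}
    (hw' : w' = ‖signalStep β m v h w‖⁻¹ • signalStep β m v h w)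
    (hx0 : 0 < β * inner ℝ v w ^ m + inner ℝ v (h w)) (hD : β / 2 ≤ ‖signalStep β m v h w‖)
    (hhw : ‖h w‖ ^ 2 ≤ 2 * C) (hhw' : ‖h w'‖ ^ 2 ≤ 2 * C) (hs : |inner ℝ v (h w')| ≤ C * r) :
    |inner ℝ w' (h w')| ≤ C * r + 4 * C * (1 / β) := by
  have hxD := le_norm_signalStep (β := β) (m := m) (h := h) (w := w) hv
  set p := inner ℝ v (h w) with hp
  set x := β * inner ℝ v w ^ m + p with hx
  set D := ‖signalStep β m v h w‖ with hDdef
  have hD0 : 0 < D := by linarith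
  have h2 : inner ℝ w' (h w') = D⁻¹ * (x * inner ℝ v (h w') + inner ℝ (h w - p • v) (h w')) := by
    have e : signalStep β m v h w = x • v + (h w - p • v) := by
      rw [signalStep, hx]
      module
    have e2 : ∀ y, inner ℝ w' y = D⁻¹ * inner ℝ (signalStep β m v h w) y := by
      intro y
      rw [hw', inner_smul_left]
      simp [hDdef]
    rw [e2, e, inner_add_left, inner_smul_left]
    simp
  have h3 : |x * inner ℝ v (h w')| ≤ D * (C * r) := by
    rw [abs_mul, abs_of_pos hx0]
    gcongr
  have h4 : |inner ℝ (h w - p • v) (h w')| ≤ 2 * C := by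
    have h5 : ‖h w - p • v‖ ^ 2 ≤ 2 * C := by
      have : ‖h w - p • v‖ ^ 2 = ‖h w‖ ^ 2 - p ^ 2 := by
        rw [norm_sub_sq_real, inner_smul_right, norm_smul, hv, real_inner_comm, ← hp]
        simp only [Real.norm_eq_abs, mul_one, sq_abs]
        ring
      rw [this]
      linarith [sq_nonneg p]
    refine (abs_real_inner_le_norm _ _).trans ?_
    linarith [two_mul_le_add_sq ‖h w - p • v‖ ‖h w'‖]
  rw [h2, abs_mul, abs_of_pos (by positivity : 0 < D⁻¹)]
  calc _ ≤ D⁻¹ * (D * (C * r) + 2 * C) := by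
        gcongr
        exact (abs_add_le _ _).trans (add_le_add h3 h4)
    _ = C * r + 2 * C / D := by field_simp
    _ ≤ C * r + 2 * C / (β / 2) := by gcongr
    _ = _ := by field_simp; ring

lemma abs_betaHat_sub_le (hC : 1 ≤ C) (hβ : 0 < β) {w' : E} (h0 : 0 ≤ inner ℝ v w')
    (h1 : inner ℝ v w' ≤ 1) (hα' : 1 - inner ℝ v w' ≤ 4 * C / β ^ 2) (hr : 0 < r)
    (hw' : |inner ℝ w' (h w')| ≤ C * r + 4 * C * (1 / β)) :
    |inner ℝ w' (signalStep β m v h w') - β| ≤ 10 * ((m + 2) * C) * (1 / β + r) := by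
  set α' := inner ℝ v w'
  have e : inner ℝ w' (signalStep β m v h w') = β * α' ^ (m + 1) + inner ℝ w' (h w') := by
    rw [signalStep, inner_add_right, inner_smul_right, real_inner_comm v w', pow_succ]
    ring
  have h7 : β * (1 - α' ^ (m + 1)) ≤ 4 * ((m + 1) * C) * (1 / β) := by
    have h8 := one_sub_pow_le h0 (m + 1)
    push_cast at h8
    calc β * (1 - α' ^ (m + 1)) ≤ β * ((m + 1) * (4 * C / β ^ 2)) := by
          gcongr
          exact h8.trans (by gcongr)
      _ = _ := by field_simp
  have h9 : 0 ≤ β * (1 - α' ^ (m + 1)) :=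
    mul_nonneg hβ.le (sub_nonneg.2 (pow_le_one₀ h0 h1))
  have h10 : β * α' ^ (m + 1) + inner ℝ w' (h w') - β
      = inner ℝ w' (h w') - β * (1 - α' ^ (m + 1)) := by ring
  rw [e, h10]
  refine (abs_sub _ _).trans ?_
  rw [abs_of_nonneg h9]
  have k1 : 0 ≤ m * C * (1 / β) := by positivity
  have k2 : 0 ≤ C * (1 / β) := by positivity
  have k3 : 0 ≤ m * C * r := by positivity
  have k4 : 0 ≤ C * r := by positivity
  linarith

/-- Constant in `late_estimate`. -/
def estimateConst (m : ℕ) (C : ℝ) : ℝ := 100 * ((m + 2) * C) ^ 2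

/-- The estimators computed from two consecutive late iterates `w` and `w'`. -/
lemma late_estimate (hC : 1 ≤ C) (hv : ‖v‖ = 1) {a : E} (ha : ‖a‖ = 1) (hr : 0 < r) (hr1 : r ≤ 1)
    (hβ : estimateConst m C ≤ β) {w' : E}
    (hw' : w' = ‖signalStep β m v h w‖⁻¹ • signalStep β m v h w)
    (hb : |inner ℝ (a - inner ℝ a v • v) (h v)| ≤ C * r)
    (H : IsLateIterate β m v (a - inner ℝ a v • v) h C r w)
    (H' : IsLateIterate β m v (a - inner ℝ a v • v) h C r w') :
    β / 2 ≤ inner ℝ w' (signalStep β m v h w') ∧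
    |inner ℝ a w' - inner ℝ a v| ≤ 10 * C / β ∧
    |inner ℝ w' (signalStep β m v h w') / r *
        (inner ℝ a w' - inner ℝ a v * (1 - 1 / (2 * inner ℝ w' (signalStep β m v h w') ^ 2)))
      - inner ℝ (a - inner ℝ a v • v) (h v) / r|
      ≤ 100 * estimateConst m C * (|inner ℝ a v| / (r * β ^ 3) + 1 / β) := by
  set b := a - inner ℝ a v • v with hbdef
  set P := (m + 2) * C with hP
  have hm0 : 0 ≤ m * C := by positivity
  have hPm : P = m * C + 2 * C := by rw [hP]; ring
  have hP2 : 2 ≤ P := by linarith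
  have hPP : 2 * P ≤ P ^ 2 := by nlinarith only [hP2]
  have hβP : 200 * P ≤ β := by
    rw [estimateConst, ← hP] at hβ
    linarith
  have hβ0 : 0 < β := by linarith
  have hβ1 : 1 ≤ β := by linarith
  have hα1 : inner ℝ v w ≤ 1 := inner_le_one_of_unit hv H.norm_eq
  have hα0 : 0 ≤ inner ℝ v w := by linarith [H.half_le]
  have hα'1 : inner ℝ v w' ≤ 1 := inner_le_one_of_unit hv H'.norm_eq
  have hα'0 : 0 ≤ inner ℝ v w' := by linarith [H'.half_le]
  have hCr : C * r ≤ C := mul_le_of_le_one_right (by linarith) hr1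
  have hhw : ‖h w‖ ^ 2 ≤ 2 * C := by linarith [(abs_le.1 H.norm_sq).2]
  have hhw' : ‖h w'‖ ^ 2 ≤ 2 * C := by linarith [(abs_le.1 H'.norm_sq).2]
  have hxβ := abs_signal_sub_le hC hβ0 hr hα0 hα1 H.one_sub_sq_le H.inner_v m
  have hq1 := abs_sub_sq_sub_one_le hC hr hr1 H.norm_sq H.inner_v
  have hpsq : inner ℝ v (h w) ^ 2 ≤ ‖h w‖ ^ 2 := by
    rw [← sq_abs (inner ℝ v (h w))]
    gcongr
    exact abs_inner_le_norm_right hv.le _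
  have hq2 : ‖h w‖ ^ 2 - inner ℝ v (h w) ^ 2 ≤ 2 * C := by
    linarith [sq_nonneg (inner ℝ v (h w))]
  have hsq := norm_signalStep_sq (β := β) (m := m) (h := h) (w := w) hv
  obtain ⟨hxlo, hxhi, hxD, hDhi, hDβ⟩ := abs_sub_le_of_sq_eq hC (by linarith) hr hr1
    (by linarith) hxβ (sub_nonneg.2 hpsq) hq2 (norm_nonneg _) hsq
  obtain ⟨hs1, hs2⟩ := step_expansion hC (by linarith) hr hr1
    (by linarith) hxβ (sub_nonneg.2 hpsq) hq2 hq1 (norm_nonneg _) hsq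
  have hα' := inner_normalize_signalStep (β := β) (m := m) (h := h) (w := w) hv
  rw [← hw'] at hα'
  rw [← hα'] at hs1 hs2
  have hD : β / 2 ≤ ‖signalStep β m v h w‖ := by linarith
  have hD0 : 0 < ‖signalStep β m v h w‖ := by linarith
  have hgβ := abs_betaHat_sub_le (m := m) hC hβ0 hα'0 hα'1 hs1 hr
    (abs_inner_noise_le hC hv hr hβ0 hw' (by linarith) hD hhw hhw' H'.inner_v)
  obtain ⟨hglo, hghi, hginv⟩ := abs_inv_two_sq_sub_le (by linarith) hr hr1 (by linarith) hgβ
  -- Split a = ⟨a,v⟩v + b with b orthogonal to `v`: the signal part of the step is invisible to b,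
  -- so only noise enters that coordinate.
  have haw : inner ℝ a w' = inner ℝ a v * inner ℝ v w'
      + inner ℝ b (h w) / ‖signalStep β m v h w‖ := by
    have h1 : a = inner ℝ a v • v + b := by rw [hbdef]; module
    have h2 : inner ℝ b v = 0 := by
      rw [hbdef, inner_sub_left, inner_smul_left, real_inner_self_eq_norm_sq, hv]
      simp
    have h3 : inner ℝ b w' = inner ℝ b (h w) / ‖signalStep β m v h w‖ := by
      have h4 : inner ℝ b (signalStep β m v h w) = inner ℝ b (h w) := by
        rw [signalStep, inner_add_right, inner_smul_right, h2, mul_zero, zero_add]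
      rw [hw', inner_smul_right, h4]
      ring
    conv_lhs => rw [h1]
    rw [inner_add_left, inner_smul_left, h3]
    simp
  have hA1 : |inner ℝ a v| ≤ 1 := by
    have := abs_real_inner_le_norm a v
    rwa [ha, hv, one_mul] at this
  have hBr : |inner ℝ b (h w)| ≤ 2 * C := by
    have e : inner ℝ b (h w) = (inner ℝ b (h w) - inner ℝ b (h v)) + inner ℝ b (h v) := by ring
    rw [e]
    refine (abs_add_le _ _).trans ?_
    have h1 := H.inner_b
    have h2 : C * r / β ≤ C * r := div_le_self (by positivity) hβ1
    linarith
  refine ⟨hglo, ?_, ?_⟩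
  · have h1 : inner ℝ a w' - inner ℝ a v = inner ℝ b (h w) / ‖signalStep β m v h w‖
        - inner ℝ a v * (1 - inner ℝ v w') := by rw [haw]; ring
    have h2 : |inner ℝ b (h w) / ‖signalStep β m v h w‖| ≤ 4 * C / β := by
      rw [abs_div, abs_of_pos hD0]
      calc _ ≤ (2 * C) / (β / 2) := by gcongr
        _ = _ := by field_simp; ring
    have h3 : |inner ℝ a v * (1 - inner ℝ v w')| ≤ 4 * C / β := by
      rw [abs_mul, abs_of_nonneg (sub_nonneg.2 hα'1)]
      calc _ ≤ 1 * (4 * C / β ^ 2) := mul_le_mul hA1 hs1 (sub_nonneg.2 hα'1) zero_le_one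
        _ ≤ 4 * C / β := by
          rw [one_mul]
          gcongr
          exact le_self_pow₀ hβ1 two_ne_zero
    rw [h1]
    refine (abs_sub _ _).trans ?_
    have e : 10 * C / β = 4 * C / β + 4 * C / β + 2 * C / β := by ring
    have : 0 ≤ 2 * C / β := by positivity
    linarith
  · rw [haw]
    refine statistic_sub_le hC (by linarith) rfl hr hr1 hβP hglo hghi hD hA1 ?_ hb H.inner_b ?_
    · have e1 : ∀ g : ℝ, inner ℝ v w' - 1 + 1 / (2 * g ^ 2)
          = (1 / (2 * g ^ 2) - 1 / (2 * β ^ 2)) - (1 - inner ℝ v w' - 1 / (2 * β ^ 2)) :=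
        fun g => by ring
      rw [e1]
      refine (abs_sub _ _).trans ((add_le_add hginv hs2).trans ?_)
      rw [← add_mul]
      gcongr
      rw [estimateConst, ← hP]
      have h5 : 4 * C ^ 2 ≤ P ^ 2 := by
        calc 4 * C ^ 2 = (2 * C) ^ 2 := by ring
          _ ≤ P ^ 2 := by gcongr; linarith
      linarith
    · have e : ∀ g : ℝ, g - ‖signalStep β m v h w‖
          = (g - β) - (‖signalStep β m v h w‖ - β) := fun g => by ring
      rw [e]
      refine (abs_sub _ _).trans ((add_le_add hgβ hDβ).trans ?_)
      rw [← add_mul]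
      gcongr
      linarith

end Late


/-! ### From concentration of the noise to the abstract trajectory hypotheses. -/

section GoodEvent

variable {m n : ℕ} {β : ℝ} {v u b : EuclideanSpace ℝ (Fin n)} {Z : Tensor (m + 1) n}

/-- The noise part of one step of power iteration. -/
noncomputable def noiseMap (Z : Tensor (m + 1) n) (w : EuclideanSpace ℝ (Fin n)) :
    EuclideanSpace ℝ (Fin n) :=
  op (flat Z) (powVec m w)

lemma applyPow_spiked_eq_signalStep (β : ℝ) (v : EuclideanSpace ℝ (Fin n)) (Z : Tensor (m + 1) n)
    (w : EuclideanSpace ℝ (Fin n)) :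
    applyPow (spiked β v Z) w = signalStep β m v (noiseMap Z) w :=
  applyPow_spiked β v Z w

lemma powerIter_succ (X : Tensor m n) (u : EuclideanSpace ℝ (Fin n)) (t : ℕ) :
    powerIter X u (t + 1) = ‖applyPow X (powerIter X u t)‖⁻¹ • applyPow X (powerIter X u t) := rfl

lemma IsConcentrated.isNoisyTrajectory {K : ℕ} {δ B : ℝ}
    (hc : IsConcentrated (explored (probe m β v u) (flat Z)) (flat Z) (K + 1) δ v b)
    (hB : ‖tensorForm Z‖ ≤ B) (hv : ‖v‖ = 1) (hu : ‖u‖ = 1) (hb : ‖b‖ ≤ 1) :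
    IsNoisyTrajectory β m v b (noiseMap Z) ((m + 1) * B) ((K + 2) ^ 2 * δ) K
      (powerIter (spiked β v Z) u) := by
  have hδ := hc.nonneg
  have hB0 : 0 ≤ B := (norm_nonneg _).trans hB
  have hK : (((K + 1 : ℕ) : ℝ) + 1) = K + 2 := by push_cast; ring
  have hKK : ((K : ℝ) + 2) * δ ≤ (K + 2) ^ 2 * δ := by
    gcongr
    exact le_self_pow₀ (by linarith [(Nat.cast_nonneg K : (0 : ℝ) ≤ K)]) two_ne_zero
  have hδK : δ ≤ (K + 2) ^ 2 * δ := by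
    refine le_mul_of_one_le_left hδ (one_le_pow₀ ?_)
    linarith [(Nat.cast_nonneg K : (0 : ℝ) ≤ K)]
  have hq := isOrthonormalOrZero_explored (f := probe m β v u) (flat Z)
  have h0 := explored_probe_zero (m := m) β u hv (flat Z)
  -- The signal occupies index 0, so the t-th iterate lies in the span of the first t + 2 explored
  -- vectors; this is why concentration is assumed up to K + 1.
  have hw : ∀ t, partialProj (explored (probe m β v u) (flat Z)) (t + 2)
      (powVec m (powerIter (spiked β v Z) u t)) = powVec m (powerIter (spiked β v Z) u t) := by
    intro t
    rw [powerIter_spiked]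
    exact partialProj_gramSchmidtNormed (fun i => probe m β v u i (flat Z)) (Nat.lt_succ_self (t + 1))
  have hw1 : ∀ t, ‖powerIter (spiked β v Z) u t‖ = 1 →
      ‖powVec m (powerIter (spiked β v Z) u t)‖ = 1 := fun t ht => by
    rw [norm_powVec, ht, one_pow]
  refine ⟨hv, hb, hu, fun t => ?_, fun w h1 => ?_, fun w w' h1 h1' => ?_, fun t ht h1 => ?_,
    fun t ht h1 => ?_, fun t ht h1 => ?_, ?_⟩
  · rw [powerIter_succ, applyPow_spiked_eq_signalStep]
  · refine (norm_op_powVec_le Z h1).trans (hB.trans (le_mul_of_one_le_left hB0 ?_))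
    linarith [(Nat.cast_nonneg m : (0 : ℝ) ≤ m)]
  · refine (norm_op_powVec_sub_le Z h1 h1').trans ?_
    gcongr
  · have := hc.abs_inner_op_le hq (by omega) (hw t) (hw1 t h1)
    rw [hK] at this
    exact this.trans hKK
  · have := hc.abs_norm_op_sq_sub_one_le hq (by omega) (hw t) (hw1 t h1)
    rwa [hK] at this
  · have := hc.symm.abs_inner_op_sub_le hq (by omega) (hw t) (hw1 t h1) (by omega)
    rw [hK, h0, inner_powVec] at this
    refine this.trans ?_
    gcongr
  · have := hc.right 0 (Nat.zero_le _)
    rw [h0] at this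
    exact this.trans hδK

/-- Bookkeeping with y = n^{ε/4} and s = √n: the signal has strength at least y⁴ and the noise map
is of order y, so the contraction factor is at most 1/y². The time t₀ brings the correlation from
c/√n to constant order, and `N` further contractions gain a factor 1/√n. -/
lemma IsNoisyTrajectory.isLateIterate_of_le {E : Type*} [NormedAddCommGroup E]
    [InnerProductSpace ℝ E] {v b : E} {h : E → E} {u : ℕ → E} {t₀ N : ℕ} {c c' y s L Q : ℝ}
    (H : IsNoisyTrajectory β m v b h ((m + 1) * (2 * y)) (Q * (L / s)) (t₀ + 4 + N) u)
    (hm : 1 ≤ m) (hβ : 0 < β) (hc : 0 < c) (hL : 1 ≤ L) (hQ : 1 ≤ Q) (hs : Q * L ≤ s)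
    (hc' : 0 < c') (hc'1 : c' ≤ 1 / 2) (hc'c : c' ≤ c / 4 ^ t₀)
    (hu : c / s ≤ inner ℝ v (u 0)) (hρ : y ^ 4 ≤ β * inner ℝ v (u 0) ^ (m - 1))
    (hyt : s ≤ (y ^ 4) ^ t₀) (hyN : s ≤ y ^ (2 * N)) (hy4 : 4 ≤ y) (hyc : 4 / c' ^ m ≤ y)
    (hyQ : 2 * (Q * L) / c ≤ y) (hym : 2 ^ (m + 1) * ((m + 1) * 2) ≤ y)
    (hyS : 2 * (stepConst m * ((m + 1) * 2)) ≤ y)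
    (hyD : 32 * (m + 1) ^ 2 * (stepConst m * ((m + 1) * 2)) ≤ y) {t : ℕ} (ht : t₀ + 2 ≤ t) :
    IsLateIterate β m v b h (lateConst m) (Q * (L / s)) (u t) := by
  have hy0 : 0 < y := by linarith
  have hs0 : 0 < s := by nlinarith
  have hm0 : (0 : ℝ) ≤ m := Nat.cast_nonneg m
  have hu0 : 0 < inner ℝ v (u 0) := lt_of_lt_of_le (by positivity) hu
  have hS := stepConst_pos m
  have hQs : Q * (L / s) = Q * L / s := by ring
  have hδ1 : Q * (L / s) ≤ 1 := by rw [hQs, div_le_one hs0]; exact hs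
  have hyy : y ≤ y ^ 4 := le_self_pow₀ (by linarith) (by norm_num)
  have hyy2 : y * y ≤ y ^ 4 := by
    calc y * y = y ^ 2 := by ring
      _ ≤ y ^ 4 := pow_le_pow_right₀ (by linarith) (by norm_num)
  have hym' : (2 : ℝ) ^ (m + 1) ≤ y := le_trans (le_mul_of_one_le_right (by positivity) (by linarith)) hym
  have hα01 : inner ℝ v (u 0) ≤ 1 := inner_le_one_of_unit H.norm_v H.norm_zero
  have hyβ : y ^ 4 ≤ β := hρ.trans (mul_le_of_le_one_right hβ.le (pow_le_one₀ hu0.le hα01))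
  have hδ2 : 2 * (Q * (L / s)) ≤ y ^ 4 * inner ℝ v (u 0) := by
    calc 2 * (Q * (L / s)) = 2 * (Q * L) / c * (c / s) := by field_simp
      _ ≤ y ^ 4 * inner ℝ v (u 0) := by
        gcongr
        exact hyQ.trans hyy
  obtain ⟨hn0, hα⟩ := H.growth hm hβ hu0 (hy4.trans hyy) (hym'.trans hyy) hρ hδ1 hδ2 t₀ (by omega)
  have hα' : c' ≤ inner ℝ v (u t₀) := by
    refine le_trans (le_min hc'1 (hc'c.trans ?_)) hα
    calc c / 4 ^ t₀ = c / s * (s / 4 ^ t₀) := by field_simp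
      _ ≤ inner ℝ v (u 0) * (y ^ 4 / 4) ^ t₀ := by
        rw [div_pow]
        gcongr
  have hβc : 4 ≤ β * c' ^ m := by
    rw [div_le_iff₀ (by positivity)] at hyc
    refine hyc.trans ?_
    gcongr
    exact hyy.trans hyβ
  obtain ⟨hn1, hα1⟩ := H.half_le_succ_of_le (by omega) hn0 hβ hc' hα' hδ1 hβc
  set D := stepConst m * ((m + 1) * 2) with hD
  have hD0 : 0 < D := by positivity
  have hκ : stepConst m * ((m + 1) * (2 * y)) / β ≤ 1 / y ^ 2 := by
    rw [div_le_div_iff₀ hβ (by positivity)]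
    calc stepConst m * ((m + 1) * (2 * y)) * y ^ 2 = D * y ^ 3 := by rw [hD]; ring
      _ ≤ y * y ^ 3 := by gcongr; linarith
      _ = y ^ 4 := by ring
      _ ≤ 1 * β := by linarith
  have hκ0 : 0 ≤ stepConst m * ((m + 1) * (2 * y)) / β := by positivity
  have hy2 : 1 / y ^ 2 ≤ 1 / 2 := by
    gcongr
    nlinarith
  refine H.isLateIterate (t₁ := t₀ + 1) hn1 hα1 (by linarith) ?_ hδ1 ?_ (hκ.trans hy2) (by omega) ?_
    (by omega)
  · nlinarith only [hm0, hy4]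
  · calc 2 ^ (m + 1) * ((m + 1) * (2 * y)) = 2 ^ (m + 1) * ((m + 1) * 2) * y := by ring
      _ ≤ y * y := by gcongr
      _ ≤ β := hyy2.trans hyβ
  -- Of the N + 3 contractions since time t₀ + 1, one cancels β, two absorb the powers of y coming
  -- from Λ, and N leave y^{-2N} ≤ 1/s.
  · have hN : t₀ + 4 + N - (t₀ + 1) = N + 2 + 1 := by omega
    rw [hN, pow_succ, le_div_iff₀ hβ]
    calc 8 * ((m + 1) * (2 * y)) ^ 2 * ((stepConst m * ((m + 1) * (2 * y)) / β) ^ (N + 2)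
          * (stepConst m * ((m + 1) * (2 * y)) / β)) * β
        = 32 * (m + 1) ^ 2 * D * y ^ 3 * (stepConst m * ((m + 1) * (2 * y)) / β) ^ (N + 2) := by
          rw [hD]; field_simp; ring
      _ ≤ y * y ^ 3 * (1 / y ^ 2) ^ (N + 2) := by gcongr
      _ = 1 / y ^ (2 * N) := by
        have e : y ^ (2 * (N + 2)) = y ^ (2 * N) * (y * y ^ 3) := by ring
        rw [one_div_pow, ← pow_mul, e]
        field_simp
      _ ≤ 1 / s := by gcongr
      _ ≤ Q * L / s := by
        gcongr
        exact one_le_mul_of_one_le_of_one_le hQ hL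
      _ = Q * (L / s) := hQs.symm

end GoodEvent


/-! ### The good event for the noise, with its fixed horizon. -/

section GoodNoise

variable {m n : ℕ} {β : ℝ} {v u b : EuclideanSpace ℝ (Fin n)} {Z : Tensor (m + 1) n}

/-- Number of steps after which the iterates have macroscopic correlation with the signal. -/
noncomputable def warmup (ε : ℝ) : ℕ := ⌈1 / (2 * ε)⌉₊

/-- Number of steps for which the trajectory is tracked by the exploration. -/
noncomputable def horizon (ε : ℝ) : ℕ := warmup ε + 4 + ⌈1 / ε⌉₊

/-- The noise is regular along the trajectory, at level `L`. -/
structure IsGoodNoise (ε L β : ℝ) (v u b : EuclideanSpace ℝ (Fin n)) (Z : Tensor (m + 1) n) :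
    Prop where
  concentrated : IsConcentrated (explored (probe m β v u) (flat Z)) (flat Z) (horizon ε + 1)
    (L / √(n : ℝ)) v b
  norm_le : ‖tensorForm Z‖ ≤ 2 * (n : ℝ) ^ (ε / 4)

/-- Constant governing the late iterates. -/
noncomputable def goodConst (m : ℕ) (ε L : ℝ) : ℝ := lateConst m * ((horizon ε + 2) ^ 2 * L)

lemma one_le_goodConst (m : ℕ) (ε : ℝ) {L : ℝ} (hL : 1 ≤ L) : 1 ≤ goodConst m ε L := by
  have h1 : 1 ≤ lateConst m := by
    have : (0 : ℝ) ≤ 3 * (m + 1) * (12 * 4 ^ m) := by positivity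
    rw [lateConst]
    linarith
  have h2 : (1 : ℝ) ≤ (horizon ε + 2) ^ 2 :=
    one_le_pow₀ (by linarith [(Nat.cast_nonneg (horizon ε) : (0 : ℝ) ≤ horizon ε)])
  exact one_le_mul_of_one_le_of_one_le h1 (one_le_mul_of_one_le_of_one_le h2 hL)

lemma tendsto_natCast_rpow_atTop {ε : ℝ} (hε : 0 < ε) :
    Tendsto (fun n : ℕ => (n : ℝ) ^ ε) atTop atTop :=
  (tendsto_rpow_atTop hε).comp tendsto_natCast_atTop_atTop

lemma tendsto_sqrt_natCast_atTop : Tendsto (fun n : ℕ => √(n : ℝ)) atTop atTop :=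
  Real.tendsto_sqrt_atTop.comp tendsto_natCast_atTop_atTop

/-- All thresholds on n depend only on `m`, ε, c, `L`, so the conclusion is uniform in the noise
tensor and in the time, which may be arbitrarily large. -/
lemma eventually_isLateIterate (hm : 1 ≤ m) {ε c L : ℝ} (hε : 0 < ε) (hc : 0 < c) (hL : 1 ≤ L) :
    ∀ᶠ n : ℕ in atTop, ∀ (β : ℝ) (v u b : EuclideanSpace ℝ (Fin n)) (Z : Tensor (m + 1) n),
      0 < β → ‖v‖ = 1 → ‖u‖ = 1 → ‖b‖ ≤ 1 → c / √(n : ℝ) ≤ inner ℝ v u →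
      (n : ℝ) ^ ε ≤ β * inner ℝ v u ^ (m - 1) → IsGoodNoise ε L β v u b Z →
      ∀ t, warmup ε + 2 ≤ t → IsLateIterate β m v b (noiseMap Z) (goodConst m ε L) (1 / √(n : ℝ))
        (powerIter (spiked β v Z) u t) := by
  set t₀ := warmup ε with ht₀
  set N := ⌈1 / ε⌉₊ with hN
  set Q : ℝ := (horizon ε + 2) ^ 2 with hQ
  set c' := min (1 / 2) (c / 4 ^ t₀) with hc'
  have hc'0 : 0 < c' := lt_min (by norm_num) (by positivity)
  have hQ1 : 1 ≤ Q :=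
    one_le_pow₀ (by linarith [(Nat.cast_nonneg (horizon ε) : (0 : ℝ) ≤ horizon ε)])
  have hy := tendsto_natCast_rpow_atTop (show 0 < ε / 4 by positivity)
  filter_upwards [tendsto_sqrt_natCast_atTop.eventually_ge_atTop (Q * L),
    hy.eventually_ge_atTop 4, hy.eventually_ge_atTop (4 / c' ^ m),
    hy.eventually_ge_atTop (2 * (Q * L) / c),
    hy.eventually_ge_atTop (2 ^ (m + 1) * ((m + 1) * 2)),
    hy.eventually_ge_atTop (2 * (stepConst m * ((m + 1) * 2))),
    hy.eventually_ge_atTop (32 * (m + 1) ^ 2 * (stepConst m * ((m + 1) * 2))),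
    eventually_ge_atTop 1]
    with n h1 h2 h3 h4 h5 h6 h7 hn β v u b Z hβ hv hu hb hα hρ hZ t ht
  have hn1 : (1 : ℝ) ≤ n := by exact_mod_cast hn
  have hn0 : (0 : ℝ) ≤ n := by linarith
  have hy4 : ((n : ℝ) ^ (ε / 4)) ^ 4 = (n : ℝ) ^ ε := by
    rw [← Real.rpow_mul_natCast hn0]
    congr 1
    push_cast
    ring
  have H := (hZ.concentrated.isNoisyTrajectory hZ.norm_le hv hu hb)
  have H' : IsLateIterate β m v b (noiseMap Z) (lateConst m) (Q * (L / √(n : ℝ)))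
      (powerIter (spiked β v Z) u t) := by
    refine H.isLateIterate_of_le (t₀ := t₀) (N := N) hm hβ hc hL hQ1 h1 hc'0 (min_le_left _ _)
      (min_le_right _ _) hα (by rw [hy4]; exact hρ) ?_ ?_ h2 h3 h4 h5 h6 h7 ht
    · rw [hy4, Real.sqrt_eq_rpow, ← Real.rpow_mul_natCast hn0]
      refine Real.rpow_le_rpow_of_exponent_le hn1 ?_
      have := Nat.le_ceil (1 / (2 * ε))
      rw [div_le_iff₀ (by positivity)] at this
      rw [ht₀, warmup]
      linarith
    · rw [Real.sqrt_eq_rpow, ← Real.rpow_mul_natCast hn0]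
      refine Real.rpow_le_rpow_of_exponent_le hn1 ?_
      have := Nat.le_ceil (1 / ε)
      rw [div_le_iff₀ (by positivity)] at this
      push_cast
      linarith
  have hlate : 0 ≤ lateConst m := by rw [lateConst]; positivity
  have e : Q * (L / √(n : ℝ)) = Q * L * (1 / √(n : ℝ)) := by ring
  rw [e] at H'
  exact H'.of_mul hlate (one_le_mul_of_one_le_of_one_le hQ1 hL)

end GoodNoise

/-! ### Membership in the interval as a bound on a studentised statistic. -/

section Interval

variable {n : ℕ}

lemma mem_confInterval_iff {α : ℝ} {a w : EuclideanSpace ℝ (Fin n)} {g x : ℝ} (hn : 0 < n)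
    (hα : 0 ≤ criticalValue α) (hg : 1 ≤ g) :
    x ∈ confInterval α a w g ↔
      |g / (1 / √(n : ℝ)) * (inner ℝ a w - x * (1 - 1 / (2 * g ^ 2)))|
        ≤ criticalValue α * √(residualForm a w) := by
  have hs : 0 < √(n : ℝ) := by positivity
  have hg0 : 0 < g := by linarith
  have hd : 0 < 1 - 1 / (2 * g ^ 2) := by
    rw [sub_pos, div_lt_one (by positivity)]
    nlinarith
  have hR : 0 ≤ √(residualForm a w) := Real.sqrt_nonneg _
  rw [confInterval, Set.uIcc_of_le (by gcongr; linarith [mul_nonneg hα (div_nonneg hR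
    (mul_nonneg hs.le hg0.le))]), Set.mem_Icc]
  generalize 1 - 1 / (2 * g ^ 2) = d at hd ⊢
  have e1 : g / (1 / √(n : ℝ)) = √(n : ℝ) * g := by field_simp
  rw [e1, abs_mul, abs_of_pos (mul_pos hs hg0), mul_comm (√(n : ℝ) * g), ← le_div_iff₀
    (mul_pos hs hg0), mul_div_assoc, abs_le, one_div, inv_mul_le_iff₀ hd, le_inv_mul_iff₀ hd,
    mul_comm d x]
  constructor <;> rintro ⟨h1, h2⟩ <;> constructor <;> linarith

lemma residualForm_eq {a w : EuclideanSpace ℝ (Fin n)} (ha : ‖a‖ = 1) :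
    residualForm a w = 1 - inner ℝ a w ^ 2 := by
  rw [residualForm, inner_sub_right, inner_smul_right, real_inner_self_eq_norm_sq, ha,
    real_inner_comm]
  ring

lemma norm_sub_inner_smul_sq {a w : EuclideanSpace ℝ (Fin n)} (ha : ‖a‖ = 1) (hw : ‖w‖ = 1) :
    ‖a - inner ℝ a w • w‖ ^ 2 = residualForm a w := by
  rw [residualForm_eq ha, norm_sub_sq_real, inner_smul_right, norm_smul, ha, hw, mul_one,
    Real.norm_eq_abs, sq_abs]
  ring

end Interval


/-- As log β / log n ≥ ε, the hypothesis on `T` gives T ≥ 3 + 1/(2ε). The margin of three makes both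
of the last two iterates late ones. -/
lemma warmup_add_three_le {ε β : ℝ} {n T : ℕ} (hε : 0 < ε) (hn : 2 ≤ n) (hβ : (n : ℝ) ^ ε ≤ β)
    (hT : 1 + 1 / ε * (1 / 2 + 2 * Real.log |β| / Real.log (n : ℝ)) ≤ (T : ℝ)) :
    warmup ε + 3 ≤ T := by
  have hn' : (1 : ℝ) < n := by exact_mod_cast hn
  have hlog : 0 < Real.log n := Real.log_pos hn'
  have h0 : (0 : ℝ) < (n : ℝ) ^ ε := by positivity
  have h1 : ε ≤ Real.log |β| / Real.log n := by
    rw [le_div_iff₀ hlog, ← Real.log_rpow (by linarith), abs_of_pos (h0.trans_le hβ)]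
    exact Real.log_le_log h0 hβ
  have h2 : 1 / (2 * ε) ≤ ((T - 3 : ℕ) : ℝ) := by
    have h3 : 1 / ε * (1 / 2 + 2 * ε) ≤ 1 / ε * (1 / 2 + 2 * Real.log |β| / Real.log (n : ℝ)) := by
      rw [mul_div_assoc]
      gcongr
    have h4 : 1 / ε * (1 / 2 + 2 * ε) = 1 / (2 * ε) + 2 := by field_simp
    have h5 : (T : ℝ) ≤ ((T - 3 : ℕ) : ℝ) + 3 := by exact_mod_cast (by omega : T ≤ T - 3 + 3)
    linarith
  have h3 : warmup ε ≤ T - 3 := Nat.ceil_le.2 h2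
  have h4 : 3 ≤ T := by
    have : (3 : ℝ) ≤ T := by
      have h3 : 1 / ε * (1 / 2 + 2 * ε)
          ≤ 1 / ε * (1 / 2 + 2 * Real.log |β| / Real.log (n : ℝ)) := by
        rw [mul_div_assoc]
        gcongr
      have h4 : 1 / ε * (1 / 2 + 2 * ε) = 1 / (2 * ε) + 2 := by field_simp
      have h5 : 0 < 1 / (2 * ε) := by positivity
      linarith
    exact_mod_cast this
  omega

lemma abs_sqrt_sub_sqrt_le {p q s : ℝ} (hp : 0 ≤ p) (hs : 0 < s) (hq : s ^ 2 ≤ q) :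
    |√p - √q| ≤ |p - q| / s := by
  have hq0 : 0 ≤ q := (sq_nonneg s).trans hq
  have h1 : s ≤ √q := Real.le_sqrt_of_sq_le hq
  have h2 : (√p - √q) * (√p + √q) = p - q := by
    linear_combination Real.sq_sqrt hp - Real.sq_sqrt hq0
  rw [le_div_iff₀ hs, ← h2, abs_mul]
  gcongr
  exact h1.trans ((le_add_of_nonneg_left (Real.sqrt_nonneg p)).trans (le_abs_self _))

/-- Comparison of two studentized statistics. -/
lemma studentized_comparison {N M S σ s z κ : ℝ} (hz : 0 ≤ z) (hs : 0 < s) (hσ : s ≤ σ)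
    (hκ : 0 ≤ κ) (hN : |N - M| ≤ κ) (hS : |S - σ| ≤ κ) :
    (|M / σ| ≤ z - κ * (1 + z) / s → |N| ≤ z * S) ∧
      (|N| ≤ z * S → |M / σ| ≤ z + κ * (1 + z) / s) := by
  have hσ0 : 0 < σ := hs.trans_le hσ
  have hk : κ * (1 + z) ≤ κ * (1 + z) / s * σ := by
    rw [div_mul_eq_mul_div, le_div_iff₀ hs]
    gcongr
  obtain ⟨S1, S2⟩ := abs_le.1 hS
  have hNM := abs_sub_abs_le_abs_sub N M
  have hMN := abs_sub_abs_le_abs_sub M N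
  rw [abs_sub_comm] at hMN
  rw [abs_div, abs_of_pos hσ0, div_le_iff₀ hσ0, div_le_iff₀ hσ0]
  constructor
  · intro h
    have : z * (σ - κ) ≤ z * S := by gcongr; linarith
    nlinarith
  · intro h
    have : z * S ≤ z * (σ + κ) := by gcongr; linarith
    nlinarith

/-- The studentized linear statistic of the noise that drives the fluctuations. -/
noncomputable def pivot {m n : ℕ} (a v : EuclideanSpace ℝ (Fin n)) (Z : Tensor (m + 1) n) : ℝ :=
  inner ℝ (a - inner ℝ a v • v) (noiseMap Z v) / (1 / √(n : ℝ)) / √(residualForm a v)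

/-- On the good event the studentised statistic differs from its Gaussian counterpart, and the
estimated standard deviation from the true one, by a fixed small κ. This is deterministic and
uniform in the noise, so probabilities are taken only afterwards. -/
lemma eventually_pivot_sandwich {m : ℕ} (hm : 1 ≤ m) {α ε c δ L η : ℝ}
    (hα : 0 ≤ criticalValue α) (hε : 0 < ε) (hc : 0 < c) (hδ : 0 < δ) (hL : 1 ≤ L) (hη : 0 < η)
    {β : ℕ → ℝ} {v u a : ∀ n, EuclideanSpace ℝ (Fin n)} {T : ℕ → ℕ}
    (hβ0 : ∀ᶠ n in atTop, 0 < β n)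
    (hv : ∀ᶠ n in atTop, ‖v n‖ = 1) (hu : ∀ᶠ n in atTop, ‖u n‖ = 1)
    (ha : ∀ᶠ n in atTop, ‖a n‖ = 1)
    (huv : ∀ᶠ n : ℕ in atTop, c / √(n : ℝ) ≤ inner ℝ (v n) (u n))
    (hβ : ∀ᶠ n : ℕ in atTop, (n : ℝ) ^ ε ≤ β n * inner ℝ (v n) (u n) ^ (m - 1))
    (hav : (fun n : ℕ => inner ℝ (a n) (v n)) =o[atTop] fun n : ℕ => β n ^ 3 / √(n : ℝ))
    (hres : ∀ᶠ n in atTop, δ ≤ residualForm (a n) (v n))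
    (hT : ∀ᶠ n : ℕ in atTop,
      1 + 1 / ε * (1 / 2 + 2 * Real.log |β n| / Real.log (n : ℝ)) ≤ (T n : ℝ)) :
    ∀ᶠ n : ℕ in atTop, ∀ Z : Tensor (m + 1) n,
      IsGoodNoise ε L (β n) (v n) (u n) (a n - inner ℝ (a n) (v n) • v n) Z →
        (|pivot (a n) (v n) Z| ≤ criticalValue α - η →
          inner ℝ (a n) (v n) ∈ powerInterval α (spiked (β n) (v n) Z) (u n) (a n) (T n)) ∧
        (inner ℝ (a n) (v n) ∈ powerInterval α (spiked (β n) (v n) Z) (u n) (a n) (T n) →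
          |pivot (a n) (v n) Z| ≤ criticalValue α + η) := by
  set z := criticalValue α
  set C := goodConst m ε L
  have hC : 1 ≤ C := one_le_goodConst m ε hL
  -- Chosen so that the total slack κ(1 + z)/√δ in `studentized_comparison` is exactly η.
  set κ := η * √δ / (1 + z) with hκ
  have hsδ : 0 < √δ := Real.sqrt_pos.2 hδ
  have hκ0 : 0 < κ := by positivity
  have hκη : κ * (1 + z) / √δ = η := by rw [hκ]; field_simp
  have hβn : ∀ᶠ n : ℕ in atTop, (n : ℝ) ^ ε ≤ β n := by
    filter_upwards [hβ, hβ0, hv, hu, huv, eventually_ge_atTop 1] with n h1 h2 h3 h4 h5 h6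
    have hα0 : 0 ≤ inner ℝ (v n) (u n) := le_trans (by positivity) h5
    exact h1.trans (mul_le_of_le_one_right h2.le
      (pow_le_one₀ hα0 (inner_le_one_of_unit h3 h4)))
  have hβtop : Tendsto β atTop atTop := tendsto_atTop_mono' _ hβn (tendsto_natCast_rpow_atTop hε)
  have hβinv : Tendsto (fun n => 1 / β n) atTop (𝓝 0) := by
    simp only [one_div]
    exact tendsto_inv_atTop_zero.comp hβtop
  have hratio : Tendsto (fun n : ℕ => |inner ℝ (a n) (v n)| / (1 / √(n : ℝ) * β n ^ 3)) atTop
      (𝓝 0) := by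
    have h := hav.tendsto_div_nhds_zero.abs
    rw [abs_zero] at h
    refine h.congr' ?_
    filter_upwards [hβ0] with n h1
    have : 0 ≤ β n ^ 3 / √(n : ℝ) := by positivity
    rw [abs_div, abs_of_nonneg this]
    congr 1
    ring
  have herr1 : Tendsto (fun n : ℕ => 100 * estimateConst m C *
      (|inner ℝ (a n) (v n)| / (1 / √(n : ℝ) * β n ^ 3) + 1 / β n)) atTop (𝓝 0) := by
    simpa using (hratio.add hβinv).const_mul (100 * estimateConst m C)
  have herr2 : Tendsto (fun n : ℕ => 20 * C / √δ * (1 / β n)) atTop (𝓝 0) := by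
    simpa using hβinv.const_mul (20 * C / √δ)
  filter_upwards [eventually_isLateIterate (L := L) hm hε hc hL, hβ0, hv, hu, ha, huv, hβ, hres, hT,
    hβn, hβtop.eventually_ge_atTop (estimateConst m C), hβtop.eventually_ge_atTop 2,
    herr1.eventually_le_const hκ0, herr2.eventually_le_const hκ0, eventually_ge_atTop 2]
    with n hlate hβ0 hv hu ha huv hβ hres hT hβn hβE hβ2 he1 he2 hn Z hZ
  have hn0 : 0 < n := by omega
  have hn1 : (1 : ℝ) ≤ n := by exact_mod_cast hn0
  set b := a n - inner ℝ (a n) (v n) • v n with hb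
  have hbsq : ‖b‖ ^ 2 = residualForm (a n) (v n) := norm_sub_inner_smul_sq ha hv
  have hb1 : ‖b‖ ≤ 1 := by
    rw [← sq_le_one_iff₀ (norm_nonneg _), hbsq, residualForm_eq ha]
    linarith [sq_nonneg (inner ℝ (a n) (v n) : ℝ)]
  have hL' := hlate (β n) (v n) (u n) b Z hβ0 hv hu hb1 huv hβ hZ
  -- The expansion needs two consecutive late iterates, at times T - 1 and T.
  obtain ⟨t, ht⟩ : ∃ t, T n = t + 1 := ⟨T n - 1, by
    have := warmup_add_three_le hε hn hβn hT
    omega⟩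
  have ht2 : warmup ε + 2 ≤ t := by
    have := warmup_add_three_le hε hn hβn hT
    omega
  set w' := powerIter (spiked (β n) (v n) Z) (u n) (t + 1) with hw'
  have hstep : w' = ‖signalStep (β n) m (v n) (noiseMap Z)
      (powerIter (spiked (β n) (v n) Z) (u n) t)‖⁻¹ • signalStep (β n) m (v n) (noiseMap Z)
      (powerIter (spiked (β n) (v n) Z) (u n) t) := by
    rw [hw', powerIter_succ, applyPow_spiked_eq_signalStep]
  have hr : 0 < 1 / √(n : ℝ) := by positivity
  have hr1 : 1 / √(n : ℝ) ≤ 1 := by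
    rw [div_le_one (by positivity)]
    exact Real.one_le_sqrt.2 hn1
  have hbn : |inner ℝ b (noiseMap Z (v n))| ≤ C * (1 / √(n : ℝ)) := by
    have h1 := hZ.concentrated.right 0 (Nat.zero_le _)
    rw [explored_probe_zero _ _ hv] at h1
    refine h1.trans ?_
    rw [div_eq_mul_one_div]
    gcongr
    have h2 : 1 ≤ lateConst m * ((horizon ε : ℝ) + 2) ^ 2 := by
      simpa [goodConst] using one_le_goodConst m ε (le_refl 1)
    calc L ≤ lateConst m * ((horizon ε : ℝ) + 2) ^ 2 * L := le_mul_of_one_le_left (by linarith) h2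
      _ = C := by rw [mul_assoc]; rfl
  obtain ⟨g1, g2, g3⟩ := late_estimate hC hv ha hr hr1 hβE hstep hbn (hL' t ht2)
    (hL' (t + 1) (by omega))
  have hw1 : ‖w'‖ = 1 := (hL' (t + 1) (by omega)).norm_eq
  rw [← applyPow_spiked_eq_signalStep, ← betaHat_eq_inner] at g1 g3
  have hinner : ∀ y : EuclideanSpace ℝ (Fin n), ‖y‖ = 1 → |inner ℝ (a n) y| ≤ 1 := by
    intro y hy
    simpa [ha, hy] using abs_real_inner_le_norm (a n) y
  have hS : |√(residualForm (a n) w') - √(residualForm (a n) (v n))| ≤ κ := by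
    have h1 := abs_le.1 (hinner w' hw1)
    have h2 := abs_le.1 (hinner (v n) hv)
    have h0 : 0 ≤ residualForm (a n) w' := by
      rw [residualForm_eq ha, sub_nonneg]
      exact (sq_le_one_iff_abs_le_one _).2 (hinner w' hw1)
    refine (abs_sqrt_sub_sqrt_le h0 hsδ (by rwa [Real.sq_sqrt hδ.le])).trans (le_trans ?_ he2)
    rw [residualForm_eq ha, residualForm_eq ha]
    have e : 1 - inner ℝ (a n) w' ^ 2 - (1 - inner ℝ (a n) (v n) ^ 2)
        = -((inner ℝ (a n) w' + inner ℝ (a n) (v n)) * (inner ℝ (a n) w' - inner ℝ (a n) (v n))) := by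
      ring
    have h3 : |inner ℝ (a n) w' + inner ℝ (a n) (v n)| ≤ 2 := abs_le.2 ⟨by linarith, by linarith⟩
    rw [e, abs_neg, abs_mul]
    calc |inner ℝ (a n) w' + inner ℝ (a n) (v n)| * |inner ℝ (a n) w' - inner ℝ (a n) (v n)| / √δ
        ≤ 2 * (10 * C / β n) / √δ := by gcongr
      _ = 20 * C / √δ * (1 / β n) := by ring
  have key := studentized_comparison hα hsδ (Real.sqrt_le_sqrt hres) hκ0.le (g3.trans he1) hS
  rw [hκη] at key
  rw [powerInterval, ht, mem_confInterval_iff hn0 hα (by linarith)]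
  exact key


/-! ### The Gaussian distribution function and its quantile. -/

section CriticalValue

instance : NullSingletonClass (gaussianReal 0 1) := nullSingletonClass_gaussianReal one_ne_zero

lemma continuous_cdf_gaussianReal : Continuous (cdf (gaussianReal 0 1)) := by
  refine continuous_iff_continuousAt.2 fun x => ?_
  rw [(monotone_cdf _).continuousAt_iff_leftLim_eq_rightLim, StieltjesFunction.rightLim_eq]
  have h1 := (cdf (gaussianReal 0 1)).measure_singleton x
  rw [measure_cdf, measure_singleton, eq_comm, ENNReal.ofReal_eq_zero, sub_nonpos] at h1
  exact le_antisymm ((monotone_cdf _).leftLim_le le_rfl) h1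

lemma cdf_neg_gaussianReal (x : ℝ) :
    cdf (gaussianReal 0 1) (-x) = 1 - cdf (gaussianReal 0 1) x := by
  have h1 : (gaussianReal 0 1).real (Set.Iic (-x)) = (gaussianReal 0 1).real (Set.Ici x) := by
    have h := gaussianReal_map_neg (μ := 0) (v := 1)
    rw [neg_zero] at h
    conv_lhs => rw [← h, map_measureReal_apply (by fun_prop) measurableSet_Iic]
    congr 1
    ext y
    simp
  rw [cdf_eq_real, cdf_eq_real, h1, measureReal_congr Ioi_ae_eq_Ici.symm, ← Set.compl_Iic,
    probReal_compl_eq_one_sub measurableSet_Iic]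

lemma cdf_zero_gaussianReal : cdf (gaussianReal 0 1) 0 = 1 / 2 := by
  have h0 := cdf_neg_gaussianReal 0
  rw [neg_zero] at h0
  linarith

lemma gaussianReal_abs_le_eq {t : ℝ} (ht : 0 ≤ t) :
    (gaussianReal 0 1).real {x | |x| ≤ t} = 2 * cdf (gaussianReal 0 1) t - 1 := by
  have h1 : {x : ℝ | |x| ≤ t} = Set.Iic t \ Set.Iio (-t) := by
    ext x
    simp [abs_le, and_comm]
  rw [h1, measureReal_sdiff (Set.Iio_subset_Iic (by linarith)) measurableSet_Iio,
    measureReal_congr Iio_ae_eq_Iic, ← cdf_eq_real, ← cdf_eq_real, cdf_neg_gaussianReal]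
  ring

/-- No sign condition on `t`: it is applied to z - η, which may be negative, where the left side is
at most zero. -/
lemma le_gaussianReal_abs_le (t : ℝ) :
    2 * cdf (gaussianReal 0 1) t - 1 ≤ (gaussianReal 0 1).real {x | |x| ≤ t} := by
  rcases le_or_gt 0 t with ht | ht
  · exact (gaussianReal_abs_le_eq ht).ge
  · have h1 := monotone_cdf (gaussianReal 0 1) ht.le
    rw [cdf_zero_gaussianReal] at h1
    exact le_trans (by linarith) measureReal_nonneg

variable {α : ℝ}

lemma cdf_criticalValue (hα0 : 0 < α) (hα1 : α < 1) :
    cdf (gaussianReal 0 1) (criticalValue α) = 1 - α / 2 := by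
  obtain ⟨x, hx⟩ : ∃ x, cdf (gaussianReal 0 1) x = 1 - α / 2 :=
    mem_range_of_exists_le_of_exists_ge continuous_cdf_gaussianReal
      ⟨0, by rw [cdf_zero_gaussianReal]; linarith⟩
      (((tendsto_cdf_atTop _).eventually_const_le (by linarith : 1 - α / 2 < 1)).exists)
  have hbdd : BddBelow {x : ℝ | 1 - α / 2 ≤ cdf (gaussianReal 0 1) x} := by
    refine ⟨0, fun y hy => ?_⟩
    by_contra! h
    have h1 := monotone_cdf (gaussianReal 0 1) h.le
    rw [cdf_zero_gaussianReal] at h1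
    have : 1 - α / 2 ≤ cdf (gaussianReal 0 1) y := hy
    linarith
  refine le_antisymm ?_ ?_
  · rw [← hx]
    exact monotone_cdf _ (csInf_le hbdd hx.ge)
  · exact (isClosed_le continuous_const continuous_cdf_gaussianReal).csInf_mem ⟨x, hx.ge⟩ hbdd

lemma criticalValue_nonneg (hα0 : 0 < α) (hα1 : α < 1) : 0 ≤ criticalValue α := by
  by_contra! h
  have h1 := monotone_cdf (gaussianReal 0 1) h.le
  rw [cdf_zero_gaussianReal, cdf_criticalValue hα0 hα1] at h1
  linarith

end CriticalValue

/-! ### Probability of the good event and law of the pivot. -/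

section Noise

variable {m n : ℕ} {Ω : Type*} [MeasurableSpace Ω] {P : Measure Ω}

lemma IsGaussianNoise.hasLaw {k : ℕ} {Z : Ω → Tensor k n} (hZ : IsGaussianNoise P Z) :
    HasLaw Z (iidGaussian (Fin k → Fin n) ((n : NNReal)⁻¹)) P :=
  hZ.indep.hasLaw_pi hZ.law

lemma IsGaussianNoise.hasLaw_flat {Z : Ω → Tensor (m + 1) n} (hZ : IsGaussianNoise P Z) :
    HasLaw (fun ω => flat (Z ω)) (iidGaussian (Fin n × (Fin m → Fin n)) ((n : NNReal)⁻¹)) P :=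
  (hZ.indep.precomp (Fin.consEquiv fun _ : Fin (m + 1) => Fin n).injective).hasLaw_pi
    fun _ => hZ.law _

variable {Z : Ω → Tensor (m + 1) n} (hZ : IsGaussianNoise P Z)
include hZ

lemma IsGaussianNoise.measure_not_isGoodNoise_le (hn : 0 < n)
    (hk : 2 * ((m + 1 : ℕ) : ℝ) ≤ √(n : ℝ)) {ε L : ℝ} (hL : 0 < L) (β : ℝ)
    {v b : EuclideanSpace ℝ (Fin n)} (u : EuclideanSpace ℝ (Fin n)) (hv : ‖v‖ ≤ 1) (hb : ‖b‖ ≤ 1) :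
    P {ω | ¬ IsGoodNoise ε L β v u b (Z ω)}
      ≤ ENNReal.ofReal (concentrationConst (horizon ε + 1) / L ^ 2)
        + ENNReal.ofReal ((2 * n + 1) ^ (n * (m + 1))
          * (2 * Real.exp (-(n * ((n : ℝ) ^ (ε / 4)) ^ 2) / 2))) := by
  have h1 : P {ω | ¬ IsConcentrated (explored (probe m β v u) (flat (Z ω))) (flat (Z ω))
      (horizon ε + 1) (L / √(n : ℝ)) v b}
      ≤ ENNReal.ofReal (concentrationConst (horizon ε + 1) / L ^ 2) := by
    refine le_trans ?_ (measure_not_isConcentrated_le (isAdapted_probe (m := m) β v u) hn (horizon ε + 1)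
      hL hv hb)
    rw [← hZ.hasLaw_flat.map_eq]
    -- Only this inequality for the pushforward is used, so measurability of the good event is never
    -- needed.
    exact Measure.le_map_apply hZ.hasLaw_flat.aemeasurable _
  have h2 : P {ω | 2 * (n : ℝ) ^ (ε / 4) < ‖tensorForm (Z ω)‖}
      ≤ ENNReal.ofReal ((2 * n + 1) ^ (n * (m + 1))
          * (2 * Real.exp (-(n * ((n : ℝ) ^ (ε / 4)) ^ 2) / 2))) := by
    refine le_trans ?_ (measure_lt_norm_tensorForm_le hn hk (by positivity))
    rw [← hZ.hasLaw.map_eq]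
    exact Measure.le_map_apply hZ.hasLaw.aemeasurable _
  refine le_trans (measure_mono ?_) ((measure_union_le _ _).trans (add_le_add h1 h2))
  intro ω hω
  by_contra h
  simp only [Set.mem_union, Set.mem_ofPred_eq, not_or, not_not, not_lt] at h
  exact hω ⟨h.1, h.2⟩

/-- The normalised test vector has squared norm n against noise variance 1/n, so the pivot is
exactly standard normal in every dimension n > 0. -/
lemma IsGaussianNoise.hasLaw_pivot (hn : 0 < n) {a v : EuclideanSpace ℝ (Fin n)} (ha : ‖a‖ = 1)
    (hv : ‖v‖ = 1) (hres : 0 < residualForm a v) :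
    HasLaw (fun ω => pivot a v (Z ω)) (gaussianReal 0 1) P := by
  have hn' : (n : ℝ) ≠ 0 := by positivity
  set y := (1 / (1 / √(n : ℝ)) / √(residualForm a v)) • (a - inner ℝ a v • v)
  have h1 : (fun ω => pivot a v (Z ω))
      = (fun W => inner ℝ y (op W (powVec m v))) ∘ fun ω => flat (Z ω) := by
    ext ω
    simp only [pivot, noiseMap, y, Function.comp, inner_smul_left, conj_trivial]
    ring
  have hy : ‖y‖ ^ 2 = n := by
    rw [norm_smul, mul_pow, norm_sub_inner_smul_sq ha hv, Real.norm_eq_abs, sq_abs, one_div_one_div,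
      div_pow, Real.sq_sqrt hres.le, Real.sq_sqrt (Nat.cast_nonneg n)]
    field_simp
  have h2 := map_inner_op ((n : NNReal)⁻¹) y (powVec m v) 1 (by
    rw [hy, norm_powVec, hv]
    push_cast
    field_simp
    simp)
  rw [h1]
  refine HasLaw.comp ⟨?_, h2⟩ hZ.hasLaw_flat
  exact (measurable_const.inner (measurable_op_const _)).aemeasurable

end Noise


/-- Coverage when the signal strength and the initial correlation are positive. -/
theorem tendsto_coverage_of_pos {m : ℕ} (hm : 1 ≤ m) {α ε c δ : ℝ} (hα0 : 0 < α) (hα1 : α < 1)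
    (hε : 0 < ε) (hc : 0 < c) (hδ : 0 < δ)
    {Ω : ℕ → Type*} [∀ n, MeasurableSpace (Ω n)] {P : ∀ n, Measure (Ω n)}
    [∀ n, IsProbabilityMeasure (P n)] {Z : ∀ n, Ω n → Tensor (m + 1) n}
    (hZ : ∀ n, IsGaussianNoise (P n) (Z n))
    {β : ℕ → ℝ} {v u a : ∀ n, EuclideanSpace ℝ (Fin n)} {T : ℕ → ℕ}
    (hβ0 : ∀ᶠ n in atTop, 0 < β n)
    (hv : ∀ᶠ n in atTop, ‖v n‖ = 1) (hu : ∀ᶠ n in atTop, ‖u n‖ = 1)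
    (ha : ∀ᶠ n in atTop, ‖a n‖ = 1)
    (huv : ∀ᶠ n : ℕ in atTop, c / √(n : ℝ) ≤ inner ℝ (v n) (u n))
    (hβ : ∀ᶠ n : ℕ in atTop, (n : ℝ) ^ ε ≤ β n * inner ℝ (v n) (u n) ^ (m - 1))
    (hav : (fun n : ℕ => inner ℝ (a n) (v n)) =o[atTop] fun n : ℕ => β n ^ 3 / √(n : ℝ))
    (hres : ∀ᶠ n in atTop, δ ≤ residualForm (a n) (v n))
    (hT : ∀ᶠ n : ℕ in atTop,
      1 + 1 / ε * (1 / 2 + 2 * Real.log |β n| / Real.log (n : ℝ)) ≤ (T n : ℝ)) :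
    Tendsto (fun n => (P n).real {ω | inner ℝ (a n) (v n) ∈
      powerInterval α (spiked (β n) (v n) (Z n ω)) (u n) (a n) (T n)}) atTop (𝓝 (1 - α)) := by
  have hz := criticalValue_nonneg hα0 hα1
  set z := criticalValue α with hzdef
  have hF : Tendsto (fun t => 2 * cdf (gaussianReal 0 1) t - 1) (𝓝 z) (𝓝 (1 - α)) := by
    have h1 : 1 - α = 2 * cdf (gaussianReal 0 1) z - 1 := by
      rw [hzdef, cdf_criticalValue hα0 hα1]
      ring
    rw [h1]
    exact ((continuous_cdf_gaussianReal.tendsto z).const_mul 2).sub_const 1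
  rw [Metric.tendsto_nhds]
  intro τ hτ
  -- Order of choices: the tolerance τ fixes η by continuity of Φ, then `L` so that concentration
  -- fails with probability at most τ/8, and only then n is taken large.
  obtain ⟨θ, hθ, hFθ⟩ := Metric.tendsto_nhds_nhds.1 hF (τ / 2) (by positivity)
  set η := θ / 2 with hη
  have hη0 : 0 < η := by positivity
  have hF1 := hFθ (x := z + η) (by rw [Real.dist_eq, add_sub_cancel_left, abs_of_pos hη0]; linarith)
  have hF2 := hFθ (x := z - η) (by
    rw [Real.dist_eq, sub_sub_cancel_left, abs_neg, abs_of_pos hη0]; linarith)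
  rw [Real.dist_eq, abs_lt] at hF1 hF2
  have hLlim : Tendsto (fun L : ℝ => concentrationConst (horizon ε + 1) / L ^ 2) atTop (𝓝 0) :=
    tendsto_const_nhds.div_atTop (tendsto_pow_atTop two_ne_zero)
  obtain ⟨L, hLτ, hL1⟩ := ((hLlim.eventually_le_const (by positivity : 0 < τ / 8)).and
    (eventually_ge_atTop 1)).exists
  have hL0 : 0 < L := by linarith
  filter_upwards [eventually_pivot_sandwich hm hz hε hc hδ hL1 hη0 hβ0 hv hu ha huv hβ hav hres hT,
    hv, ha, hres,
    (tendsto_grid_bound (m + 1) (by positivity : 0 < ε / 4)).eventually_le_const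
      (by positivity : 0 < τ / 8),
    tendsto_sqrt_natCast_atTop.eventually_ge_atTop (2 * ((m + 1 : ℕ) : ℝ)), eventually_gt_atTop 0]
    with n hsand hv ha hres hgrid hk hn
  set b := a n - inner ℝ (a n) (v n) • v n with hb
  have hb1 : ‖b‖ ≤ 1 := by
    rw [← sq_le_one_iff₀ (norm_nonneg _), norm_sub_inner_smul_sq ha hv, residualForm_eq ha]
    linarith [sq_nonneg (inner ℝ (a n) (v n) : ℝ)]
  have hbad : (P n).real {ω | ¬ IsGoodNoise ε L (β n) (v n) (u n) b (Z n ω)} ≤ τ / 4 := by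
    refine ENNReal.toReal_le_of_le_ofReal (by positivity) ?_
    refine ((hZ n).measure_not_isGoodNoise_le hn hk hL0 (β n) (u n) hv.le hb1).trans ?_
    have e : τ / 4 = τ / 8 + τ / 8 := by ring
    rw [e, ENNReal.ofReal_add (by positivity) (by positivity)]
    exact add_le_add (ENNReal.ofReal_le_ofReal hLτ) (ENNReal.ofReal_le_ofReal hgrid)
  have hlaw := (hZ n).hasLaw_pivot hn ha hv (hδ.trans_le hres)
  have hpiv : ∀ t, (P n).real {ω | |pivot (a n) (v n) (Z n ω)| ≤ t}
      = (gaussianReal 0 1).real {x | |x| ≤ t} := fun t =>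
    hlaw.measureReal_eq (p := fun x => |x| ≤ t) (measurableSet_le measurable_norm measurable_const)
  have hup : (P n).real {ω | inner ℝ (a n) (v n) ∈
      powerInterval α (spiked (β n) (v n) (Z n ω)) (u n) (a n) (T n)}
      ≤ (gaussianReal 0 1).real {x | |x| ≤ z + η} + τ / 4 := by
    rw [← hpiv]
    refine le_trans (measureReal_mono (fun ω hω => ?_)) ((measureReal_union_le _ _).trans
      (add_le_add_right hbad _))
    by_cases hg : IsGoodNoise ε L (β n) (v n) (u n) b (Z n ω)
    · exact Or.inl ((hsand _ hg).2 hω)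
    · exact Or.inr hg
  have hlow : (gaussianReal 0 1).real {x | |x| ≤ z - η}
      ≤ (P n).real {ω | inner ℝ (a n) (v n) ∈
        powerInterval α (spiked (β n) (v n) (Z n ω)) (u n) (a n) (T n)} + τ / 4 := by
    rw [← hpiv]
    refine le_trans (measureReal_mono (fun ω hω => ?_)) ((measureReal_union_le _ _).trans
      (add_le_add_right hbad _))
    by_cases hg : IsGoodNoise ε L (β n) (v n) (u n) b (Z n ω)
    · exact Or.inl ((hsand _ hg).1 hω)
    · exact Or.inr hg
  rw [gaussianReal_abs_le_eq (by linarith)] at hup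
  have hlow' := le_gaussianReal_abs_le (z - η)
  rw [Real.dist_eq, abs_lt]
  constructor <;> linarith


/-! ### Reduction to positive signal strength and positive initial correlation. -/

section Sign

variable {m n : ℕ}

lemma sq_eq_one_iff_abs {s : ℝ} : s ^ 2 = 1 ↔ |s| = 1 := by
  rw [← sq_abs, pow_eq_one_iff_of_nonneg (abs_nonneg s) two_ne_zero]

lemma applyPow_smul (σ : ℝ) (X : Tensor (m + 1) n) (w : EuclideanSpace ℝ (Fin n)) :
    applyPow (σ • X) w = σ • applyPow X w := by
  ext i
  simp [applyPow, tensorInner, Finset.mul_sum, mul_assoc]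

lemma applyPow_smul_right (s : ℝ) (X : Tensor (m + 1) n) (w : EuclideanSpace ℝ (Fin n)) :
    applyPow X (s • w) = s ^ m • applyPow X w := by
  have h : powVec m (s • w) = s ^ m • powVec m w := by
    ext j
    simp [Finset.prod_mul_distrib]
  rw [applyPow_eq_op, applyPow_eq_op, h, map_smul]

lemma spiked_smul (σ β : ℝ) (v : EuclideanSpace ℝ (Fin n)) (Z : Tensor (m + 1) n) :
    spiked (σ * β) v (σ • Z) = σ • spiked β v Z := by
  rw [spiked, spiked, smul_add, mul_smul]

/-- Signs of the iterates relative to those started from `s • u` with the tensor `σ • X`. -/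
def iterSign (m : ℕ) (σ s : ℝ) : ℕ → ℝ
  | 0 => s
  | t + 1 => σ * iterSign m σ s t ^ m

variable {σ s : ℝ}

lemma abs_iterSign (hσ : |σ| = 1) (hs : |s| = 1) (t : ℕ) : |iterSign m σ s t| = 1 := by
  induction t with
  | zero => exact hs
  | succ t ih => rw [iterSign, abs_mul, abs_pow, ih, hσ, one_pow, one_mul]

lemma iterSign_of_even (hm : Even m) (hσ : |σ| = 1) (hs : |s| = 1) {t : ℕ} (ht : 1 ≤ t) :
    iterSign m σ s t = σ := by
  obtain ⟨t, rfl⟩ : ∃ l, t = l + 1 := ⟨t - 1, by omega⟩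
  rw [iterSign, ← hm.pow_abs, abs_iterSign hσ hs, one_pow, mul_one]

lemma iterSign_of_odd (hm : Odd m) (hσ : |σ| = 1) (hs : |s| = 1) (t : ℕ) :
    iterSign m σ s t = σ ^ t * s := by
  induction t with
  | zero => simp [iterSign]
  | succ t ih =>
    obtain ⟨l, rfl⟩ := hm
    have h := sq_eq_one_iff_abs.2 (abs_iterSign (m := 2 * l + 1) hσ hs t)
    rw [iterSign, pow_succ, pow_mul, h, ih]
    ring

/-- A step is linear in the tensor and homogeneous of degree m in the iterate, so flipping the signs
of tensor and initialisation only changes the signs of the iterates. -/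
lemma powerIter_eq_smul (hσ : |σ| = 1) (hs : |s| = 1) (X : Tensor (m + 1) n)
    (u : EuclideanSpace ℝ (Fin n)) (t : ℕ) :
    powerIter X u t = iterSign m σ s t • powerIter (σ • X) (s • u) t := by
  induction t with
  | zero =>
    rw [powerIter, powerIter, iterSign, smul_smul, ← sq, sq_eq_one_iff_abs.2 hs, one_smul]
  | succ t ih =>
    have h1 : applyPow X (powerIter X u t)
        = iterSign m σ s (t + 1) • applyPow (σ • X) (powerIter (σ • X) (s • u) t) := by
      rw [ih, applyPow_smul_right, applyPow_smul, smul_smul, iterSign]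
      congr 1
      have := sq_eq_one_iff_abs.2 hσ
      linear_combination -(iterSign m σ s t ^ m) * this
    rw [powerIter_succ, powerIter_succ, h1, norm_smul, Real.norm_eq_abs, abs_iterSign hσ hs,
      one_mul, smul_comm]

lemma betaHat_smul_smul (σ s : ℝ) (X : Tensor (m + 1) n) (w : EuclideanSpace ℝ (Fin n)) :
    betaHat (σ • X) (s • w) = σ * s ^ (m + 1) * betaHat X w := by
  rw [betaHat_eq_inner, betaHat_eq_inner, applyPow_smul, applyPow_smul_right, inner_smul_left,
    inner_smul_right, inner_smul_right, conj_trivial]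
  ring

/-- The interval depends on `g` only through g² and a half-width that is odd in `g`; a sign flip at
most swaps the endpoints, to which the unordered interval is insensitive. -/
lemma mem_confInterval_smul_iff (hσ : |σ| = 1) (hs : |s| = 1) {α : ℝ}
    (a w : EuclideanSpace ℝ (Fin n)) (g x : ℝ) :
    s * x ∈ confInterval α a (s • w) (σ * g) ↔ x ∈ confInterval α a w g := by
  have hσ2 := sq_eq_one_iff_abs.2 hσ
  have hs2 := sq_eq_one_iff_abs.2 hs
  have hR : residualForm a (s • w) = residualForm a w := by
    rw [residualForm, residualForm, inner_smul_left, smul_smul, conj_trivial,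
      show s * inner ℝ w a * s = s ^ 2 * inner ℝ w a by ring, hs2, one_mul]
  have he : ∀ r q : ℝ, r / (q * (σ * g)) = σ * (r / (q * g)) := by
    intro r q
    have : σ⁻¹ = σ := by
      rw [inv_eq_iff_eq_inv, eq_comm]
      exact inv_eq_of_mul_eq_one_right (by rw [← sq, hσ2])
    rw [div_eq_mul_inv, div_eq_mul_inv, mul_inv, mul_inv, mul_inv, this]
    ring
  rw [confInterval, confInterval, hR, mul_pow, hσ2, one_mul, inner_smul_right, he]
  generalize 1 / (1 - 1 / (2 * g ^ 2)) = d
  generalize √(residualForm a w) / (√(n : ℝ) * g) = e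
  generalize inner ℝ a w = y
  rw [Set.mem_uIcc, Set.mem_uIcc]
  rcases eq_or_eq_neg_of_abs_eq hσ with rfl | rfl <;> rcases eq_or_eq_neg_of_abs_eq hs with rfl | rfl
  · simp
  · constructor <;> rintro (⟨h1, h2⟩ | ⟨h1, h2⟩)
    · exact Or.inl ⟨by linarith, by linarith⟩
    · exact Or.inr ⟨by linarith, by linarith⟩
    · exact Or.inl ⟨by linarith, by linarith⟩
    · exact Or.inr ⟨by linarith, by linarith⟩
  · constructor <;> rintro (⟨h1, h2⟩ | ⟨h1, h2⟩)
    · exact Or.inr ⟨by linarith, by linarith⟩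
    · exact Or.inl ⟨by linarith, by linarith⟩
    · exact Or.inr ⟨by linarith, by linarith⟩
    · exact Or.inl ⟨by linarith, by linarith⟩
  · constructor <;> rintro (⟨h1, h2⟩ | ⟨h1, h2⟩)
    · exact Or.inr ⟨by linarith, by linarith⟩
    · exact Or.inl ⟨by linarith, by linarith⟩
    · exact Or.inr ⟨by linarith, by linarith⟩
    · exact Or.inl ⟨by linarith, by linarith⟩

lemma mem_powerInterval_iff (hσ : |σ| = 1) (hs : |s| = 1) (α : ℝ) (X : Tensor (m + 1) n)
    (u a v : EuclideanSpace ℝ (Fin n)) (t : ℕ) :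
    inner ℝ a (iterSign m σ s t • v) ∈ powerInterval α X u a t
      ↔ inner ℝ a v ∈ powerInterval α (σ • X) (s • u) a t := by
  have hσ2 := sq_eq_one_iff_abs.2 hσ
  have hX : X = σ • σ • X := by rw [smul_smul, ← sq, hσ2, one_smul]
  have hs' := abs_iterSign (m := m) hσ hs t
  have hb : betaHat X (powerIter X u t) = (σ * iterSign m σ s t ^ (m + 1))
      * betaHat (σ • X) (powerIter (σ • X) (s • u) t) := by
    conv_lhs => rw [powerIter_eq_smul hσ hs, hX]
    rw [betaHat_smul_smul, ← hX]
  rw [powerInterval, powerInterval, hb, powerIter_eq_smul hσ hs X u t, inner_smul_right]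
  refine mem_confInterval_smul_iff ?_ hs' a _ _ _
  rw [abs_mul, abs_pow, hs', hσ, one_pow, one_mul]

lemma IsGaussianNoise.smul {Ω : Type*} [MeasurableSpace Ω] {P : Measure Ω}
    {Z : Ω → Tensor (m + 1) n} (hZ : IsGaussianNoise P Z) (hσ : |σ| = 1) :
    IsGaussianNoise P fun ω => σ • Z ω where
  indep := hZ.indep.comp (fun _ x => σ * x) fun _ => measurable_const_mul σ
  law j := by
    have h := gaussianReal_const_mul (hZ.law j) σ
    have e : (.mk (σ ^ 2) (sq_nonneg _) : NNReal) * (n : NNReal)⁻¹ = (n : NNReal)⁻¹ := by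
      ext
      push_cast
      simp [sq_eq_one_iff_abs.2 hσ]
    rw [mul_zero] at h
    exact e ▸ h

end Sign

/-- Coverage for signs of the signal strength and of the initial correlation given by `σ`, `s`. -/
theorem tendsto_coverage {m : ℕ} (hm : 1 ≤ m) {α ε c δ : ℝ} (hα0 : 0 < α) (hα1 : α < 1)
    (hε : 0 < ε) (hc : 0 < c) (hδ : 0 < δ)
    {Ω : ℕ → Type*} [∀ n, MeasurableSpace (Ω n)] {P : ∀ n, Measure (Ω n)}
    [∀ n, IsProbabilityMeasure (P n)] {Z : ∀ n, Ω n → Tensor (m + 1) n}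
    (hZ : ∀ n, IsGaussianNoise (P n) (Z n))
    {β : ℕ → ℝ} {v u a : ∀ n, EuclideanSpace ℝ (Fin n)} {T : ℕ → ℕ}
    (hv : ∀ᶠ n in atTop, ‖v n‖ = 1) (hu : ∀ᶠ n in atTop, ‖u n‖ = 1)
    (ha : ∀ᶠ n in atTop, ‖a n‖ = 1)
    (huv : ∀ᶠ n : ℕ in atTop, c / √(n : ℝ) ≤ |inner ℝ (u n) (v n)|)
    (hβ : ∀ᶠ n : ℕ in atTop, (n : ℝ) ^ ε ≤ |β n * inner ℝ (u n) (v n) ^ (m - 1)|)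
    (hav : (fun n : ℕ => inner ℝ (a n) (v n)) =o[atTop] fun n : ℕ => β n ^ 3 / √(n : ℝ))
    (hres : ∀ᶠ n in atTop, δ ≤ residualForm (a n) (v n))
    (hT : ∀ᶠ n : ℕ in atTop,
      1 + 1 / ε * (1 / 2 + 2 * Real.log |β n| / Real.log (n : ℝ)) ≤ (T n : ℝ))
    {σ : ℝ} (hσ : |σ| = 1) (hσβ : ∀ᶠ n in atTop, 0 < σ * β n) :
    Tendsto (fun n => (P n).real {ω | inner ℝ (a n)
        (iterSign m σ (Real.sign (inner ℝ (u n) (v n))) (T n) • v n) ∈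
      powerInterval α (spiked (β n) (v n) (Z n ω)) (u n) (a n) (T n)}) atTop (𝓝 (1 - α)) := by
  set s : ℕ → ℝ := fun n => Real.sign (inner ℝ (u n) (v n)) with hsdef
  have hβabs : ∀ᶠ n in atTop, σ * β n = |β n| := by
    filter_upwards [hσβ] with n h
    rw [← abs_of_pos h, abs_mul, hσ, one_mul]
  have hinner : ∀ n, inner ℝ (v n) (s n • u n) = |inner ℝ (u n) (v n)| := by
    intro n
    rw [inner_smul_right, real_inner_comm]
    change Real.sign (inner ℝ (u n) (v n)) * _ = _
    rcases lt_trichotomy (inner ℝ (u n) (v n) : ℝ) 0 with h | h | h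
    · rw [Real.sign_of_neg h, abs_of_neg h, neg_one_mul]
    · rw [h, mul_zero, abs_zero]
    · rw [Real.sign_of_pos h, abs_of_pos h, one_mul]
  have hs : ∀ᶠ n in atTop, |s n| = 1 := by
    filter_upwards [huv, eventually_gt_atTop 0] with n h hn
    have h0 : inner ℝ (u n) (v n) ≠ 0 := abs_pos.1 (lt_of_lt_of_le (by positivity) h)
    rcases Real.sign_apply_eq_of_ne_zero _ h0 with h1 | h1 <;> simp [hsdef, h1]
  -- Positive case for the strength σβ, the noise σZ (again i.i.d. with the same law, by symmetry)
  -- and the start s u, whose correlation with `v` is |⟨u,v⟩|.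
  have key := tendsto_coverage_of_pos hm hα0 hα1 hε hc hδ (fun n => (hZ n).smul hσ) hσβ hv
    (u := fun n => s n • u n) (T := T) (by
      filter_upwards [hu, hs] with n h1 h2
      rw [norm_smul, h1, Real.norm_eq_abs, h2, one_mul]) ha
    (by simpa only [hinner] using huv)
    (by
      filter_upwards [hβ, hβabs] with n h1 h2
      rwa [hinner, h2, ← abs_pow, ← abs_mul])
    (by
      refine hav.trans_isBigO (IsBigO.of_bound 1 (Eventually.of_forall fun n => ?_))
      rw [one_mul, mul_pow, norm_div, norm_div, norm_mul, norm_pow σ, Real.norm_eq_abs σ, hσ,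
        one_pow, one_mul])
    hres (by
      filter_upwards [hT, hβabs] with n h1 h2
      rwa [h2, abs_abs])
  refine key.congr' ?_
  filter_upwards [hs] with n hs
  congr 1
  ext ω
  simp only [Set.mem_ofPred_eq, spiked_smul]
  exact (mem_powerInterval_iff hσ hs α _ _ _ _ _).symm

end SpikedTensor

theorem corollary2p4
    (k : ℕ) (hk : 2 ≤ k)
    (α : ℝ) (hα0 : 0 < α) (hα1 : α < 1)
    (ε : ℝ) (hε : 0 < ε)
    -- for every dimension `n`: the noise tensor, on a probability space of its own
    (Ω : ℕ → Type*) [∀ n, MeasurableSpace (Ω n)]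
    (P : ∀ n, Measure (Ω n)) [∀ n, IsProbabilityMeasure (P n)]
    (Z : ∀ n, Ω n → SpikedTensor.Tensor k n)
    (hZ : ∀ n, SpikedTensor.IsGaussianNoise (P n) (Z n))
    -- signal strength, signal, initialization, test vector, number of iterations
    (β : ℕ → ℝ) (v u a : ∀ n, EuclideanSpace ℝ (Fin n)) (T : ℕ → ℕ)
    (hv : ∀ᶠ n in atTop, ‖v n‖ = 1)
    (hu : ∀ᶠ n in atTop, ‖u n‖ = 1)
    (ha : ∀ᶠ n in atTop, ‖a n‖ = 1)
    (c : ℝ) (hc : 0 < c)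
    (huv : ∀ᶠ n : ℕ in atTop, c / √(n : ℝ) ≤ |inner ℝ (u n) (v n)|)
    (hβ : ∀ᶠ n : ℕ in atTop, (n : ℝ) ^ ε ≤ |β n * inner ℝ (u n) (v n) ^ (k - 2)|)
    (hav : (fun n : ℕ => inner ℝ (a n) (v n)) =o[atTop] fun n : ℕ => β n ^ 3 / √(n : ℝ))
    -- `a` stays away from the line spanned by `v`
    (δ : ℝ) (hδ : 0 < δ)
    (hres : ∀ᶠ n in atTop, δ ≤ SpikedTensor.residualForm (a n) (v n))
    (hT : ∀ᶠ n : ℕ in atTop,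
      1 + 1 / ε * (1 / 2 + 2 * Real.log |β n| / Real.log (n : ℝ)) ≤ (T n : ℝ)) :
    (Odd k → (∀ᶠ n in atTop, 0 < β n) →
      Tendsto (fun n => (P n).real {ω | inner ℝ (a n) (v n) ∈
          SpikedTensor.powerInterval α (SpikedTensor.spiked (β n) (v n) (Z n ω)) (u n) (a n) (T n)})
        atTop (𝓝 (1 - α))) ∧
    (Odd k → (∀ᶠ n in atTop, β n < 0) →
      Tendsto (fun n => (P n).real {ω | inner ℝ (a n) (-v n) ∈
          SpikedTensor.powerInterval α (SpikedTensor.spiked (β n) (v n) (Z n ω)) (u n) (a n) (T n)})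
        atTop (𝓝 (1 - α))) ∧
    (Even k → (∀ᶠ n in atTop, 0 < β n) →
      Tendsto (fun n => (P n).real {ω | inner ℝ (a n) (Real.sign (inner ℝ (u n) (v n)) • v n) ∈
          SpikedTensor.powerInterval α (SpikedTensor.spiked (β n) (v n) (Z n ω)) (u n) (a n) (T n)})
        atTop (𝓝 (1 - α))) ∧
    (Even k → (∀ᶠ n in atTop, β n < 0) →
      Tendsto (fun n => (P n).real
          {ω | inner ℝ (a n) (((-1) ^ T n * Real.sign (inner ℝ (u n) (v n))) • v n) ∈
          SpikedTensor.powerInterval α (SpikedTensor.spiked (β n) (v n) (Z n ω)) (u n) (a n) (T n)})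
        atTop (𝓝 (1 - α))) := by
  obtain ⟨m, rfl⟩ : ∃ m, k = m + 1 := ⟨k - 1, by omega⟩
  have hm : 1 ≤ m := by omega
  have hm2 : m + 1 - 2 = m - 1 := by omega
  rw [hm2] at hβ
  have hβn : ∀ᶠ n : ℕ in atTop, (n : ℝ) ^ ε ≤ |β n| := by
    filter_upwards [hβ, hu, hv] with n h1 h2 h3
    rw [abs_mul, abs_pow] at h1
    refine h1.trans (mul_le_of_le_one_right (abs_nonneg _) (pow_le_one₀ (abs_nonneg _) ?_))
    simpa [h2, h3] using abs_real_inner_le_norm (u n) (v n)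
  have hT1 : ∀ᶠ n in atTop, 1 ≤ T n := by
    filter_upwards [hβn, hT, eventually_ge_atTop 2] with n h1 h2 h3
    have := SpikedTensor.warmup_add_three_le hε h3 h1 (by rwa [abs_abs])
    omega
  have hs : ∀ᶠ n in atTop, |Real.sign (inner ℝ (u n) (v n))| = 1 := by
    filter_upwards [huv, eventually_gt_atTop 0] with n h hn
    have h0 : inner ℝ (u n) (v n) ≠ 0 := abs_pos.1 (lt_of_lt_of_le (by positivity) h)
    rcases Real.sign_apply_eq_of_ne_zero _ h0 with h1 | h1 <;> simp [h1]
  have key := fun {σ : ℝ} => SpikedTensor.tendsto_coverage (σ := σ) hm hα0 hα1 hε hc hδ hZ hv hu ha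
    huv hβ hav hres hT
  have hpos : (∀ᶠ n in atTop, 0 < β n) → ∀ᶠ n in atTop, 0 < 1 * β n := fun h => by
    simpa only [one_mul] using h
  have hneg : (∀ᶠ n in atTop, β n < 0) → ∀ᶠ n in atTop, 0 < -1 * β n := fun h => by
    simpa only [neg_one_mul, neg_pos] using h
  have h1 : |(1 : ℝ)| = 1 := abs_one
  have h2 : |(-1 : ℝ)| = 1 := by simp
  -- Parity flips in passing to m = k - 1. For odd k the iterate's sign is that of β from time 1 on,
  -- which is why T ≥ 1 is needed; for even k it is sgn(β)^T times the initial sign.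
  refine ⟨fun hk h => ?_, fun hk h => ?_, fun hk h => ?_, fun hk h => ?_⟩
  · refine (key h1 (hpos h)).congr' ?_
    filter_upwards [hT1, hs] with n hT hs
    rw [SpikedTensor.iterSign_of_even (by simpa using Nat.Odd.sub_odd hk odd_one) h1 hs hT, one_smul]
  · refine (key h2 (hneg h)).congr' ?_
    filter_upwards [hT1, hs] with n hT hs
    rw [SpikedTensor.iterSign_of_even (by simpa using Nat.Odd.sub_odd hk odd_one) h2 hs hT,
      neg_one_smul]
  · refine (key h1 (hpos h)).congr' ?_
    filter_upwards [hs] with n hs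
    rw [SpikedTensor.iterSign_of_odd (by simpa using Nat.Even.sub_odd (by omega) hk odd_one) h1 hs,
      one_pow, one_mul]
  · refine (key h2 (hneg h)).congr' ?_
    filter_upwards [hs] with n hs
    rw [SpikedTensor.iterSign_of_odd (by simpa using Nat.Even.sub_odd (by omega) hk odd_one) h2 hs]
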